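/- Let $\mathcal M$ be the set of Borel probability measures on $\mathbb R^D$ with finite second moment, with the weak-$*$ topology defined by continuous test functions of at most quadratic growth (the topology of the Wasserstein distance $W_2$). Let $\Gamma_o(\mu,\nu)$ be the set of optimal couplings for the cost $|x-y|^2$. Let $\mathcal X_c$ be the space of compactly supported smooth vector fields on $\mathbb R^D$, let $T_\mu\mathcal M$ be the closure of $\nabla C_c^\infty(\mathbb R^D)$ in $L^2(\mu)=L^2(\mu;\mathbb R^D)$, and let $\pi_\mu:L^2(\mu)\to T_\mu\mathcal M$ be the orthogonal projection. A function $F:\mathcal M\to\mathbb R$ is differentiable at $\mu$ if there is $\xi\in L^2(\mu)$ such that $F(\nu)=F(\mu)+\iint\langle\xi(x),y-x\rangle\,d\gamma(x,y)+o(W_2(\mu,\nu))$ as $\nu\to\mu$, uniformly in $\gamma\in\Gamma_o(\mu,\nu)$; then $\nabla_\mu F:=\pi_\mu(\xi)$, and $X(F)(\mu):=\int\langle\nabla_\mu F,X\rangle\,d\mu$ for $X\in\mathcal X_c$. A 1-form is a family $\Lambda_\mu\in(T_\mu\mathcal M)^*$, $\mu\in\mathcal M$; put $\bar\Lambda_\mu:=\Lambda_\mu\circ\pi_\mu$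 on $L^2(\mu)$. It is differentiable if $\mu\mapsto\bar\Lambda_\mu(X)$ is differentiable at every $\mu$ for every $X\in\mathcal X_c$ and if, with $$d\Lambda(X,Y):=X\bar\Lambda(Y)-Y\bar\Lambda(X)-\bar\Lambda([X,Y]),\qquad [X,Y]=\nabla Y\cdot X-\nabla X\cdot Y,$$ for each $\mu$ there is $c_\mu$ with $|d\Lambda_\mu(\nabla f,\nabla g)|\le c_\mu\|\nabla f\|_\mu\|\nabla g\|_\mu$ for all $f,g\in C_c^\infty(\mathbb R^D)$. Then $d\Lambda_\mu$ extends uniquely to a continuous bilinear form on $T_\mu\mathcal M$; let $\|d\Lambda_\mu\|$ be the smallest constant $c_\mu\ge0$. Let $\Lambda$ be a differentiable 1-form such that for every compact $\mathcal K\subset\mathcal M$: $\sup_{\mathcal K}\|\Lambda_\mu\|<\infty$; $\sup_{\mathcal K}\|d\Lambda_\mu\|<\infty$; and there is $C_{\mathcal K}$ with $$|\bar\Lambda_\nu(u)-\bar\Lambda_\mu(u)|\le C_{\mathcal K}\,W_2(\mu,\nu)\,(\|u\|_\infty+\|\nabla u\|_\infty)$$ for all $\mu,\nu\in\mathcal K$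 and all bounded differentiable $u:\mathbb R^D\to\mathbb R^D$ with bounded $\nabla u$. Let $T>0$ and let $S:[0,1]\times[0,T]\to\mathcal M$ satisfy: (i) For each $s\in[0,1]$ the curve $S(s,\cdot)$ is 2-absolutely continuous on $(0,T)$, and for each $t\in[0,T]$ the curve $S(\cdot,t)$ is 2-absolutely continuous on $(0,1)$. (A curve $\sigma$ is 2-absolutely continuous on $(a,b)$ if $W_2(\sigma_r,\sigma_t)\le\int_r^t\beta$ for $a<r<t<b$ and some $\beta\in L^2(a,b)$.) (ii) For each $s$, $v(s,\cdot,\cdot)$ is the velocity of minimal norm of $S(s,\cdot)$; for each $t$, $w(\cdot,t,\cdot)$ is that of $S(\cdot,t)$. (The velocity of minimal norm of $\sigma$ is the Borel field $v$ with $\partial_t\sigma+\mathrm{div}(v\sigma)=0$ in the sense of distributions and $v_t\in T_{\sigma_t}\mathcal M$ for a.e. $t$.) Moreover $v,w\in C^2([0,1]\times[0,T]\times\mathbb R^D,\mathbb R^D)$, they and their derivatives up to second order are bounded, their second derivatives are Lipschitz (that is, third-order derivatives are bounded), and $v(s,t,\cdot)$, $w(s,t,\cdot)$ are gradient vector fields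 for all $(s,t)$. (iii) $S(s,t)=\rho(s,t,\cdot)\,\mathcal L^D$ for all $(s,t)$, with $\rho\ge0$, $\rho\in C^1([0,1]\times[0,T]\times\mathbb R^D)$, bounded with bounded first derivatives. Define $$\int_S d\Lambda:=\int_0^T\!\!\int_0^1 d\Lambda_{S(s,t)}\big(w(s,t,\cdot),v(s,t,\cdot)\big)\,ds\,dt,$$ the integral of $d\Lambda$ over $S$ oriented by $(s,t)$ ($w$ and $v$ are the velocities in $s$ and in $t$), and let $\int_{\partial S}\Lambda$ be the integral over the boundary with $S(1,\cdot)$, $S(\cdot,0)$ positively and $S(0,\cdot)$, $S(\cdot,T)$ negatively oriented: $$\int_{\partial S}\Lambda:=\int_0^T\Lambda_{S(1,t)}(v(1,t,\cdot))\,dt+\int_0^1\Lambda_{S(s,0)}(w(s,0,\cdot))\,ds-\int_0^T\Lambda_{S(0,t)}(v(0,t,\cdot))\,dt-\int_0^1\Lambda_{S(s,T)}(w(s,T,\cdot))\,ds.$$ Then all these integrands are integrable (indeed so are the integrands along every curve $S(s,\cdot)$ and $S(\cdot,t)$), and $$\int_S d\Lambda=\int_{\partial S}\Lambda .$$ -/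

import Mathlib

open MeasureTheory Set Filter Topology
open scoped ENNReal NNReal ContDiff Gradient InnerProductSpace

noncomputable section

namespace WassersteinCalculus

/-- The Euclidean space of dimension `D`. -/
abbrev E (D : ℕ) : Type := EuclideanSpace ℝ (Fin D)

/-- Borel probability measures on the Euclidean space with finite second moment. -/
structure WSpace (D : ℕ) where
  toMeasure : Measure (E D)
  isProb : IsProbabilityMeasure toMeasure
  secondMoment : ∫⁻ x, ‖x‖ₑ ^ 2 ∂toMeasure < (⊤ : ℝ≥0∞)

instance {D : ℕ} (μ : WSpace D) : IsProbabilityMeasure μ.toMeasure := μ.isProb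

/-- Continuous functions of 2-growth. -/
def IsC2Growth {D : ℕ} (f : E D → ℝ) : Prop :=
  Continuous f ∧ ∃ A B : ℝ, ∀ x, |f x| ≤ A + B * ‖x‖ ^ 2

/-- The topology induced by the weak-* topology of the dual of the space of continuous functions
of 2-growth: the coarsest one for which all `μ ↦ ∫ f dμ` are continuous. -/
instance {D : ℕ} : TopologicalSpace (WSpace D) :=
  ⨅ f : {f : E D → ℝ // IsC2Growth f},
    TopologicalSpace.induced (fun μ : WSpace D => ∫ x, f.1 x ∂μ.toMeasure) inferInstance

/-! ### The Wasserstein distance -/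

/-- `Γ(μ, ν)`: the measures with marginals `μ` and `ν`. -/
def couplings {D : ℕ} (μ ν : WSpace D) : Set (Measure (E D × E D)) :=
  {γ | γ.map Prod.fst = μ.toMeasure ∧ γ.map Prod.snd = ν.toMeasure}

/-- Quadratic transport cost. -/
def transportCost {D : ℕ} (γ : Measure (E D × E D)) : ℝ≥0∞ :=
  ∫⁻ p, ‖p.1 - p.2‖ₑ ^ 2 ∂γ

/-- The Wasserstein distance `W₂`. -/
def W2 {D : ℕ} (μ ν : WSpace D) : ℝ :=
  Real.sqrt (⨅ γ ∈ couplings μ ν, transportCost γ).toReal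

/-- `Γ_o(μ, ν)`: the optimal couplings. -/
def optCouplings {D : ℕ} (μ ν : WSpace D) : Set (Measure (E D × E D)) :=
  {γ | γ ∈ couplings μ ν ∧ ∀ γ' ∈ couplings μ ν, transportCost γ ≤ transportCost γ'}

/-! ### Tangent spaces -/

/-- The Hilbert space `L²(μ)` of vector fields. -/
abbrev L2 {D : ℕ} (μ : WSpace D) : Type := Lp (E D) 2 μ.toMeasure

open scoped Classical in
/-- The class in `L²(μ)` of a square integrable vector field. -/
def toL2 {D : ℕ} (μ : WSpace D) (X : E D → E D) : L2 μ :=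
  if h : MemLp X 2 μ.toMeasure then h.toLp X else 0

/-- Compactly supported smooth functions. -/
def IsTest {V W : Type*} [NormedAddCommGroup V] [NormedSpace ℝ V]
    [NormedAddCommGroup W] [NormedSpace ℝ W] (f : V → W) : Prop :=
  ContDiff ℝ ∞ f ∧ HasCompactSupport f

/-- The tangent space at `μ`: the closure in `L²(μ)` of the gradients of test functions (these
gradients form a linear space already, so the span adds nothing). -/
def tangentSpace {D : ℕ} (μ : WSpace D) : Submodule ℝ (L2 μ) :=
  (Submodule.span ℝ {X | ∃ f : E D → ℝ, IsTest f ∧ X = toL2 μ (∇ f)}).topologicalClosure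

instance {D : ℕ} (μ : WSpace D) : CompleteSpace (tangentSpace μ) :=
  Submodule.topologicalClosure.completeSpace _

/-- The orthogonal projection `π_μ` of `L²(μ)` onto the tangent space. -/
def tangentProj {D : ℕ} (μ : WSpace D) : L2 μ →L[ℝ] tangentSpace μ :=
  (tangentSpace μ).orthogonalProjectionOnto

/-! ### Differentiable functions -/

/-- `ξ` belongs to the subdifferential of `F` at `μ`. -/
def IsSubgradient {D : ℕ} (F : WSpace D → ℝ) (μ : WSpace D) (ξ : L2 μ) : Prop :=
  ∀ ε > 0, ∃ δ > 0, ∀ ν : WSpace D, W2 μ ν < δ → ∀ γ ∈ optCouplings μ ν,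
    F ν ≥ F μ + ∫ p, ⟪ξ p.1, p.2 - p.1⟫_ℝ ∂γ - ε * W2 μ ν

/-- `ξ` belongs to both the subdifferential and the superdifferential of `F` at `μ`. -/
def IsSubSupergradient {D : ℕ} (F : WSpace D → ℝ) (μ : WSpace D) (ξ : L2 μ) : Prop :=
  IsSubgradient F μ ξ ∧ IsSubgradient (fun ν => -F ν) μ (-ξ)

/-- Differentiability of a function at `μ`. -/
def WDifferentiableAt {D : ℕ} (F : WSpace D → ℝ) (μ : WSpace D) : Prop :=
  ∃ ξ : L2 μ, IsSubSupergradient F μ ξ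

open scoped Classical in
/-- The gradient vector `∇_μ F = π_μ(ξ)` of a function that is differentiable at `μ`
(it does not depend on the choice of `ξ`). -/
def wGradient {D : ℕ} (F : WSpace D → ℝ) (μ : WSpace D) : tangentSpace μ :=
  if h : WDifferentiableAt F μ then tangentProj μ h.choose else 0

/-! ### Forms -/

/-- 1-forms: sections of the cotangent bundle. -/
abbrev OneForm (D : ℕ) : Type := (μ : WSpace D) → (tangentSpace μ →L[ℝ] ℝ)

/-- Pseudo 1-forms: sections of the pseudo cotangent bundle. -/
abbrev PseudoOneForm (D : ℕ) : Type := (μ : WSpace D) → (L2 μ →L[ℝ] ℝ)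

/-- The pseudo 1-form associated to a 1-form, by extending each `Λ_μ` by zero on the orthogonal
complement of the tangent space. -/
def OneForm.bar {D : ℕ} (Λ : OneForm D) : PseudoOneForm D :=
  fun μ => (Λ μ).comp (tangentProj μ)

/-- `X(F)` at `μ`: the differential of `F` applied to the vector field `X`. -/
def dirDeriv {D : ℕ} (X : E D → E D) (F : WSpace D → ℝ) (μ : WSpace D) : ℝ :=
  ⟪(wGradient F μ : L2 μ), toL2 μ X⟫_ℝ

/-- `X Λ(Y) - Y Λ(X) - Λ([X, Y])` at `μ`. Here `[X, Y] = ∇Y · X - ∇X · Y`. -/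
def PseudoOneForm.dField {D : ℕ} (Λ : PseudoOneForm D) (μ : WSpace D) (X Y : E D → E D) : ℝ :=
  dirDeriv X (fun ν => Λ ν (toL2 ν Y)) μ - dirDeriv Y (fun ν => Λ ν (toL2 ν X)) μ
    - Λ μ (toL2 μ (VectorField.lieBracket ℝ X Y))

/-- `c` is an admissible constant for the continuity of `dΛ_μ` on gradients of test functions. -/
def PseudoOneForm.IsDBound {D : ℕ} (Λ : PseudoOneForm D) (μ : WSpace D) (c : ℝ) : Prop :=
  ∀ f g : E D → ℝ, IsTest f → IsTest g →
    |Λ.dField μ (∇ f) (∇ g)| ≤ c * ‖toL2 μ (∇ f)‖ * ‖toL2 μ (∇ g)‖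

/-- Differentiability of pseudo 1-forms. -/
def PseudoOneForm.IsDifferentiable {D : ℕ} (Λ : PseudoOneForm D) : Prop :=
  (∀ X : E D → E D, IsTest X → ∀ μ, WDifferentiableAt (fun ν => Λ ν (toL2 ν X)) μ) ∧
    ∀ μ, ∃ c : ℝ, Λ.IsDBound μ c

/-- A 1-form is differentiable if the associated pseudo 1-form is. -/
def OneForm.IsDifferentiable {D : ℕ} (Λ : OneForm D) : Prop := Λ.bar.IsDifferentiable

open scoped Classical in
/-- The exterior derivative `dΛ_μ` of a differentiable 1-form, as a continuous bilinear form on the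
tangent space: the unique continuous bilinear extension of its values on gradients of test
functions. -/
def OneForm.d {D : ℕ} (Λ : OneForm D) (μ : WSpace D) :
    tangentSpace μ →L[ℝ] tangentSpace μ →L[ℝ] ℝ :=
  if h : ∃ B : tangentSpace μ →L[ℝ] tangentSpace μ →L[ℝ] ℝ,
      ∀ f g : E D → ℝ, IsTest f → IsTest g →
        B (tangentProj μ (toL2 μ (∇ f))) (tangentProj μ (toL2 μ (∇ g)))
          = Λ.bar.dField μ (∇ f) (∇ g)
  then h.choose else 0

/-- `‖dΛ_μ‖`: the smallest nonnegative admissible constant. -/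
def OneForm.dNorm {D : ℕ} (Λ : OneForm D) (μ : WSpace D) : ℝ :=
  sInf {c : ℝ | 0 ≤ c ∧ Λ.bar.IsDBound μ c}

/-- `‖Λ_μ‖` is bounded on compact sets. -/
def OneForm.LocallyBounded {D : ℕ} (Λ : OneForm D) : Prop :=
  ∀ K : Set (WSpace D), IsCompact K → ∃ C : ℝ, ∀ μ ∈ K, ‖Λ μ‖ ≤ C

/-- `‖dΛ_μ‖` is bounded on compact sets. -/
def OneForm.DLocallyBounded {D : ℕ} (Λ : OneForm D) : Prop :=
  ∀ K : Set (WSpace D), IsCompact K → ∃ C : ℝ, ∀ μ ∈ K, Λ.dNorm μ ≤ C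

/-- The Lipschitz-type bound
`|Λ_ν(u) - Λ_μ(u)| ≤ C_K W₂(μ, ν) (‖u‖_∞ + ‖∇u‖_∞)` on every compact set `K`. -/
def OneForm.LocallyLipschitzOnFields {D : ℕ} (Λ : OneForm D) : Prop :=
  ∀ K : Set (WSpace D), IsCompact K → ∃ C : ℝ, ∀ μ ∈ K, ∀ ν ∈ K, ∀ u : E D → E D,
    Differentiable ℝ u → BddAbove (range fun x => ‖u x‖) →
    BddAbove (range fun x => ‖fderiv ℝ u x‖) →
      |Λ.bar ν (toL2 ν u) - Λ.bar μ (toL2 μ u)|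
        ≤ C * W2 μ ν * ((⨆ x, ‖u x‖) + ⨆ x, ‖fderiv ℝ u x‖)

/-! ### Curves -/

/-- 2-absolutely continuous curves on `(a, b)`. -/
def IsAC2 {D : ℕ} (a b : ℝ) (σ : ℝ → WSpace D) : Prop :=
  ∃ β : ℝ → ℝ, MemLp β 2 (volume.restrict (Ioo a b)) ∧
    ∀ s t, a < s → s < t → t < b → W2 (σ s) (σ t) ≤ ∫ τ in s..t, β τ

/-- `v` is a velocity of `σ` on `(a, b)`: it is Borel, `v_t ∈ L²(σ_t)` for almost every `t`, and
`∂σ/∂t + div_σ(v) = 0` in the sense of distributions. -/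
structure IsVelocity {D : ℕ} (a b : ℝ) (σ : ℝ → WSpace D) (v : ℝ → E D → E D) : Prop where
  measurable : Measurable fun p : Ioo a b × E D => v p.1 p.2
  memLp : ∀ᵐ t ∂volume.restrict (Ioo a b), MemLp (v t) 2 (σ t).toMeasure
  integrable : ∀ φ : ℝ × E D → ℝ, IsTest φ → tsupport φ ⊆ Ioo a b ×ˢ univ →
    IntegrableOn (fun t => ∫ x, (fderiv ℝ φ (t, x) (1, 0) + fderiv ℝ φ (t, x) (0, v t x))
      ∂(σ t).toMeasure) (Ioo a b)
  continuityEq : ∀ φ : ℝ × E D → ℝ, IsTest φ → tsupport φ ⊆ Ioo a b ×ˢ univ →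
    ∫ t in Ioo a b, ∫ x, (fderiv ℝ φ (t, x) (1, 0) + fderiv ℝ φ (t, x) (0, v t x))
      ∂(σ t).toMeasure = 0

/-- `v` is the velocity of minimal norm of `σ`: the (unique) velocity that is tangent for almost
every time. -/
def IsMinimalVelocity {D : ℕ} (a b : ℝ) (σ : ℝ → WSpace D) (v : ℝ → E D → E D) : Prop :=
  IsVelocity a b σ v ∧
    ∀ᵐ t ∂volume.restrict (Ioo a b), toL2 (σ t) (v t) ∈ tangentSpace (σ t)

/-- The integral over `[a, b]` of a 1-form along the curve `σ` with velocity `v`. -/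
def OneForm.curveIntegral {D : ℕ} (Λ : OneForm D) (a b : ℝ) (σ : ℝ → WSpace D)
    (v : ℝ → E D → E D) : ℝ :=
  ∫ t in a..b, Λ.bar (σ t) (toL2 (σ t) (v t))

/-! ### Surfaces -/

/-- The domain `[0,1] × [0,T] × ℝ^D`. -/
def box (D : ℕ) (T : ℝ) : Set (ℝ × ℝ × E D) := Icc 0 1 ×ˢ Icc 0 T ×ˢ univ

/-- `v` is of class `C²` on `[0,1] × [0,T] × ℝ^D`, with bounded derivatives of orders `0, 1, 2` and
Lipschitz derivative of order 2, that is, bounded derivatives of order 3 (almost everywhere). -/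
def HasBoundedC2 {D : ℕ} (T : ℝ) (v : ℝ → ℝ → E D → E D) : Prop :=
  ContDiffOn ℝ 2 (fun p : ℝ × ℝ × E D => v p.1 p.2.1 p.2.2) (box D T) ∧
  (∃ C : ℝ, ∀ k ≤ 2, ∀ p ∈ box D T,
    ‖iteratedFDerivWithin ℝ k (fun p : ℝ × ℝ × E D => v p.1 p.2.1 p.2.2) (box D T) p‖ ≤ C) ∧
  ∃ C : ℝ≥0, LipschitzOnWith C
    (iteratedFDerivWithin ℝ 2 (fun p : ℝ × ℝ × E D => v p.1 p.2.1 p.2.2) (box D T)) (box D T)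

/-- `v(s, t, ·)` is a gradient vector field for all `(s, t) ∈ [0,1] × [0,T]`. -/
def IsGradientFamily {D : ℕ} (T : ℝ) (v : ℝ → ℝ → E D → E D) : Prop :=
  ∀ s ∈ Icc (0 : ℝ) 1, ∀ t ∈ Icc (0 : ℝ) T, ∃ f : E D → ℝ, ∀ x, HasGradientAt f (v s t x) x

/-- The surface `S` has densities that are bounded and `C¹` with bounded derivatives on
`[0,1] × [0,T] × ℝ^D`. -/
def HasBoundedC1Density {D : ℕ} (T : ℝ) (S : ℝ → ℝ → WSpace D) : Prop :=
  ∃ ρ : ℝ → ℝ → E D → ℝ,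
    (∀ s ∈ Icc (0 : ℝ) 1, ∀ t ∈ Icc (0 : ℝ) T, (∀ x, 0 ≤ ρ s t x) ∧
      (S s t).toMeasure = volume.withDensity fun x => ENNReal.ofReal (ρ s t x)) ∧
    ContDiffOn ℝ 1 (fun p : ℝ × ℝ × E D => ρ p.1 p.2.1 p.2.2) (box D T) ∧
    ∃ C : ℝ, ∀ p ∈ box D T, |ρ p.1 p.2.1 p.2.2| ≤ C ∧
      ‖fderivWithin ℝ (fun p : ℝ × ℝ × E D => ρ p.1 p.2.1 p.2.2) (box D T) p‖ ≤ C

/-- The regularity conditions on a surface `S` over `[0,1] × [0,T]` with velocity `v` in the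
direction of `t` and velocity `w` in the direction of `s`. -/
structure IsSmoothSurface {D : ℕ} (T : ℝ) (S : ℝ → ℝ → WSpace D)
    (v w : ℝ → ℝ → E D → E D) : Prop where
  ac_t : ∀ s ∈ Icc (0 : ℝ) 1, IsAC2 0 T fun t => S s t
  ac_s : ∀ t ∈ Icc (0 : ℝ) T, IsAC2 0 1 fun s => S s t
  vel_t : ∀ s ∈ Icc (0 : ℝ) 1, IsMinimalVelocity 0 T (fun t => S s t) fun t => v s t
  vel_s : ∀ t ∈ Icc (0 : ℝ) T, IsMinimalVelocity 0 1 (fun s => S s t) fun s => w s t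
  reg_v : HasBoundedC2 T v
  reg_w : HasBoundedC2 T w
  grad_v : IsGradientFamily T v
  grad_w : IsGradientFamily T w
  density : HasBoundedC1Density T S

/-- `dΛ(∂S/∂s, ∂S/∂t)` at `(s, t)`, the tangent vectors being `w` and `v`. -/
def OneForm.dSurface {D : ℕ} (Λ : OneForm D) (S : ℝ → ℝ → WSpace D)
    (v w : ℝ → ℝ → E D → E D) (s t : ℝ) : ℝ :=
  Λ.d (S s t) (tangentProj (S s t) (toL2 (S s t) (w s t)))
    (tangentProj (S s t) (toL2 (S s t) (v s t)))

/-- The integral of the 2-form `dΛ` over the surface `S`, oriented by `(s, t)`. -/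
def OneForm.surfaceIntegral {D : ℕ} (Λ : OneForm D) (T : ℝ) (S : ℝ → ℝ → WSpace D)
    (v w : ℝ → ℝ → E D → E D) : ℝ :=
  ∫ p in Icc (0 : ℝ) 1 ×ˢ Icc (0 : ℝ) T, Λ.dSurface S v w p.1 p.2

/-- The integral of `Λ` over the boundary of `S`: the curves `S(1, ·)`, `S(·, 0)` are positively
oriented, the curves `S(0, ·)`, `S(·, T)` negatively. -/
def OneForm.boundaryIntegral {D : ℕ} (Λ : OneForm D) (T : ℝ) (S : ℝ → ℝ → WSpace D)
    (v w : ℝ → ℝ → E D → E D) : ℝ :=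
  Λ.curveIntegral 0 T (fun t => S 1 t) (fun t => v 1 t)
    + Λ.curveIntegral 0 1 (fun s => S s 0) (fun s => w s 0)
    - Λ.curveIntegral 0 T (fun t => S 0 t) (fun t => v 0 t)
    - Λ.curveIntegral 0 1 (fun s => S s T) (fun s => w s T)

end WassersteinCalculus

end

/-!
The formula is Green's formula for the functions `a(s, t) = Λ_{S(s,t)}(v(s, t))` and `b(s, t) =
Λ_{S(s,t)}(w(s, t))` on the rectangle `[0, 1] × [0, T]`, once `∂_s a - ∂_t b = dΛ(w, v)` is known.
Formally, `∂_s a = w(Λ(v)) + Λ(∂_s v)` and `∂_t b = v(Λ(w)) + Λ(∂_t w)`, so that the difference is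
`dΛ(w, v) + Λ([w, v] + ∂_s v - ∂_t w)`, and the last term vanishes because the derivatives in `s`
and `t` of a surface commute. Two difficulties have to be met: `v` and `w` are not compactly
supported, so that the differentiability of `Λ` says nothing about `Λ(v)` and `Λ(w)`, and
functions on the Wasserstein space are differentiable along optimal couplings, whereas `S` moves
along flows.

*Transport by flows.* The continuity equation with a bounded Lipschitz velocity determines the
curve. Tested against functions of space (`IsVelocity.integral_sub_eq`) it shows that one step of
Euler's method transports the measures up to an error of second order; the limit of Euler polygons
is the flow, which therefore transports the measures exactly (`IsFlowField.exists_transport`).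
Composing the flows of `v` and `w` gives maps between any two measures of the surface, with a
first order expansion in terms of `v` and `w` (`IsSmoothSurface.exists_isTransported`). In
particular the surface has compact image, and `(s, t) ↦ Λ_{S(s,t)}(U(s,t))` is Lipschitz for
regular fields `U` (`IsTransported.exists_lipschitz_bar`).

*Derivatives along flows.* If a map displaces `μ` to first order by `h u` with `u` a gradient,
then every optimal coupling of `μ` and its image is `L²`-close to `x ↦ x + h u(x)` with an error
of order `h^{3/2}`. Indeed the cost is at most that of the map, and the correlation of the
coupling with `u = ∇f` is, up to a Taylor error, the increment of `∫ f`, which only depends on the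
marginals (`IsGradientField.integral_optCoupling_le`). Hence a differentiable function has the
expected derivative along such displacements (`abs_sub_dirDeriv_le`), and a product rule holds for
`Λ(X)` with a test field `X` that depends on time (`OneForm.hasDerivAt_bar`).

*Approximation.* A gradient field `u = ∇f` is approximated by test fields `approx n u`,
mollifications of `∇(χ_n f)` with cutoff functions `χ_n`. Since `f` has linear growth, these are
bounded in `C¹` and converge with their first derivatives (`fderiv_approx`). The functions
`Λ(approx n v)` are differentiable along the surface. Their derivatives in direction `w` may be
replaced by those in direction `approx n w`: the derivative in a direction that is small in
`L²(μ)` is small uniformly in `n`, by the Lipschitz hypothesis on `Λ` on a suitable compact set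
(`OneForm.tendsto_dirDeriv_zero`). Then the formula that defines `dΛ` on gradients of test
functions applies (`OneForm.d_apply`, where it is shown that the continuous bilinear extension
exists), and its left-hand side converges to `dΛ(w, v)` (`IsC1GradientField.tendsto_d`).

*Commutation.* The second derivative of `(s, t) ↦ ∫ φ dS(s, t)` is symmetric for every test
function `φ`, which says that `∂_s v + ∇v · w - ∂_t w - ∇w · v` is orthogonal in `L²(S(s, t))` to
all gradients (`IsTransported.integral_commutator`). As `Λ` only sees the tangential component of
a field, the bracket is compensated in the limit (`IsTransported.tendsto_bar_lieBracket`).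

The approximations of `a` and `b` are uniformly Lipschitz, and the difference of their derivatives
converges to `dΛ(w, v)` at interior points, so that Green's formula passes to the limit by
dominated convergence (`integral_rect_of_tendsto`); this gives the integrability of `dΛ(w, v)` as
well.
-/

noncomputable section

namespace WassersteinCalculus

variable {D : ℕ}

/-! ### Couplings and the Wasserstein distance -/

lemma memLp_id (μ : WSpace D) : MemLp (fun x : E D => x) 2 μ.toMeasure := by
  refine ⟨by fun_prop, ?_⟩
  rw [eLpNorm_lt_top_iff_lintegral_rpow_enorm_lt_top (by simp) (by simp)]
  simpa using μ.secondMoment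

lemma couplings_isProb {μ ν : WSpace D} {γ : Measure (E D × E D)} (hγ : γ ∈ couplings μ ν) :
    IsProbabilityMeasure γ := by
  have h : IsProbabilityMeasure (γ.map Prod.fst) := by rw [hγ.1]; infer_instance
  exact (Measure.isProbabilityMeasure_map_iff (by fun_prop)).1 h

lemma memLp_fst {μ ν : WSpace D} {γ : Measure (E D × E D)} (hγ : γ ∈ couplings μ ν)
    {G : Type*} [NormedAddCommGroup G] {g : E D → G} {p : ℝ≥0∞} (hg : MemLp g p μ.toMeasure) :
    MemLp (fun q : E D × E D => g q.1) p γ := by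
  have h := hγ.1 ▸ hg
  exact h.comp_of_map (by fun_prop)

lemma memLp_snd {μ ν : WSpace D} {γ : Measure (E D × E D)} (hγ : γ ∈ couplings μ ν)
    {G : Type*} [NormedAddCommGroup G] {g : E D → G} {p : ℝ≥0∞} (hg : MemLp g p ν.toMeasure) :
    MemLp (fun q : E D × E D => g q.2) p γ := by
  have h := hγ.2 ▸ hg
  exact h.comp_of_map (by fun_prop)

lemma integral_fst {μ ν : WSpace D} {γ : Measure (E D × E D)} (hγ : γ ∈ couplings μ ν)
    {g : E D → ℝ} (hg : AEStronglyMeasurable g μ.toMeasure) :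
    ∫ q, g q.1 ∂γ = ∫ x, g x ∂μ.toMeasure := by
  rw [← hγ.1, integral_map (by fun_prop) (by rwa [hγ.1])]

lemma integral_snd {μ ν : WSpace D} {γ : Measure (E D × E D)} (hγ : γ ∈ couplings μ ν)
    {g : E D → ℝ} (hg : AEStronglyMeasurable g ν.toMeasure) :
    ∫ q, g q.2 ∂γ = ∫ x, g x ∂ν.toMeasure := by
  rw [← hγ.2, integral_map (by fun_prop) (by rwa [hγ.2])]

lemma memLp_sub {μ ν : WSpace D} {γ : Measure (E D × E D)} (hγ : γ ∈ couplings μ ν) :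
    MemLp (fun q : E D × E D => q.2 - q.1) 2 γ :=
  (memLp_snd hγ (memLp_id ν)).sub (memLp_fst hγ (memLp_id μ))

lemma transportCost_eq {μ ν : WSpace D} {γ : Measure (E D × E D)} (hγ : γ ∈ couplings μ ν) :
    transportCost γ = ENNReal.ofReal (∫ q, ‖q.2 - q.1‖ ^ 2 ∂γ) := by
  rw [ofReal_integral_eq_lintegral_ofReal]
  · unfold transportCost
    refine lintegral_congr fun q => ?_
    rw [← norm_sub_rev, ← ofReal_norm, ENNReal.ofReal_pow (norm_nonneg _)]
  · exact (memLp_sub hγ).integrable_norm_pow (by norm_num)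
  · exact Eventually.of_forall fun _ => by positivity

lemma graph_mem_couplings {μ ν : WSpace D} {Θ : E D → E D} (hΘ : Measurable Θ)
    (h : ν.toMeasure = μ.toMeasure.map Θ) :
    μ.toMeasure.map (fun x => (x, Θ x)) ∈ couplings μ ν := by
  refine ⟨?_, ?_⟩
  · rw [Measure.map_map (by fun_prop) (by fun_prop)]
    exact Measure.map_id
  · rw [Measure.map_map (by fun_prop) (by fun_prop), h]
    rfl

lemma W2_nonneg (μ ν : WSpace D) : 0 ≤ W2 μ ν := Real.sqrt_nonneg _

/-- A transport map bounds the Wasserstein distance by its displacement in `L²(μ)`. -/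
lemma W2_le_of_map {μ ν : WSpace D} {Θ : E D → E D} (hΘ : Measurable Θ)
    (h : ν.toMeasure = μ.toMeasure.map Θ) {c : ℝ} (hc : 0 ≤ c)
    (hcost : ∫ x, ‖Θ x - x‖ ^ 2 ∂μ.toMeasure ≤ c ^ 2) : W2 μ ν ≤ c := by
  have hmem := graph_mem_couplings hΘ h
  have h1 : (⨅ γ ∈ couplings μ ν, transportCost γ) ≤ ENNReal.ofReal (c ^ 2) := by
    refine (iInf₂_le _ hmem).trans ?_
    rw [transportCost_eq hmem]
    refine ENNReal.ofReal_le_ofReal ?_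
    rwa [integral_map (by fun_prop) (by fun_prop)]
  unfold W2
  rw [Real.sqrt_le_left hc]
  exact ENNReal.toReal_le_of_le_ofReal (by positivity) h1

lemma W2_le_of_dist_le {μ ν : WSpace D} {Θ : E D → E D} (hΘ : Measurable Θ)
    (h : ν.toMeasure = μ.toMeasure.map Θ) {c : ℝ} (hc : 0 ≤ c)
    (hdist : ∀ x, ‖Θ x - x‖ ≤ c) : W2 μ ν ≤ c := by
  refine W2_le_of_map hΘ h hc ?_
  have : ∫ x, ‖Θ x - x‖ ^ 2 ∂μ.toMeasure ≤ ∫ _, c ^ 2 ∂μ.toMeasure := by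
    refine integral_mono_of_nonneg (Eventually.of_forall fun _ => by positivity)
      (integrable_const _) (Eventually.of_forall fun x => ?_)
    exact pow_le_pow_left₀ (norm_nonneg _) (hdist x) 2
  simpa using this

/-- Optimal couplings exist: the couplings form a compact set for the narrow topology, and the cost
is a supremum of continuous functions on it. -/
theorem exists_optCoupling (μ ν : WSpace D) : ∃ γ, γ ∈ optCouplings μ ν := by
  let P : WSpace D → ProbabilityMeasure (E D) := fun μ => ⟨μ.toMeasure, μ.isProb⟩
  let A : Set (ProbabilityMeasure (E D × E D)) :=
    {γ | γ.map (f := Prod.fst) (by fun_prop) = P μ ∧ γ.map (f := Prod.snd) (by fun_prop) = P ν}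
  have hA : ∀ γ : ProbabilityMeasure (E D × E D), γ ∈ A ↔ (γ : Measure _) ∈ couplings μ ν := by
    intro γ
    exact and_congr Subtype.ext_iff Subtype.ext_iff
  have hclosed : IsClosed A := by
    refine IsClosed.inter ?_ ?_
    · exact isClosed_singleton.preimage (ProbabilityMeasure.continuous_map continuous_fst)
    · exact isClosed_singleton.preimage (ProbabilityMeasure.continuous_map continuous_snd)
  have htight : IsTightMeasureSet {((γ : ProbabilityMeasure (E D × E D)) : Measure (E D × E D)) |
      γ ∈ A} := by
    refine IsTightMeasureSet.prodMk ?_ ?_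
    · refine (isTightMeasureSet_singleton (μ := μ.toMeasure)).subset ?_
      rintro _ ⟨_, ⟨γ, hγ, rfl⟩, rfl⟩
      exact ((hA γ).1 hγ).1
    · refine (isTightMeasureSet_singleton (μ := ν.toMeasure)).subset ?_
      rintro _ ⟨_, ⟨γ, hγ, rfl⟩, rfl⟩
      exact ((hA γ).1 hγ).2
  have hcomp : IsCompact A := by
    have := isCompact_closure_of_isTightMeasureSet htight
    rwa [hclosed.closure_eq] at this
  have hne : A.Nonempty := by
    refine ⟨⟨μ.toMeasure.prod ν.toMeasure, inferInstance⟩, (hA _).2 ?_⟩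
    constructor
    · simp
    · simp
  have hlsc : LowerSemicontinuous
      fun γ : ProbabilityMeasure (E D × E D) => transportCost (γ : Measure (E D × E D)) := by
    -- the cost is the supremum of its truncations at height `n`, which are continuous in `γ`
    have h1 : (fun γ : ProbabilityMeasure (E D × E D) => transportCost (γ : Measure (E D × E D))) =
        fun γ : ProbabilityMeasure (E D × E D) =>
          ⨆ n : ℕ, ∫⁻ q : E D × E D, ((min (‖q.1 - q.2‖₊ ^ 2) (n : ℝ≥0) : ℝ≥0) : ℝ≥0∞)
            ∂(γ : Measure (E D × E D)) := by
      funext γ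
      rw [← lintegral_iSup]
      · unfold transportCost
        refine lintegral_congr fun q => ?_
        refine le_antisymm ?_ (iSup_le fun n => ?_)
        · obtain ⟨n, hn⟩ := exists_nat_ge (‖q.1 - q.2‖₊ ^ 2)
          refine le_iSup_of_le n ?_
          rw [min_eq_left hn]
          simp [enorm_eq_nnnorm]
        · refine (ENNReal.coe_le_coe.2 (min_le_left _ _)).trans ?_
          simp [enorm_eq_nnnorm]
      · intro n
        fun_prop
      · intro m n hmn q
        simp only [ENNReal.coe_le_coe]
        exact min_le_min_left _ (by exact_mod_cast hmn)
    rw [h1]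
    refine lowerSemicontinuous_iSup fun n => Continuous.lowerSemicontinuous ?_
    let f : BoundedContinuousFunction (E D × E D) ℝ≥0 :=
      BoundedContinuousFunction.mkOfBound
        ⟨fun q => min (‖q.1 - q.2‖₊ ^ 2) (n : ℝ≥0), by fun_prop⟩ n (by
          intro x y
          rw [NNReal.dist_eq]
          have h1 : ((min (‖x.1 - x.2‖₊ ^ 2) (n : ℝ≥0) : ℝ≥0) : ℝ) ≤ n := by
            exact_mod_cast min_le_right _ _
          have h2 : ((min (‖y.1 - y.2‖₊ ^ 2) (n : ℝ≥0) : ℝ≥0) : ℝ) ≤ n := by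
            exact_mod_cast min_le_right _ _
          have h3 := (min (‖x.1 - x.2‖₊ ^ 2) (n : ℝ≥0)).2
          have h4 := (min (‖y.1 - y.2‖₊ ^ 2) (n : ℝ≥0)).2
          rw [abs_le]
          constructor <;> simp only [ContinuousMap.coe_mk] <;> linarith!)
    exact ProbabilityMeasure.continuous_lintegral_boundedContinuousFunction f
  obtain ⟨γ, hγ, hmin⟩ := (hlsc.lowerSemicontinuousOn A).exists_isMinOn hne hcomp
  refine ⟨γ, (hA γ).1 hγ, fun γ' hγ' => ?_⟩
  have : IsProbabilityMeasure γ' := couplings_isProb hγ'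
  exact hmin ((hA ⟨γ', this⟩).2 hγ')

/-! ### Directional derivatives along transport maps -/

/-- First order Taylor expansion on a convex set for a function with Lipschitz derivative. (The
constant is twice the optimal one.) -/
lemma norm_sub_sub_le_of_lipschitz_fderiv {V W : Type*} [NormedAddCommGroup V] [NormedSpace ℝ V]
    [NormedAddCommGroup W] [NormedSpace ℝ W] {s : Set V} (hs : Convex ℝ s) {g : V → W}
    {g' : V → V →L[ℝ] W} {L : ℝ} (hg : ∀ z ∈ s, HasFDerivWithinAt g (g' z) s z)
    (hL : ∀ z ∈ s, ∀ z' ∈ s, ‖g' z - g' z'‖ ≤ L * ‖z - z'‖) (hL0 : 0 ≤ L) {x y : V} (hx : x ∈ s)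
    (hy : y ∈ s) : ‖g y - g x - g' x (y - x)‖ ≤ L * ‖y - x‖ ^ 2 := by
  have hsub : segment ℝ x y ⊆ s := hs.segment_subset hx hy
  have h := (convex_segment x y).norm_image_sub_le_of_norm_hasFDerivWithin_le' (f := g) (f' := g')
    (φ := g' x) (C := L * ‖y - x‖) (fun z hz => (hg z (hsub hz)).mono hsub) (fun z hz => by
      refine (hL z (hsub hz) x hx).trans ?_
      gcongr
      rw [norm_sub_rev]
      obtain ⟨a, b, ha, hb, hab, rfl⟩ := hz
      have : x - (a • x + b • y) = b • (x - y) := by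
        rw [show a = 1 - b by linarith]; module
      rw [this, norm_smul, Real.norm_of_nonneg hb, norm_sub_rev y x]
      exact mul_le_of_le_one_left (norm_nonneg _) (by linarith))
    (left_mem_segment ℝ x y) (right_mem_segment ℝ x y)
  calc _ ≤ _ := h
    _ = _ := by ring

/-- `u` is the gradient of `f`, with norm at most `M` and Lipschitz constant `L`. -/
structure IsGradientField (u : E D → E D) (f : E D → ℝ) (M L : ℝ) : Prop where
  hasGradient : ∀ x, HasGradientAt f (u x) x
  norm_le : ∀ x, ‖u x‖ ≤ M
  lipschitz : ∀ x y, ‖u x - u y‖ ≤ L * ‖x - y‖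
  nonneg : 0 ≤ L

namespace IsGradientField

variable {u : E D → E D} {f : E D → ℝ} {M L : ℝ}

lemma bound_nonneg (hu : IsGradientField u f M L) : 0 ≤ M := (norm_nonneg _).trans (hu.norm_le 0)

lemma continuous (hu : IsGradientField u f M L) : Continuous u :=
  (LipschitzWith.of_dist_le_mul (K := ⟨L, hu.nonneg⟩) (fun x y => by
    simpa [dist_eq_norm] using! hu.lipschitz x y)).continuous

lemma taylor (hu : IsGradientField u f M L) (x y : E D) :
    |f y - f x - ⟪u x, y - x⟫_ℝ| ≤ L * ‖y - x‖ ^ 2 := by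
  have := norm_sub_sub_le_of_lipschitz_fderiv (convex_univ) (g := f)
    (g' := fun z => InnerProductSpace.toDual ℝ (E D) (u z)) (L := L)
    (fun z _ => ((hu.hasGradient z).hasFDerivAt).hasFDerivWithinAt)
    (fun z _ z' _ => by
      rw [← map_sub, LinearIsometryEquiv.norm_map]
      exact hu.lipschitz z z') hu.nonneg (mem_univ x) (mem_univ y)
  simpa using this

lemma continuous_potential (hu : IsGradientField u f M L) : Continuous f :=
  continuous_iff_continuousAt.2 fun x => ((hu.hasGradient x).hasFDerivAt).continuousAt

lemma abs_sub_le (hu : IsGradientField u f M L) (x y : E D) : |f y - f x| ≤ M * ‖y - x‖ := by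
  have := convex_univ.norm_image_sub_le_of_norm_hasFDerivWithin_le (f := f)
    (f' := fun z => InnerProductSpace.toDual ℝ (E D) (u z)) (C := M)
    (fun z _ => ((hu.hasGradient z).hasFDerivAt).hasFDerivWithinAt)
    (fun z _ => by rw [LinearIsometryEquiv.norm_map]; exact hu.norm_le z) (mem_univ x) (mem_univ y)
  simpa using this

lemma memLp (hu : IsGradientField u f M L) (μ : WSpace D) (p : ℝ≥0∞) : MemLp u p μ.toMeasure :=
  MemLp.of_bound hu.continuous.aestronglyMeasurable M (Eventually.of_forall hu.norm_le)

lemma integrable_potential (hu : IsGradientField u f M L) (μ : WSpace D) :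
    Integrable f μ.toMeasure := by
  have h1 : Integrable (fun x : E D => |f 0| + M * ‖x‖) μ.toMeasure :=
    (integrable_const _).add ((((memLp_id μ).integrable (by norm_num)).norm).const_mul M)
  refine h1.mono' hu.continuous_potential.aestronglyMeasurable (Eventually.of_forall fun x => ?_)
  have h2 := hu.abs_sub_le 0 x
  rw [sub_zero] at h2
  calc ‖f x‖ = |f 0 + (f x - f 0)| := by rw [Real.norm_eq_abs]; ring_nf
    _ ≤ |f 0| + |f x - f 0| := abs_add_le _ _
    _ ≤ _ := by gcongr

end IsGradientField

/-- If `Θ` displaces `μ` to first order by `h • u` with `u` a gradient, then so does every optimal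
coupling of `μ` and `Θ_# μ`: its deviation from `x ↦ x + h • u x` is of higher order. The potential
of `u` computes the correlation of the coupling with `u` from its marginals alone, and optimality
bounds the cost. -/
theorem IsGradientField.integral_optCoupling_le {u : E D → E D} {f : E D → ℝ} {M L : ℝ}
    (hu : IsGradientField u f M L) {C : ℝ} (hC : 0 ≤ C) {μ ν : WSpace D} {Θ : E D → E D} {h : ℝ}
    (hh : |h| ≤ 1) (hΘ : Measurable Θ) (hν : ν.toMeasure = μ.toMeasure.map Θ)
    (hexp : ∀ x, ‖Θ x - x - h • u x‖ ≤ C * h ^ 2) {γ : Measure (E D × E D)}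
    (hγ : γ ∈ optCouplings μ ν) :
    ∫ q, ‖q.2 - q.1 - h • u q.1‖ ^ 2 ∂γ ≤
      (4 * L * (M + C) ^ 2 + 4 * M * C + C ^ 2) * |h| ^ 3 := by
  have hM := hu.bound_nonneg
  have hL := hu.nonneg
  have hγc := hγ.1
  have := couplings_isProb hγc
  have ha : 0 ≤ |h| := abs_nonneg h
  have hsq : |h| ^ 2 = h ^ 2 := sq_abs h
  have h4 : |h| ^ 4 ≤ |h| ^ 3 := pow_le_pow_of_le_one ha hh (by norm_num)
  have h2 : h ^ 2 ≤ |h| := by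
    rw [← hsq]; exact (pow_le_pow_of_le_one ha hh (by norm_num : 1 ≤ 2)).trans (by simp)
  have hd : ∀ x, ‖Θ x - x‖ ≤ |h| * ‖u x‖ + C * h ^ 2 := fun x => by
    calc ‖Θ x - x‖ = ‖h • u x + (Θ x - x - h • u x)‖ := by congr 1; abel
      _ ≤ ‖h • u x‖ + ‖Θ x - x - h • u x‖ := norm_add_le _ _
      _ ≤ _ := by rw [norm_smul, Real.norm_eq_abs]; gcongr; exact hexp x
  have hd' : ∀ x, ‖Θ x - x‖ ≤ (M + C) * |h| := fun x => by
    have := hu.norm_le x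
    calc _ ≤ _ := hd x
      _ ≤ |h| * M + C * |h| := by gcongr
      _ = _ := by ring
  -- the mean of `‖u‖ ^ 2`
  set m : ℝ := ∫ x, ‖u x‖ ^ 2 ∂μ.toMeasure with hm
  have hi_u : Integrable (fun x => ‖u x‖ ^ 2) μ.toMeasure :=
    (hu.memLp μ 2).integrable_norm_pow (by norm_num)
  have hi_Θ : Integrable (fun x => ‖Θ x - x‖ ^ 2) μ.toMeasure := by
    refine (integrable_const (((M + C) * |h|) ^ 2)).mono' (by fun_prop)
      (Eventually.of_forall fun x => ?_)
    rw [Real.norm_of_nonneg (by positivity)]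
    exact pow_le_pow_left₀ (norm_nonneg _) (hd' x) 2
  have hi_q : Integrable (fun q : E D × E D => ‖q.2 - q.1‖ ^ 2) γ :=
    (memLp_sub hγc).integrable_norm_pow (by norm_num)
  -- the cost of the optimal coupling
  have hcost : ∫ q, ‖q.2 - q.1‖ ^ 2 ∂γ ≤ h ^ 2 * m + (2 * M * C + C ^ 2) * |h| ^ 3 := by
    have hg := graph_mem_couplings hΘ hν
    have h1 := hγ.2 _ hg
    rw [transportCost_eq hγc, transportCost_eq hg, ENNReal.ofReal_le_ofReal_iff
      (integral_nonneg fun _ => by positivity), integral_map (by fun_prop) (by fun_prop)] at h1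
    refine h1.trans ?_
    have h3 : ∀ x, ‖Θ x - x‖ ^ 2 ≤ h ^ 2 * ‖u x‖ ^ 2 + (2 * M * C + C ^ 2) * |h| ^ 3 := fun x => by
      calc ‖Θ x - x‖ ^ 2 ≤ (|h| * ‖u x‖ + C * h ^ 2) ^ 2 :=
            pow_le_pow_left₀ (norm_nonneg _) (hd x) 2
        _ = h ^ 2 * ‖u x‖ ^ 2 + 2 * ‖u x‖ * C * |h| ^ 3 + C ^ 2 * |h| ^ 4 := by
            rw [← hsq]; ring
        _ ≤ h ^ 2 * ‖u x‖ ^ 2 + 2 * M * C * |h| ^ 3 + C ^ 2 * |h| ^ 3 := by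
            have := hu.norm_le x
            gcongr
        _ = _ := by ring
    calc ∫ x, ‖Θ x - x‖ ^ 2 ∂μ.toMeasure
        ≤ ∫ x, (h ^ 2 * ‖u x‖ ^ 2 + (2 * M * C + C ^ 2) * |h| ^ 3) ∂μ.toMeasure :=
          integral_mono hi_Θ ((hi_u.const_mul _).add (integrable_const _)) h3
      _ = _ := by
          rw [integral_add (hi_u.const_mul _) (integrable_const _), integral_const_mul]
          simp [hm]
  -- the increment of the potential, whose integral depends only on the marginals of the coupling,
  -- so that it may be computed with the coupling `(id, Θ)`
  have hi_f1 := (memLp_fst hγc (memLp_one_iff_integrable.2 (hu.integrable_potential μ)))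
  have hi_f2 := (memLp_snd hγc (memLp_one_iff_integrable.2 (hu.integrable_potential ν)))
  rw [memLp_one_iff_integrable] at hi_f1 hi_f2
  have hi_fΘ : Integrable (fun x => f (Θ x)) μ.toMeasure := by
    have := hν ▸ hu.integrable_potential ν
    exact this.comp_measurable hΘ
  have hpot : |∫ q, (f q.2 - f q.1) ∂γ - h * m| ≤ (L * (M + C) ^ 2 + M * C) * h ^ 2 := by
    have e1 : ∫ q, (f q.2 - f q.1) ∂γ - h * m =
        ∫ x, (f (Θ x) - f x - h * ‖u x‖ ^ 2) ∂μ.toMeasure := by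
      rw [integral_sub hi_f2 hi_f1, integral_fst hγc hu.continuous_potential.aestronglyMeasurable,
        integral_snd hγc hu.continuous_potential.aestronglyMeasurable, hν,
        integral_map hΘ.aemeasurable hu.continuous_potential.aestronglyMeasurable,
        integral_sub (f := fun x => f (Θ x) - f x) (hi_fΘ.sub (hu.integrable_potential μ))
          (hi_u.const_mul _), integral_sub hi_fΘ (hu.integrable_potential μ), integral_const_mul]
    rw [e1, ← Real.norm_eq_abs]
    refine (norm_integral_le_of_norm_le_const (C := (L * (M + C) ^ 2 + M * C) * h ^ 2)
      (Eventually.of_forall fun x => ?_)).trans (by simp)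
    have t1 := hu.taylor x (Θ x)
    have t2 : |⟪u x, Θ x - x⟫_ℝ - h * ‖u x‖ ^ 2| ≤ M * C * h ^ 2 := by
      have : ⟪u x, Θ x - x⟫_ℝ - h * ‖u x‖ ^ 2 = ⟪u x, Θ x - x - h • u x⟫_ℝ := by
        rw [inner_sub_right (u x) (Θ x - x), inner_smul_right, real_inner_self_eq_norm_sq]
      rw [this]
      calc _ ≤ ‖u x‖ * ‖Θ x - x - h • u x‖ := abs_real_inner_le_norm _ _
        _ ≤ M * (C * h ^ 2) := by gcongr; exacts [hu.norm_le x, hexp x]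
        _ = _ := by ring
    have t3 : L * ‖Θ x - x‖ ^ 2 ≤ L * (M + C) ^ 2 * h ^ 2 := by
      calc L * ‖Θ x - x‖ ^ 2 ≤ L * ((M + C) * |h|) ^ 2 := by gcongr; exact hd' x
        _ = _ := by rw [mul_pow, hsq]; ring
    rw [Real.norm_eq_abs]
    calc |f (Θ x) - f x - h * ‖u x‖ ^ 2| = |(f (Θ x) - f x - ⟪u x, Θ x - x⟫_ℝ) +
          (⟪u x, Θ x - x⟫_ℝ - h * ‖u x‖ ^ 2)| := by ring_nf
      _ ≤ _ := abs_add_le _ _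
      _ ≤ L * (M + C) ^ 2 * h ^ 2 + M * C * h ^ 2 := add_le_add (t1.trans t3) t2
      _ = _ := by ring
  -- expand the square pointwise, trading the scalar product for the potential
  have hpt : ∀ q : E D × E D, ‖q.2 - q.1 - h • u q.1‖ ^ 2 ≤
      (1 + 2 * |h| * L) * ‖q.2 - q.1‖ ^ 2 - 2 * h * (f q.2 - f q.1) + h ^ 2 * ‖u q.1‖ ^ 2 := by
    intro q
    have t1 := hu.taylor q.1 q.2
    have t2 : |h * (f q.2 - f q.1 - ⟪u q.1, q.2 - q.1⟫_ℝ)| ≤ |h| * (L * ‖q.2 - q.1‖ ^ 2) := by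
      rw [abs_mul]; gcongr
    have t3 := (abs_le.1 t2).2
    rw [@norm_sub_sq ℝ, norm_smul, inner_smul_right, real_inner_comm, mul_pow, Real.norm_eq_abs,
      hsq]
    simp only [RCLike.re_to_real]
    linarith
  have hi_u1 := (memLp_fst hγc (memLp_one_iff_integrable.2 hi_u))
  rw [memLp_one_iff_integrable] at hi_u1
  have hi_e : Integrable (fun q : E D × E D => ‖q.2 - q.1 - h • u q.1‖ ^ 2) γ :=
    ((memLp_sub hγc).sub ((memLp_fst hγc (hu.memLp μ 2)).const_smul h)).integrable_norm_pow
      (by norm_num)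
  have hint : ∫ q, ‖q.2 - q.1 - h • u q.1‖ ^ 2 ∂γ ≤
      (1 + 2 * |h| * L) * ∫ q, ‖q.2 - q.1‖ ^ 2 ∂γ - 2 * h * ∫ q, (f q.2 - f q.1) ∂γ
        + h ^ 2 * m := by
    have e1 : ∫ q, ‖u q.1‖ ^ 2 ∂γ = m :=
      integral_fst hγc (g := fun x => ‖u x‖ ^ 2) hi_u.aestronglyMeasurable
    calc _ ≤ _ := integral_mono hi_e (((hi_q.const_mul _).sub
          ((hi_f2.sub hi_f1).const_mul _)).add (hi_u1.const_mul _)) hpt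
      _ = _ := by
        rw [integral_add' ((hi_q.const_mul _).sub ((hi_f2.sub hi_f1).const_mul _))
          (hi_u1.const_mul _), integral_sub' (hi_q.const_mul _) ((hi_f2.sub hi_f1).const_mul _)]
        simp only [integral_const_mul, Pi.sub_apply]
        rw [e1]
  have hpot' : -(2 * h * ∫ q, (f q.2 - f q.1) ∂γ) ≤
      -2 * h ^ 2 * m + 2 * (L * (M + C) ^ 2 + M * C) * |h| ^ 3 := by
    have t1 : |h * (∫ q, (f q.2 - f q.1) ∂γ - h * m)| ≤
        |h| * ((L * (M + C) ^ 2 + M * C) * h ^ 2) := by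
      rw [abs_mul]; gcongr
    have t2 := (abs_le.1 t1).1
    have t3 : |h| * ((L * (M + C) ^ 2 + M * C) * h ^ 2) =
        (L * (M + C) ^ 2 + M * C) * |h| ^ 3 := by rw [← hsq]; ring
    rw [t3] at t2
    linarith
  have hcost2 : ∫ q, ‖q.2 - q.1‖ ^ 2 ∂γ ≤ (M + C) ^ 2 * h ^ 2 := by
    have hg := graph_mem_couplings hΘ hν
    have h1 := hγ.2 _ hg
    rw [transportCost_eq hγc, transportCost_eq hg, ENNReal.ofReal_le_ofReal_iff
      (integral_nonneg fun _ => by positivity), integral_map (by fun_prop) (by fun_prop)] at h1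
    refine h1.trans ?_
    calc ∫ x, ‖Θ x - x‖ ^ 2 ∂μ.toMeasure ≤ ∫ _, (M + C) ^ 2 * h ^ 2 ∂μ.toMeasure :=
          integral_mono hi_Θ (integrable_const _) fun x => by
            rw [← hsq, ← mul_pow]
            exact pow_le_pow_left₀ (norm_nonneg _) (hd' x) 2
      _ = _ := by simp
  have hcost3 : 2 * |h| * L * ∫ q, ‖q.2 - q.1‖ ^ 2 ∂γ ≤ 2 * L * (M + C) ^ 2 * |h| ^ 3 := by
    calc _ ≤ 2 * |h| * L * ((M + C) ^ 2 * h ^ 2) := by gcongr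
      _ = _ := by rw [← hsq]; ring
  linarith

lemma integrable_inner_of_memLp {α : Type*} [MeasurableSpace α] {P : Measure α} {X Y : α → E D}
    (hX : MemLp X 2 P) (hY : MemLp Y 2 P) : Integrable (fun a => ⟪X a, Y a⟫_ℝ) P :=
  (hX.norm.integrable_mul hY.norm).mono' (hX.aestronglyMeasurable.inner hY.aestronglyMeasurable)
    (Eventually.of_forall fun a => norm_inner_le_norm (X a) (Y a))

set_option maxHeartbeats 600000 in
/-- A differentiable function has the expected derivative along a family of transport maps that
displaces `μ` to first order by a gradient field `u`. -/
theorem IsSubSupergradient.abs_sub_le_of_map {F : WSpace D → ℝ} {μ : WSpace D} {ξ : L2 μ}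
    (hF : IsSubSupergradient F μ ξ) {u : E D → E D} {f : E D → ℝ} {M L : ℝ}
    (hu : IsGradientField u f M L) {C : ℝ} (hC : 0 ≤ C) {ε : ℝ} (hε : 0 < ε) :
    ∃ δ > 0, ∀ h : ℝ, |h| < δ → ∀ (ν : WSpace D) (Θ : E D → E D), Measurable Θ →
      ν.toMeasure = μ.toMeasure.map Θ → (∀ x, ‖Θ x - x - h • u x‖ ≤ C * h ^ 2) →
      |F ν - F μ - h * ⟪ξ, toL2 μ u⟫_ℝ| ≤ ε * |h| := by
  have hM := hu.bound_nonneg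
  have hL := hu.nonneg
  set K : ℝ := 4 * L * (M + C) ^ 2 + 4 * M * C + C ^ 2 with hK
  have hK0 : 0 ≤ K := by positivity
  set a : ℝ := ∫ x, ‖ξ x‖ ^ 2 ∂μ.toMeasure with ha
  have ha0 : 0 ≤ a := integral_nonneg fun _ => by positivity
  -- `η` is the weight in Young's inequality; `ε'` absorbs the bound `M + C` for `W₂(μ, ν) / |h|`
  set η : ℝ := ε / (2 * (a + 1)) with hη
  have hη0 : 0 < η := by positivity
  set ε' : ℝ := ε / (4 * (M + C + 1)) with hε'
  have hε'0 : 0 < ε' := by positivity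
  obtain ⟨δ1, hδ1, H1⟩ := hF.1 ε' hε'0
  obtain ⟨δ2, hδ2, H2⟩ := hF.2 ε' hε'0
  refine ⟨min 1 (min (min δ1 δ2 / (M + C + 1)) (ε * η / (2 * (K + 1)))), by positivity, ?_⟩
  intro h hh ν Θ hΘ hν hexp
  rw [lt_min_iff, lt_min_iff] at hh
  obtain ⟨hh1, hh2, hh3⟩ := hh
  have hab : 0 ≤ |h| := abs_nonneg h
  have hsq : |h| ^ 2 = h ^ 2 := sq_abs h
  have hh' : h ^ 2 ≤ |h| := by
    rw [← hsq]; exact (pow_le_pow_of_le_one hab hh1.le (by norm_num : 1 ≤ 2)).trans (by simp)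
  have hW : W2 μ ν ≤ (M + C) * |h| := by
    refine W2_le_of_dist_le hΘ hν (by positivity) fun x => ?_
    calc ‖Θ x - x‖ = ‖h • u x + (Θ x - x - h • u x)‖ := by congr 1; abel
      _ ≤ ‖h • u x‖ + ‖Θ x - x - h • u x‖ := norm_add_le _ _
      _ ≤ |h| * M + C * |h| := by
          rw [norm_smul, Real.norm_eq_abs]
          gcongr
          · exact hu.norm_le x
          · exact (hexp x).trans (by gcongr)
      _ = _ := by ring
  have hWδ : W2 μ ν < min δ1 δ2 := by
    rw [lt_div_iff₀ (by positivity)] at hh2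
    nlinarith
  obtain ⟨γ, hγ⟩ := exists_optCoupling μ ν
  have hγc := hγ.1
  have := couplings_isProb hγc
  have G1 := H1 ν (hWδ.trans_le (min_le_left _ _)) γ hγ
  have G2 := H2 ν (hWδ.trans_le (min_le_right _ _)) γ hγ
  have hneg : ∫ p, ⟪(-ξ : L2 μ) p.1, p.2 - p.1⟫_ℝ ∂γ = -∫ p, ⟪ξ p.1, p.2 - p.1⟫_ℝ ∂γ := by
    rw [← integral_neg]
    refine integral_congr_ae ?_
    have h1 : ∀ᵐ x ∂(γ.map Prod.fst), (-ξ : L2 μ) x = -ξ x := by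
      rw [hγc.1]; exact Lp.coeFn_neg ξ
    filter_upwards [ae_of_ae_map (by fun_prop) h1] with p hp
    rw [hp, inner_neg_left]
  rw [hneg] at G2
  set J : ℝ := ∫ p, ⟪ξ p.1, p.2 - p.1⟫_ℝ ∂γ with hJ
  have hξ := memLp_fst hγc (Lp.memLp ξ)
  have hur := (hu.memLp μ 2)
  have hu1 := memLp_fst hγc hur
  have hinner : ⟪ξ, toL2 μ u⟫_ℝ = ∫ p, ⟪ξ p.1, u p.1⟫_ℝ ∂γ := by
    rw [integral_fst hγc (g := fun x => ⟪ξ x, u x⟫_ℝ)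
      ((Lp.memLp ξ).aestronglyMeasurable.inner hur.aestronglyMeasurable), L2.inner_def]
    refine integral_congr_ae ?_
    have h1 : toL2 μ u =ᵐ[μ.toMeasure] u := by
      rw [toL2, dif_pos hur]; exact hur.coeFn_toLp
    filter_upwards [h1] with x hx
    rw [hx]
  have hr : MemLp (fun q : E D × E D => q.2 - q.1 - h • u q.1) 2 γ :=
    (memLp_sub hγc).sub (hu1.const_smul h)
  have hsplit : J - h * ⟪ξ, toL2 μ u⟫_ℝ = ∫ p, ⟪ξ p.1, p.2 - p.1 - h • u p.1⟫_ℝ ∂γ := by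
    rw [hinner, hJ, ← integral_const_mul, ← integral_sub]
    · refine integral_congr_ae (Eventually.of_forall fun p => ?_)
      simp only [inner_sub_right, inner_smul_right]
    · exact integrable_inner_of_memLp hξ (memLp_sub hγc)
    · exact (integrable_inner_of_memLp hξ hu1).const_mul _
  have hkey := hu.integral_optCoupling_le hC hh1.le hΘ hν hexp hγ
  -- the deviation of the coupling from `x ↦ x + h • u x` contributes `o(h)`
  have hrest : |J - h * ⟪ξ, toL2 μ u⟫_ℝ| ≤ ε / 2 * |h| := by
    rcases eq_or_ne h 0 with rfl | hne
    · have h0 : ∫ q, ‖q.2 - q.1 - (0 : ℝ) • u q.1‖ ^ 2 ∂γ = 0 :=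
        le_antisymm (by simpa using hkey) (integral_nonneg fun _ => by positivity)
      rw [integral_eq_zero_iff_of_nonneg (fun _ => by positivity)
        (hr.integrable_norm_pow (by norm_num))] at h0
      rw [hsplit]
      have : ∫ p, ⟪ξ p.1, p.2 - p.1 - (0 : ℝ) • u p.1⟫_ℝ ∂γ = ∫ _, (0 : ℝ) ∂γ := by
        refine integral_congr_ae ?_
        filter_upwards [h0] with p hp
        have : p.2 - p.1 - (0 : ℝ) • u p.1 = 0 := by simpa using! hp
        rw [this, inner_zero_right]
      rw [this]; simp
    have hpos : 0 < |h| := abs_pos.2 hne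
    rw [hsplit, ← Real.norm_eq_abs]
    -- Young's inequality with weight `η * |h|`
    have hy : ∀ p : E D × E D, ‖⟪ξ p.1, p.2 - p.1 - h • u p.1⟫_ℝ‖ ≤
        η * |h| / 2 * ‖ξ p.1‖ ^ 2 + 1 / (2 * (η * |h|)) * ‖p.2 - p.1 - h • u p.1‖ ^ 2 := by
      intro p
      refine (norm_inner_le_norm _ _).trans ?_
      have hw : 0 < η * |h| := by positivity
      have := two_mul_le_add_sq (η * |h| * ‖ξ p.1‖) ‖p.2 - p.1 - h • u p.1‖
      rw [← sub_nonneg]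
      have e : η * |h| / 2 * ‖ξ p.1‖ ^ 2 + 1 / (2 * (η * |h|)) * ‖p.2 - p.1 - h • u p.1‖ ^ 2
          - ‖ξ p.1‖ * ‖p.2 - p.1 - h • u p.1‖ = 1 / (2 * (η * |h|)) *
          ((η * |h| * ‖ξ p.1‖) ^ 2 + ‖p.2 - p.1 - h • u p.1‖ ^ 2
            - 2 * (η * |h| * ‖ξ p.1‖) * ‖p.2 - p.1 - h • u p.1‖) := by
        field_simp
      rw [e]
      exact mul_nonneg (by positivity) (by linarith)
    have hi1 := hξ.integrable_norm_pow (p := 2) (by norm_num)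
    have hi2 := hr.integrable_norm_pow (p := 2) (by norm_num)
    calc _ ≤ ∫ p, (η * |h| / 2 * ‖ξ p.1‖ ^ 2 +
            1 / (2 * (η * |h|)) * ‖p.2 - p.1 - h • u p.1‖ ^ 2) ∂γ :=
          norm_integral_le_of_norm_le ((hi1.const_mul _).add (hi2.const_mul _))
            (Eventually.of_forall hy)
      _ = η * |h| / 2 * a + 1 / (2 * (η * |h|)) * ∫ p, ‖p.2 - p.1 - h • u p.1‖ ^ 2 ∂γ := by
          rw [integral_add (hi1.const_mul _) (hi2.const_mul _), integral_const_mul,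
            integral_const_mul, integral_fst hγc (g := fun x => ‖ξ x‖ ^ 2)
            ((Lp.memLp ξ).aestronglyMeasurable.norm.pow 2)]
      _ ≤ η * |h| / 2 * a + 1 / (2 * (η * |h|)) * (K * |h| ^ 3) := by gcongr
      _ = |h| * (η * a / 2) + |h| * (K * |h| / (2 * η)) := by field_simp
      _ ≤ |h| * (ε / 4) + |h| * (ε / 4) := by
          have t1 : η * a / 2 ≤ ε / 4 := by
            rw [hη, div_mul_eq_mul_div, div_div, div_le_div_iff₀ (by positivity) (by norm_num)]
            nlinarith
          have t2 : K * |h| / (2 * η) ≤ ε / 4 := by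
            rw [lt_div_iff₀ (by positivity)] at hh3
            rw [div_le_div_iff₀ (by positivity) (by norm_num)]
            nlinarith
          exact add_le_add (mul_le_mul_of_nonneg_left t1 hab) (mul_le_mul_of_nonneg_left t2 hab)
      _ = _ := by ring
  have hsmall : ε' * W2 μ ν ≤ ε / 2 * |h| := by
    calc ε' * W2 μ ν ≤ ε' * ((M + C) * |h|) := by gcongr
      _ = (ε' * (M + C)) * |h| := by ring
      _ ≤ ε / 2 * |h| := by
        gcongr
        rw [hε', div_mul_eq_mul_div, div_le_div_iff₀ (by positivity) (by norm_num)]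
        have := mul_nonneg hε.le (add_nonneg hM hC)
        linarith
  rw [abs_le] at hrest ⊢
  constructor <;> linarith [hrest.1, hrest.2]

/-! ### Displacements and directional derivatives -/

/-- The measure `(id + h u)_# μ`, for a bounded continuous field `u`. -/
def WSpace.displace (μ : WSpace D) {u : E D → E D} (hu : Continuous u) {M : ℝ}
    (hM : ∀ x, ‖u x‖ ≤ M) (h : ℝ) : WSpace D where
  toMeasure := μ.toMeasure.map fun x => x + h • u x
  isProb := Measure.isProbabilityMeasure_map (by fun_prop)
  secondMoment := by
    have h1 : MemLp (fun x => x + h • u x) 2 μ.toMeasure :=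
      (memLp_id μ).add ((MemLp.of_bound hu.aestronglyMeasurable M
        (Eventually.of_forall hM)).const_smul h)
    have h2 := lintegral_rpow_enorm_lt_top_of_eLpNorm_lt_top (by simp) (by simp) h1.2
    rw [lintegral_map (by fun_prop) (by fun_prop)]
    simpa using h2

lemma toL2_coeFn (μ : WSpace D) {X : E D → E D} (hX : MemLp X 2 μ.toMeasure) :
    toL2 μ X =ᵐ[μ.toMeasure] X := by
  rw [toL2, dif_pos hX]; exact hX.coeFn_toLp

lemma toL2_add (μ : WSpace D) {X Y : E D → E D} (hX : MemLp X 2 μ.toMeasure)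
    (hY : MemLp Y 2 μ.toMeasure) : toL2 μ (X + Y) = toL2 μ X + toL2 μ Y := by
  rw [toL2, toL2, toL2, dif_pos hX, dif_pos hY, dif_pos (hX.add hY)]
  exact MemLp.toLp_add hX hY

lemma toL2_sub (μ : WSpace D) {X Y : E D → E D} (hX : MemLp X 2 μ.toMeasure)
    (hY : MemLp Y 2 μ.toMeasure) : toL2 μ (X - Y) = toL2 μ X - toL2 μ Y := by
  rw [toL2, toL2, toL2, dif_pos hX, dif_pos hY, dif_pos (hX.sub hY)]
  exact MemLp.toLp_sub hX hY

lemma toL2_smul (μ : WSpace D) {X : E D → E D} (hX : MemLp X 2 μ.toMeasure) (c : ℝ) :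
    toL2 μ (c • X) = c • toL2 μ X := by
  rw [toL2, toL2, dif_pos hX, dif_pos (hX.const_smul c)]
  exact MemLp.toLp_const_smul c hX

lemma norm_toL2_sq (μ : WSpace D) {X : E D → E D} (hX : MemLp X 2 μ.toMeasure) :
    ‖toL2 μ X‖ ^ 2 = ∫ x, ‖X x‖ ^ 2 ∂μ.toMeasure := by
  rw [← real_inner_self_eq_norm_sq, L2.inner_def]
  refine integral_congr_ae ?_
  filter_upwards [toL2_coeFn μ hX] with x hx
  rw [hx, real_inner_self_eq_norm_sq]

lemma norm_toL2_le (μ : WSpace D) {X : E D → E D} (hX : MemLp X 2 μ.toMeasure) {c : ℝ}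
    (hc : ∀ x, ‖X x‖ ≤ c) : ‖toL2 μ X‖ ≤ c := by
  have hc0 : 0 ≤ c := (norm_nonneg _).trans (hc 0)
  refine (pow_le_pow_iff_left₀ (norm_nonneg _) hc0 two_ne_zero).1 ?_
  rw [norm_toL2_sq μ hX]
  have : ∫ x, ‖X x‖ ^ 2 ∂μ.toMeasure ≤ ∫ _, c ^ 2 ∂μ.toMeasure :=
    integral_mono_of_nonneg (Eventually.of_forall fun _ => by positivity) (integrable_const _)
      (Eventually.of_forall fun x => pow_le_pow_left₀ (norm_nonneg _) (hc x) 2)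
  simpa using this

lemma tangentProj_of_mem (μ : WSpace D) {X : L2 μ} (hX : X ∈ tangentSpace μ) :
    tangentProj μ X = ⟨X, hX⟩ :=
  Submodule.orthogonalProjectionOnto_mem_subspace_eq_self (⟨X, hX⟩ : tangentSpace μ)

lemma norm_tangentProj_le (μ : WSpace D) (X : L2 μ) : ‖tangentProj μ X‖ ≤ ‖X‖ :=
  Submodule.norm_orthogonalProjectionOnto_apply_le _ X

lemma inner_tangentProj (μ : WSpace D) (X : L2 μ) {Y : L2 μ} (hY : Y ∈ tangentSpace μ) :
    ⟪(tangentProj μ X : L2 μ), Y⟫_ℝ = ⟪X, Y⟫_ℝ :=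
  Submodule.inner_orthogonalProjectionOnto_eq_of_mem_right (⟨Y, hY⟩ : tangentSpace μ) X

lemma WSpace.ext {μ ν : WSpace D} (h : μ.toMeasure = ν.toMeasure) : μ = ν := by
  cases μ; cases ν; cases h; rfl

lemma WSpace.displace_zero (μ : WSpace D) {u : E D → E D} (hu : Continuous u) {M : ℝ}
    (hM : ∀ x, ‖u x‖ ≤ M) : μ.displace hu hM 0 = μ := by
  refine WSpace.ext ?_
  simp [WSpace.displace]

lemma WSpace.W2_displace_le (μ : WSpace D) {u : E D → E D} (hu : Continuous u) {M : ℝ}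
    (hM : ∀ x, ‖u x‖ ≤ M) (h : ℝ) : W2 μ (μ.displace hu hM h) ≤ |h| * ‖toL2 μ u‖ := by
  have hLp : MemLp u 2 μ.toMeasure :=
    MemLp.of_bound hu.aestronglyMeasurable M (Eventually.of_forall hM)
  refine W2_le_of_map (Θ := fun x => x + h • u x) (by fun_prop) rfl (by positivity) (le_of_eq ?_)
  rw [mul_pow, norm_toL2_sq μ hLp, ← integral_const_mul]
  simp [norm_smul, mul_pow]

/-- The directional derivative of a differentiable function, with the subgradient that defines
`∇_μ F`. -/
lemma dirDeriv_eq_inner {F : WSpace D → ℝ} {μ : WSpace D} (hF : WDifferentiableAt F μ)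
    {X : E D → E D} (hX : toL2 μ X ∈ tangentSpace μ) :
    dirDeriv X F μ = ⟪hF.choose, toL2 μ X⟫_ℝ := by
  rw [dirDeriv, wGradient, dif_pos hF, inner_tangentProj μ _ hX]

/-- In a tangent direction `u = ∇f`, `dirDeriv u F μ` is the derivative of `F` along any family of
maps that displaces `μ` to first order by `u`. -/
lemma abs_sub_dirDeriv_le {F : WSpace D → ℝ} {μ : WSpace D} (hF : WDifferentiableAt F μ)
    {u : E D → E D} {f : E D → ℝ} {M L : ℝ} (hu : IsGradientField u f M L)
    (hT : toL2 μ u ∈ tangentSpace μ) {C : ℝ} (hC : 0 ≤ C) {ε : ℝ} (hε : 0 < ε) :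
    ∃ δ > 0, ∀ h : ℝ, |h| < δ → ∀ (ν : WSpace D) (Θ : E D → E D), Measurable Θ →
      ν.toMeasure = μ.toMeasure.map Θ → (∀ x, ‖Θ x - x - h • u x‖ ≤ C * h ^ 2) →
      |F ν - F μ - h * dirDeriv u F μ| ≤ ε * |h| := by
  rw [dirDeriv_eq_inner hF hT]
  exact hF.choose_spec.abs_sub_le_of_map hu hC hε

lemma hasDerivAt_displace {F : WSpace D → ℝ} {μ : WSpace D} (hF : WDifferentiableAt F μ)
    {u : E D → E D} {f : E D → ℝ} {M L : ℝ} (hu : IsGradientField u f M L)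
    (hT : toL2 μ u ∈ tangentSpace μ) :
    HasDerivAt (fun h => F (μ.displace hu.continuous hu.norm_le h)) (dirDeriv u F μ) 0 := by
  rw [hasDerivAt_iff_isLittleO_nhds_zero, Asymptotics.isLittleO_iff]
  intro c hc
  obtain ⟨δ, hδ, H⟩ := abs_sub_dirDeriv_le hF hu hT (C := 0) le_rfl hc
  filter_upwards [Metric.ball_mem_nhds (0 : ℝ) hδ] with h hh
  have := H h (by simpa using! hh) (μ.displace hu.continuous hu.norm_le h) (fun x => x + h • u x)
    (by have := hu.continuous; fun_prop) rfl (by simp)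
  simpa [WSpace.displace_zero] using this

/-! ### Test functions -/

lemma IsTest.add {V W : Type*} [NormedAddCommGroup V] [NormedSpace ℝ V]
    [NormedAddCommGroup W] [NormedSpace ℝ W] {f g : V → W} (hf : IsTest f) (hg : IsTest g) :
    IsTest (f + g) := ⟨hf.1.add hg.1, hf.2.add hg.2⟩

lemma IsTest.const_smul {V W : Type*} [NormedAddCommGroup V] [NormedSpace ℝ V]
    [NormedAddCommGroup W] [NormedSpace ℝ W] {f : V → W} (hf : IsTest f) (c : ℝ) :
    IsTest (c • f) := ⟨hf.1.const_smul c, hf.2.smul_left (f := fun _ => c)⟩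

lemma IsTest.bounded {V W : Type*} [NormedAddCommGroup V] [NormedSpace ℝ V]
    [NormedAddCommGroup W] [NormedSpace ℝ W] {f : V → W} (hf : IsTest f) : ∃ M, ∀ x, ‖f x‖ ≤ M :=
  hf.2.exists_bound_of_continuous hf.1.continuous

lemma IsTest.memLp {X : E D → E D} (hX : IsTest X) (μ : WSpace D) : MemLp X 2 μ.toMeasure := by
  obtain ⟨M, hM⟩ := hX.bounded
  exact MemLp.of_bound hX.1.continuous.aestronglyMeasurable M (Eventually.of_forall hM)

lemma IsTest.gradient {f : E D → ℝ} (hf : IsTest f) : IsTest (∇ f) := by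
  refine ⟨?_, ?_⟩
  · have h1 : ContDiff ℝ ∞ (fderiv ℝ f) := hf.1.fderiv_right (by simp)
    exact (InnerProductSpace.toDual ℝ (E D)).symm.contDiff.comp h1
  · exact (hf.2.fderiv (𝕜 := ℝ)).comp_left (g := (InnerProductSpace.toDual ℝ (E D)).symm) (by simp)

lemma IsTest.differentiable {V W : Type*} [NormedAddCommGroup V] [NormedSpace ℝ V]
    [NormedAddCommGroup W] [NormedSpace ℝ W] {f : V → W} (hf : IsTest f) : Differentiable ℝ f :=
  hf.1.differentiable (by simp)

lemma IsTest.isGradientField {f : E D → ℝ} (hf : IsTest f) :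
    ∃ M L, IsGradientField (∇ f) f M L := by
  obtain ⟨M, hM⟩ := hf.gradient.bounded
  obtain ⟨K, hK⟩ := hf.gradient.1.lipschitzWith_of_hasCompactSupport hf.gradient.2 (by simp)
  exact ⟨M, K, fun x => (hf.differentiable x).hasGradientAt, hM,
    fun x y => by simpa [dist_eq_norm] using! hK.dist_le_mul x y, K.2⟩

lemma IsTest.toL2_gradient_mem {f : E D → ℝ} (hf : IsTest f) (μ : WSpace D) :
    toL2 μ (∇ f) ∈ tangentSpace μ :=
  Submodule.le_topologicalClosure _ (Submodule.subset_span ⟨f, hf, rfl⟩)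

lemma gradient_add' {f g : E D → ℝ} (hf : Differentiable ℝ f) (hg : Differentiable ℝ g) :
    ∇ (f + g) = ∇ f + ∇ g := by
  funext x
  simp only [_root_.gradient, Pi.add_apply, fderiv_add (hf x) (hg x), map_add]

lemma gradient_smul' {f : E D → ℝ} (hf : Differentiable ℝ f) (c : ℝ) :
    ∇ (c • f) = c • ∇ f := by
  funext x
  simp only [_root_.gradient, Pi.smul_apply, fderiv_const_smul (hf x) c]
  simp

/-! ### The exterior derivative as a continuous bilinear form -/

/-- The space of test functions. -/
def testFunctions (D : ℕ) : Submodule ℝ (E D → ℝ) where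
  carrier := {f | IsTest f}
  add_mem' := IsTest.add
  zero_mem' := ⟨contDiff_const, HasCompactSupport.zero⟩
  smul_mem' c _ hf := hf.const_smul c

/-- The gradient of test functions, as a map to the tangent space. -/
def gradMap (μ : WSpace D) : testFunctions D →ₗ[ℝ] tangentSpace μ where
  toFun f := tangentProj μ (toL2 μ (∇ f.1))
  map_add' f g := by
    have hf : IsTest f.1 := f.2
    have hg : IsTest g.1 := g.2
    rw [Submodule.coe_add, gradient_add' hf.differentiable hg.differentiable,
      toL2_add μ (hf.gradient.memLp μ) (hg.gradient.memLp μ), map_add]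
  map_smul' c f := by
    have hf : IsTest f.1 := f.2
    rw [Submodule.coe_smul, gradient_smul' hf.differentiable,
      toL2_smul μ (hf.gradient.memLp μ), map_smul, RingHom.id_apply]

lemma coe_gradMap (μ : WSpace D) (f : testFunctions D) :
    (gradMap μ f : L2 μ) = toL2 μ (∇ f.1) := by
  have := tangentProj_of_mem μ (IsTest.toL2_gradient_mem f.2 μ)
  exact congrArg Subtype.val this

/-- The gradients of test functions are dense in the tangent space: they form a linear space, so
that the span in the definition of the tangent space may be dropped. -/
lemma denseRange_gradMap (μ : WSpace D) : DenseRange (gradMap μ) := by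
  let e : testFunctions D →ₗ[ℝ] L2 μ := (tangentSpace μ).subtype ∘ₗ gradMap μ
  have hle : Submodule.span ℝ {X | ∃ f : E D → ℝ, IsTest f ∧ X = toL2 μ (∇ f)} ≤
      LinearMap.range e := by
    rw [Submodule.span_le]
    rintro _ ⟨f, hf, rfl⟩
    exact ⟨⟨f, hf⟩, coe_gradMap μ _⟩
  rw [Metric.denseRange_iff]
  intro x r hr
  have hx : (x : L2 μ) ∈ closure (Submodule.span ℝ
      {X | ∃ f : E D → ℝ, IsTest f ∧ X = toL2 μ (∇ f)} : Set (L2 μ)) := x.2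
  obtain ⟨y, hy, hxy⟩ := Metric.mem_closure_iff.1 hx r hr
  obtain ⟨f, rfl⟩ := hle hy
  exact ⟨f, hxy⟩

lemma WDifferentiableAt.dirDeriv_add {F G : WSpace D → ℝ} {μ : WSpace D}
    (hF : WDifferentiableAt F μ) (hG : WDifferentiableAt G μ)
    (hFG : WDifferentiableAt (fun ν => F ν + G ν) μ) {f : E D → ℝ} (hf : IsTest f) :
    dirDeriv (∇ f) (fun ν => F ν + G ν) μ = dirDeriv (∇ f) F μ + dirDeriv (∇ f) G μ := by
  obtain ⟨M, L, hu⟩ := hf.isGradientField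
  have hT := hf.toL2_gradient_mem μ
  exact (hasDerivAt_displace hFG hu hT).unique
    ((hasDerivAt_displace hF hu hT).add (hasDerivAt_displace hG hu hT))

lemma WDifferentiableAt.dirDeriv_smul {F : WSpace D → ℝ} {μ : WSpace D} {c : ℝ}
    (hF : WDifferentiableAt F μ)
    (hcF : WDifferentiableAt (fun ν => c * F ν) μ) {f : E D → ℝ} (hf : IsTest f) :
    dirDeriv (∇ f) (fun ν => c * F ν) μ = c * dirDeriv (∇ f) F μ := by
  obtain ⟨M, L, hu⟩ := hf.isGradientField
  have hT := hf.toL2_gradient_mem μ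
  exact (hasDerivAt_displace hcF hu hT).unique ((hasDerivAt_displace hF hu hT).const_mul c)

lemma dirDeriv_add_left (F : WSpace D → ℝ) (μ : WSpace D) {X Y : E D → E D}
    (hX : MemLp X 2 μ.toMeasure) (hY : MemLp Y 2 μ.toMeasure) :
    dirDeriv (X + Y) F μ = dirDeriv X F μ + dirDeriv Y F μ := by
  simp only [dirDeriv, toL2_add μ hX hY, inner_add_right]

lemma dirDeriv_smul_left (F : WSpace D → ℝ) (μ : WSpace D) {X : E D → E D}
    (hX : MemLp X 2 μ.toMeasure) (c : ℝ) :
    dirDeriv (c • X) F μ = c * dirDeriv X F μ := by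
  simp only [dirDeriv, toL2_smul μ hX, inner_smul_right]

lemma IsTest.lieBracket {X Y : E D → E D} (hX : IsTest X) (hY : IsTest Y) :
    IsTest (VectorField.lieBracket ℝ X Y) := by
  have h1 : ContDiff ℝ ∞ (fderiv ℝ X) := hX.1.fderiv_right (by simp)
  have h2 : ContDiff ℝ ∞ (fderiv ℝ Y) := hY.1.fderiv_right (by simp)
  refine ⟨(h2.clm_apply hX.1).sub (h1.clm_apply hY.1), ?_⟩
  refine HasCompactSupport.intro hX.2 fun x hx => ?_
  have hx1 : X x = 0 := image_eq_zero_of_notMem_tsupport hx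
  have hx2 : fderiv ℝ X x = 0 :=
    image_eq_zero_of_notMem_tsupport fun h => hx (tsupport_fderiv_subset ℝ h)
  simp [VectorField.lieBracket, hx1, hx2]

/-- `dΛ_μ`, evaluated on gradients of test functions, is skew-symmetric. -/
lemma PseudoOneForm.dField_swap (Λ : PseudoOneForm D) (μ : WSpace D) {X Y : E D → E D}
    (hX : IsTest X) (hY : IsTest Y) : Λ.dField μ Y X = -Λ.dField μ X Y := by
  have h1 : VectorField.lieBracket ℝ Y X = (-1 : ℝ) • VectorField.lieBracket ℝ X Y := by
    funext x; simp [VectorField.lieBracket]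
  rw [dField, dField, h1, toL2_smul μ ((hX.lieBracket hY).memLp μ), map_smul]
  simp only [smul_eq_mul]
  ring

lemma PseudoOneForm.dField_add_right {Λ : PseudoOneForm D} (hΛ : Λ.IsDifferentiable)
    (μ : WSpace D) {f g g' : E D → ℝ} (hf : IsTest f) (hg : IsTest g) (hg' : IsTest g') :
    Λ.dField μ (∇ f) (∇ (g + g')) = Λ.dField μ (∇ f) (∇ g) + Λ.dField μ (∇ f) (∇ g') := by
  have e1 : (fun ν => Λ ν (toL2 ν (∇ (g + g')))) =
      fun ν => Λ ν (toL2 ν (∇ g)) + Λ ν (toL2 ν (∇ g')) := by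
    funext ν
    rw [gradient_add' hg.differentiable hg'.differentiable, toL2_add ν (hg.gradient.memLp ν)
      (hg'.gradient.memLp ν), map_add]
  have h0 := hΛ.1 _ (hg.add hg').gradient μ
  rw [e1] at h0
  rw [dField, dField, dField, e1, (hΛ.1 _ hg.gradient μ).dirDeriv_add (hΛ.1 _ hg'.gradient μ) h0 hf,
    gradient_add' hg.differentiable hg'.differentiable,
    dirDeriv_add_left _ _ (hg.gradient.memLp μ) (hg'.gradient.memLp μ)]
  have e2 : VectorField.lieBracket ℝ (∇ f) (∇ g + ∇ g') =
      VectorField.lieBracket ℝ (∇ f) (∇ g) + VectorField.lieBracket ℝ (∇ f) (∇ g') := by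
    funext x
    exact VectorField.lieBracket_add_right (hg.gradient.differentiable x)
      (hg'.gradient.differentiable x)
  rw [e2, toL2_add μ ((hf.gradient.lieBracket hg.gradient).memLp μ)
    ((hf.gradient.lieBracket hg'.gradient).memLp μ), map_add]
  ring

lemma PseudoOneForm.dField_smul_right {Λ : PseudoOneForm D} (hΛ : Λ.IsDifferentiable)
    (μ : WSpace D) {f g : E D → ℝ} (hf : IsTest f) (hg : IsTest g) (c : ℝ) :
    Λ.dField μ (∇ f) (∇ (c • g)) = c * Λ.dField μ (∇ f) (∇ g) := by
  have e1 : (fun ν => Λ ν (toL2 ν (∇ (c • g)))) = fun ν => c * Λ ν (toL2 ν (∇ g)) := by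
    funext ν
    rw [gradient_smul' hg.differentiable, toL2_smul ν (hg.gradient.memLp ν), map_smul,
      smul_eq_mul]
  have h0 := hΛ.1 _ (hg.const_smul c).gradient μ
  rw [e1] at h0
  rw [dField, dField, e1, (hΛ.1 _ hg.gradient μ).dirDeriv_smul h0 hf,
    gradient_smul' hg.differentiable, dirDeriv_smul_left _ _ (hg.gradient.memLp μ)]
  have e2 : VectorField.lieBracket ℝ (∇ f) (c • ∇ g) =
      c • VectorField.lieBracket ℝ (∇ f) (∇ g) := by
    funext x
    exact VectorField.lieBracket_const_smul_right (hg.gradient.differentiable x)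
  rw [e2, toL2_smul μ ((hf.gradient.lieBracket hg.gradient).memLp μ), map_smul, smul_eq_mul]
  ring

/-- The values of `dΛ_μ` on gradients of test functions, as a bilinear form. -/
def PseudoOneForm.dTest {Λ : PseudoOneForm D} (hΛ : Λ.IsDifferentiable) (μ : WSpace D) :
    testFunctions D →ₗ[ℝ] testFunctions D →ₗ[ℝ] ℝ :=
  LinearMap.mk₂ ℝ (fun f g => Λ.dField μ (∇ f.1) (∇ g.1))
    (fun f f' g => by
      have hf : IsTest f.1 := f.2
      have hf' : IsTest f'.1 := f'.2
      have hg : IsTest g.1 := g.2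
      rw [Submodule.coe_add, dField_swap Λ μ hg.gradient (hf.add hf').gradient,
        dField_add_right hΛ μ hg hf hf', dField_swap Λ μ hf.gradient hg.gradient,
        dField_swap Λ μ hf'.gradient hg.gradient]
      ring)
    (fun c f g => by
      have hf : IsTest f.1 := f.2
      have hg : IsTest g.1 := g.2
      rw [Submodule.coe_smul, dField_swap Λ μ hg.gradient (hf.const_smul c).gradient,
        dField_smul_right hΛ μ hg hf, dField_swap Λ μ hf.gradient hg.gradient, smul_eq_mul]
      ring)
    (fun f g g' => dField_add_right hΛ μ f.2 g.2 g'.2)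
    (fun c f g => dField_smul_right hΛ μ f.2 g.2 c)

/-- A bilinear form on `N` that is bounded with respect to a map `e` with dense range extends to a
continuous bilinear form. -/
lemma exists_bilinear_extension {N V : Type*} [AddCommGroup N] [Module ℝ N]
    [NormedAddCommGroup V] [NormedSpace ℝ V] {e : N →ₗ[ℝ] V} (he : DenseRange e)
    (b : N →ₗ[ℝ] N →ₗ[ℝ] ℝ) {c : ℝ} (hc : 0 ≤ c) (hb : ∀ f g, ‖b f g‖ ≤ c * ‖e f‖ * ‖e g‖) :
    ∃ B : V →L[ℝ] V →L[ℝ] ℝ, ∀ f g, B (e f) (e g) = b f g := by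
  have h1 : ∀ f g, (b f).extendOfNorm e (e g) = b f g := fun f g =>
    LinearMap.extendOfNorm_eq he ⟨c * ‖e f‖, hb f⟩ g
  have hext : ∀ A B : V →L[ℝ] ℝ, (∀ g, A (e g) = B (e g)) → A = B := fun A B h =>
    ContinuousLinearMap.ext fun x => congrFun (he.equalizer A.continuous B.continuous (funext h)) x
  let B1 : N →ₗ[ℝ] (V →L[ℝ] ℝ) :=
    { toFun := fun f => (b f).extendOfNorm e
      map_add' := fun f f' => hext _ _ fun g => by
        rw [h1, add_apply, h1, h1, map_add, LinearMap.add_apply]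
      map_smul' := fun a f => hext _ _ fun g => by
        rw [h1, RingHom.id_apply, smul_apply, h1, map_smul,
          LinearMap.smul_apply] }
  refine ⟨B1.extendOfNorm e, fun f g => ?_⟩
  rw [LinearMap.extendOfNorm_eq he ⟨c, fun f => ?_⟩ f]
  · exact h1 f g
  · exact LinearMap.opNorm_extendOfNorm_le he (by positivity) (hb f)

/-- The exterior derivative of a differentiable 1-form has the prescribed values on gradients of
test functions. -/
theorem OneForm.d_apply {Λ : OneForm D} (hΛ : Λ.IsDifferentiable) (μ : WSpace D) {f g : E D → ℝ}
    (hf : IsTest f) (hg : IsTest g) :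
    Λ.d μ (tangentProj μ (toL2 μ (∇ f))) (tangentProj μ (toL2 μ (∇ g))) =
      Λ.bar.dField μ (∇ f) (∇ g) := by
  have hex : ∃ B : tangentSpace μ →L[ℝ] tangentSpace μ →L[ℝ] ℝ,
      ∀ f g : E D → ℝ, IsTest f → IsTest g →
        B (tangentProj μ (toL2 μ (∇ f))) (tangentProj μ (toL2 μ (∇ g)))
          = Λ.bar.dField μ (∇ f) (∇ g) := by
    obtain ⟨c, hc⟩ := hΛ.2 μ
    obtain ⟨B, hB⟩ := exists_bilinear_extension (denseRange_gradMap μ)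
      (PseudoOneForm.dTest hΛ μ) (abs_nonneg c) (fun f g => by
        have e1 : ‖gradMap μ f‖ = ‖toL2 μ (∇ f.1)‖ := by rw [← coe_gradMap]; rfl
        have e2 : ‖gradMap μ g‖ = ‖toL2 μ (∇ g.1)‖ := by rw [← coe_gradMap]; rfl
        rw [e1, e2]
        refine (hc f.1 g.1 f.2 g.2).trans ?_
        gcongr
        exact le_abs_self c)
    exact ⟨B, fun f g hf hg => hB ⟨f, hf⟩ ⟨g, hg⟩⟩
  rw [OneForm.d, dif_pos hex]
  exact hex.choose_spec f g hf hg

/-! ### Mollification -/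

/-- A smooth bump function supported in the ball of radius `1 / (n + 1)`. -/
def mollBump (D n : ℕ) : ContDiffBump (0 : E D) where
  rIn := 1 / (2 * (n + 1))
  rOut := 1 / (n + 1)
  rIn_pos := by positivity
  rIn_lt_rOut := by
    apply one_div_lt_one_div_of_lt <;> linarith [(Nat.cast_nonneg n : (0 : ℝ) ≤ n)]

/-- The mollification `η_n * g`. -/
def moll {V : Type*} [NormedAddCommGroup V] [NormedSpace ℝ V] (n : ℕ) (g : E D → V) (x : E D) : V :=
  ∫ y, (mollBump D n).normed volume y • g (x - y)

section moll

variable {V : Type*} [NormedAddCommGroup V] [NormedSpace ℝ V]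

lemma moll_eq_convolution (n : ℕ) (g : E D → V) :
    moll n g = MeasureTheory.convolution ((mollBump D n).normed volume) g
      (ContinuousLinearMap.lsmul ℝ ℝ) volume := rfl

lemma integrable_moll (n : ℕ) {g : E D → V} (hg : Continuous g) (x : E D) :
    Integrable fun y => (mollBump D n).normed volume y • g (x - y) := by
  refine Continuous.integrable_of_hasCompactSupport ?_ ?_
  · exact ((mollBump D n).continuous_normed).smul (by fun_prop)
  · exact (mollBump D n).hasCompactSupport_normed.smul_right

lemma norm_moll_le (n : ℕ) {g : E D → V} {B : ℝ} (hB : ∀ x, ‖g x‖ ≤ B) (x : E D) :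
    ‖moll n g x‖ ≤ B := by
  have h : ∀ y, ‖(mollBump D n).normed volume y • g (x - y)‖ ≤
      (mollBump D n).normed volume y * B := fun y => by
    rw [norm_smul, Real.norm_of_nonneg ((mollBump D n).nonneg_normed y)]
    exact mul_le_mul_of_nonneg_left (hB _) ((mollBump D n).nonneg_normed y)
  refine (norm_integral_le_of_norm_le ((mollBump D n).integrable_normed.mul_const B)
    (Eventually.of_forall h)).trans ?_
  rw [integral_mul_const, (mollBump D n).integral_normed, one_mul]

lemma moll_add (n : ℕ) {g k : E D → V} (hg : Continuous g) (hk : Continuous k) :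
    moll n (g + k) = moll n g + moll n k := by
  funext x
  simp only [moll, Pi.add_apply, smul_add]
  exact integral_add (integrable_moll n hg x) (integrable_moll n hk x)

lemma moll_smul (n : ℕ) (c : ℝ) (g : E D → V) : moll n (c • g) = c • moll n g := by
  funext x
  simp only [moll, Pi.smul_apply, smul_comm _ c]
  exact integral_smul c _

/-- The value `moll n g x` is an average of `g` over the ball of radius `1 / (n + 1)` about `x`. -/
lemma norm_moll_sub_le (n : ℕ) [CompleteSpace V] {g : E D → V} (hg : Continuous g) {x : E D} {ε : ℝ}
    {c : V} (h : ∀ y, ‖y - x‖ < 1 / (n + 1) → ‖g y - c‖ ≤ ε) : ‖moll n g x - c‖ ≤ ε := by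
  rw [moll_eq_convolution, ← dist_eq_norm]
  refine dist_convolution_le ?_ (mollBump D n).support_normed_eq.le (mollBump D n).nonneg_normed
    (mollBump D n).integral_normed hg.aestronglyMeasurable (fun y hy => ?_)
  · have := h x (by simp; positivity)
    exact (norm_nonneg _).trans this
  · rw [dist_eq_norm]
    refine h y ?_
    rw [Metric.mem_ball, dist_eq_norm] at hy
    exact hy

lemma contDiff_moll [CompleteSpace V] (n : ℕ) {g : E D → V} (hg : Continuous g) :
    ContDiff ℝ ∞ (moll n g) := by
  rw [moll_eq_convolution]
  exact (mollBump D n).hasCompactSupport_normed.contDiff_convolution_left _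
    ((mollBump D n).contDiff_normed) hg.locallyIntegrable

lemma hasCompactSupport_moll (n : ℕ) {g : E D → V} (hg : HasCompactSupport g) :
    HasCompactSupport (moll n g) := by
  rw [moll_eq_convolution]
  exact (mollBump D n).hasCompactSupport_normed.convolution _ hg

lemma isTest_moll [CompleteSpace V] (n : ℕ) {g : E D → V} (hg : Continuous g)
    (hg' : HasCompactSupport g) : IsTest (moll n g) :=
  ⟨contDiff_moll n hg, hasCompactSupport_moll n hg'⟩

/-- Mollification commutes with differentiation. -/
lemma hasFDerivAt_moll [CompleteSpace V] (n : ℕ) {g : E D → V} {g' : E D → E D →L[ℝ] V}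
    (hg : HasCompactSupport g) (hd : ∀ x, HasFDerivAt g (g' x) x) (hg' : Continuous g') (x : E D) :
    HasFDerivAt (moll n g) (moll n g' x) x := by
  have e : fderiv ℝ g = g' := funext fun x => (hd x).fderiv
  have h1 : ContDiff ℝ 1 g := by
    rw [contDiff_one_iff_fderiv, e]
    exact ⟨fun x => (hd x).differentiableAt, hg'⟩
  have hloc : LocallyIntegrable ((mollBump D n).normed volume) (volume : Measure (E D)) :=
    ((mollBump D n).continuous_normed (μ := volume)).locallyIntegrable
  have h := hg.hasFDerivAt_convolution_right (ContinuousLinearMap.lsmul ℝ ℝ) hloc h1 x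
  rw [← moll_eq_convolution, e] at h
  exact h

end moll

/-! ### The continuity equation tested against functions of space -/

/-- A bounded field on `[0, ℓ] × ℝ^D`, Lipschitz in time and space, with spatial derivative `W'`
bounded and Lipschitz in space. -/
structure IsFlowField (ℓ : ℝ) (W : ℝ → E D → E D) (W' : ℝ → E D → E D →L[ℝ] E D) (C : ℝ) :
    Prop where
  hasFDerivAt : ∀ τ ∈ Icc 0 ℓ, ∀ x, HasFDerivAt (W τ) (W' τ x) x
  norm_le : ∀ τ ∈ Icc 0 ℓ, ∀ x, ‖W τ x‖ ≤ C
  norm_fderiv_le : ∀ τ ∈ Icc 0 ℓ, ∀ x, ‖W' τ x‖ ≤ C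
  fderiv_lipschitz : ∀ τ ∈ Icc 0 ℓ, ∀ x y, ‖W' τ x - W' τ y‖ ≤ C * ‖x - y‖
  lipschitz : ∀ τ ∈ Icc 0 ℓ, ∀ τ' ∈ Icc 0 ℓ, ∀ x y,
    ‖W τ x - W τ' y‖ ≤ C * (|τ - τ'| + ‖x - y‖)

/-- The measures `σ τ`, `τ ∈ [0, ℓ]`, have continuous densities that are Lipschitz in time. -/
structure HasLipschitzDensity (ℓ : ℝ) (σ : ℝ → WSpace D) (r : ℝ → E D → ℝ) (C : ℝ) : Prop where
  nonneg : ∀ τ ∈ Icc 0 ℓ, ∀ x, 0 ≤ r τ x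
  continuous : ∀ τ ∈ Icc 0 ℓ, Continuous (r τ)
  lipschitz : ∀ τ ∈ Icc 0 ℓ, ∀ τ' ∈ Icc 0 ℓ, ∀ x, |r τ x - r τ' x| ≤ C * |τ - τ'|
  measure_eq : ∀ τ ∈ Icc 0 ℓ,
    (σ τ).toMeasure = volume.withDensity fun x => ENNReal.ofReal (r τ x)

/-- `φ` is compactly supported with Lipschitz derivative `φ'`; `N` bounds `φ'` and its Lipschitz
constant, and the support lies in the ball of radius `R`. -/
structure IsC11Test (φ : E D → ℝ) (φ' : E D → E D →L[ℝ] ℝ) (N R : ℝ) : Prop where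
  hasFDerivAt : ∀ x, HasFDerivAt φ (φ' x) x
  norm_le : ∀ x, ‖φ' x‖ ≤ N
  lipschitz : ∀ x y, ‖φ' x - φ' y‖ ≤ N * ‖x - y‖
  eq_zero : ∀ x, R < ‖x‖ → φ x = 0

lemma continuous_of_norm_sub_le {V W : Type*} [NormedAddCommGroup V]
    [NormedAddCommGroup W] {g : V → W} {L : ℝ} (h : ∀ x y, ‖g x - g y‖ ≤ L * ‖x - y‖) :
    Continuous g := by
  refine (LipschitzWith.of_dist_le_mul (K := L.toNNReal) (fun x y => ?_)).continuous
  rw [dist_eq_norm, dist_eq_norm]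
  exact (h x y).trans (by gcongr; exact Real.le_coe_toNNReal L)

namespace IsC11Test

variable {φ : E D → ℝ} {φ' : E D → E D →L[ℝ] ℝ} {N R : ℝ}

lemma nonneg (h : IsC11Test φ φ' N R) : 0 ≤ N := (norm_nonneg _).trans (h.norm_le 0)

lemma continuous (h : IsC11Test φ φ' N R) : Continuous φ :=
  continuous_iff_continuousAt.2 fun x => (h.hasFDerivAt x).continuousAt

lemma continuous_deriv (h : IsC11Test φ φ' N R) : Continuous φ' :=
  continuous_of_norm_sub_le h.lipschitz

lemma deriv_eq_zero (h : IsC11Test φ φ' N R) {x : E D} (hx : R < ‖x‖) : φ' x = 0 := by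
  have h1 : φ =ᶠ[𝓝 x] fun _ => 0 := by
    filter_upwards [(isOpen_lt continuous_const continuous_norm).mem_nhds hx] with y hy
    exact h.eq_zero y hy
  exact ((h.hasFDerivAt x).congr_of_eventuallyEq h1.symm).unique (hasFDerivAt_const 0 x)

lemma hasCompactSupport (h : IsC11Test φ φ' N R) : HasCompactSupport φ := by
  refine HasCompactSupport.intro (isCompact_closedBall (0 : E D) R) fun x hx => h.eq_zero x ?_
  simpa using hx

lemma abs_sub_le (h : IsC11Test φ φ' N R) (x y : E D) : ‖φ x - φ y‖ ≤ N * ‖x - y‖ :=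
  convex_univ.norm_image_sub_le_of_norm_hasFDerivWithin_le
    (fun z _ => (h.hasFDerivAt z).hasFDerivWithinAt) (fun z _ => h.norm_le z) (mem_univ y)
    (mem_univ x)

lemma taylor (h : IsC11Test φ φ' N R) (x y : E D) : ‖φ y - φ x - φ' x (y - x)‖ ≤
    N * ‖y - x‖ ^ 2 :=
  norm_sub_sub_le_of_lipschitz_fderiv convex_univ (fun z _ => (h.hasFDerivAt z).hasFDerivWithinAt)
    (fun z _ z' _ => h.lipschitz z z') h.nonneg (mem_univ x) (mem_univ y)

lemma integrable (h : IsC11Test φ φ' N R) (μ : WSpace D) : Integrable φ μ.toMeasure :=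
  h.continuous.integrable_of_hasCompactSupport h.hasCompactSupport

end IsC11Test

namespace HasLipschitzDensity

variable {ℓ C : ℝ} {σ : ℝ → WSpace D} {r : ℝ → E D → ℝ}

lemma integral_eq (hσ : HasLipschitzDensity ℓ σ r C) {τ : ℝ} (hτ : τ ∈ Icc 0 ℓ) (g : E D → ℝ) :
    ∫ x, g x ∂(σ τ).toMeasure = ∫ x, r τ x * g x := by
  rw [hσ.measure_eq τ hτ, integral_withDensity_eq_integral_toReal_smul]
  · refine integral_congr_ae (Eventually.of_forall fun x => ?_)
    simp only [smul_eq_mul]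
    rw [ENNReal.toReal_ofReal (hσ.nonneg τ hτ x)]
  · exact (hσ.continuous τ hτ).measurable.ennreal_ofReal
  · simp

/-- For compactly supported integrands, integrals with respect to `σ_τ` are Lipschitz in `τ`. -/
lemma abs_integral_sub_le (hσ : HasLipschitzDensity ℓ σ r C) (hC : 0 ≤ C) {τ τ' : ℝ}
    (hτ : τ ∈ Icc 0 ℓ) (hτ' : τ' ∈ Icc 0 ℓ) {g : E D → ℝ} (hg : Continuous g) {R B : ℝ}
    (hB : ∀ x, |g x| ≤ B) (hR : ∀ x, R < ‖x‖ → g x = 0) :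
    |∫ x, g x ∂(σ τ).toMeasure - ∫ x, g x ∂(σ τ').toMeasure| ≤
      volume.real (Metric.closedBall (0 : E D) R) * (C * B) * |τ - τ'| := by
  have hcs : HasCompactSupport g := by
    refine HasCompactSupport.intro (isCompact_closedBall (0 : E D) R) fun x hx => hR x ?_
    simpa using hx
  have hi : ∀ τ ∈ Icc 0 ℓ, Integrable fun x => r τ x * g x := fun τ hτ =>
    ((hσ.continuous τ hτ).mul hg).integrable_of_hasCompactSupport hcs.mul_left
  rw [hσ.integral_eq hτ, hσ.integral_eq hτ', ← integral_sub (hi τ hτ) (hi τ' hτ'),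
    ← setIntegral_eq_integral_of_forall_compl_eq_zero (s := Metric.closedBall (0 : E D) R)]
  · rw [← Real.norm_eq_abs]
    refine (norm_setIntegral_le_of_norm_le_const (C := C * B * |τ - τ'|)
      measure_closedBall_lt_top fun x _ => ?_).trans (le_of_eq (by ring))
    rw [← sub_mul, norm_mul]
    calc _ ≤ C * |τ - τ'| * B := by
          gcongr
          · exact hσ.lipschitz τ hτ τ' hτ' x
          · exact hB x
      _ = _ := by ring
  · intro x hx
    rw [hR x (by simpa using hx)]
    simp

end HasLipschitzDensity

namespace IsFlowField

variable {ℓ C : ℝ} {W : ℝ → E D → E D} {W' : ℝ → E D → E D →L[ℝ] E D}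

lemma continuous (hW : IsFlowField ℓ W W' C) {τ : ℝ} (hτ : τ ∈ Icc 0 ℓ) : Continuous (W τ) :=
  continuous_iff_continuousAt.2 fun x => (hW.hasFDerivAt τ hτ x).continuousAt

/-- The flux `τ ↦ ∫ ⟨∇φ, W_τ⟩ dσ_τ` is Lipschitz. -/
lemma abs_flux_sub_le (hW : IsFlowField ℓ W W' C) (hC : 0 ≤ C) {σ : ℝ → WSpace D}
    {r : ℝ → E D → ℝ} (hσ : HasLipschitzDensity ℓ σ r C) {φ : E D → ℝ} {φ' : E D → E D →L[ℝ] ℝ}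
    {N R : ℝ} (hφ : IsC11Test φ φ' N R) {τ τ' : ℝ} (hτ : τ ∈ Icc 0 ℓ) (hτ' : τ' ∈ Icc 0 ℓ) :
    |∫ x, φ' x (W τ x) ∂(σ τ).toMeasure - ∫ x, φ' x (W τ' x) ∂(σ τ').toMeasure| ≤
      (C + volume.real (Metric.closedBall (0 : E D) R) * C ^ 2) * N * |τ - τ'| := by
  have hN := hφ.nonneg
  have hcont : ∀ τ ∈ Icc 0 ℓ, Continuous fun x => φ' x (W τ x) := fun τ hτ =>
    hφ.continuous_deriv.clm_apply (hW.continuous hτ)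
  have hbd : ∀ τ ∈ Icc 0 ℓ, ∀ x, ‖φ' x (W τ x)‖ ≤ N * C := fun τ hτ x =>
    (φ' x).le_of_opNorm_le_of_le (hφ.norm_le x) (hW.norm_le τ hτ x)
  have hi : ∀ τ ∈ Icc 0 ℓ, ∀ μ : WSpace D, Integrable (fun x => φ' x (W τ x)) μ.toMeasure :=
    fun τ hτ μ => Integrable.of_bound (hcont τ hτ).aestronglyMeasurable (N * C)
      (Eventually.of_forall (hbd τ hτ))
  have h1 : |∫ x, φ' x (W τ x) ∂(σ τ).toMeasure - ∫ x, φ' x (W τ' x) ∂(σ τ).toMeasure| ≤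
      N * (C * |τ - τ'|) := by
    rw [← integral_sub (hi τ hτ _) (hi τ' hτ' _), ← Real.norm_eq_abs]
    refine (norm_integral_le_of_norm_le_const (C := N * (C * |τ - τ'|))
      (Eventually.of_forall fun x => ?_)).trans (by simp)
    rw [← map_sub]
    refine (φ' x).le_of_opNorm_le_of_le (hφ.norm_le x) ?_
    simpa using hW.lipschitz τ hτ τ' hτ' x x
  have h2 := hσ.abs_integral_sub_le hC hτ hτ' (hcont τ' hτ') (hbd τ' hτ')
    (R := R) (fun x hx => by rw [hφ.deriv_eq_zero hx]; simp)
  calc _ ≤ _ := abs_sub_le _ (∫ x, φ' x (W τ' x) ∂(σ τ).toMeasure) _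
    _ ≤ _ := add_le_add h1 h2
    _ = _ := by ring

end IsFlowField

lemma IsTest.isC11Test {ψ : E D → ℝ} (hψ : IsTest ψ) : ∃ N R, IsC11Test ψ (fderiv ℝ ψ) N R := by
  have h1 : ContDiff ℝ ∞ (fderiv ℝ ψ) := hψ.1.fderiv_right (by simp)
  have h2 : HasCompactSupport (fderiv ℝ ψ) := hψ.2.fderiv (𝕜 := ℝ)
  obtain ⟨M, hM⟩ := h2.exists_bound_of_continuous h1.continuous
  obtain ⟨K, hK⟩ := h1.lipschitzWith_of_hasCompactSupport h2 (by simp)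
  obtain ⟨R, hR⟩ := hψ.2.isCompact.isBounded.subset_closedBall (0 : E D)
  refine ⟨max M K, R, fun x => (hψ.differentiable x).hasFDerivAt,
    fun x => (hM x).trans (le_max_left _ _), fun x y => ?_, fun x hx => ?_⟩
  · have := hK.dist_le_mul x y
    rw [dist_eq_norm, dist_eq_norm] at this
    exact this.trans (by gcongr; exact le_max_right _ _)
  · by_contra hne
    have := hR (subset_tsupport ψ hne)
    simp at this
    linarith

/-- The continuity equation, integrated in time against a smooth function of space. Testing with
products `θ(t) ψ(x)` identifies the derivative of the Lipschitz function `τ ↦ ∫ ψ dσ_τ` almost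
everywhere in `(0, ℓ)`; since that function is continuous up to the end points of the interval, so
is the integrated formula. -/
lemma IsVelocity.integral_sub_eq_of_isTest {ℓ C : ℝ} {W : ℝ → E D → E D}
    {W' : ℝ → E D → E D →L[ℝ] E D} (hℓ : 0 ≤ ℓ) (hW : IsFlowField ℓ W W' C) (hC : 0 ≤ C)
    {σ : ℝ → WSpace D} {r : ℝ → E D → ℝ} (hσ : HasLipschitzDensity ℓ σ r C)
    (hvel : IsVelocity 0 ℓ σ W) {ψ : E D → ℝ} (hψ : IsTest ψ) {a b : ℝ} (ha : a ∈ Icc 0 ℓ)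
    (hb : b ∈ Icc 0 ℓ) :
    ∫ x, ψ x ∂(σ b).toMeasure - ∫ x, ψ x ∂(σ a).toMeasure =
      ∫ τ in a..b, ∫ x, fderiv ℝ ψ x (W τ x) ∂(σ τ).toMeasure := by
  obtain ⟨N, R, hψ'⟩ := hψ.isC11Test
  obtain ⟨B, hB⟩ := hψ.bounded
  set m : ℝ → ℝ := fun τ => ∫ x, ψ x ∂(σ τ).toMeasure with hm
  set c : ℝ → ℝ := fun τ => ∫ x, fderiv ℝ ψ x (W τ x) ∂(σ τ).toMeasure with hc
  have hucc : uIcc 0 ℓ = Icc 0 ℓ := uIcc_of_le hℓ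
  have hmlip : ∃ K : ℝ≥0, LipschitzOnWith K m (uIcc 0 ℓ) := by
    refine ⟨Real.toNNReal (volume.real (Metric.closedBall (0 : E D) R) * (C * B)),
      LipschitzOnWith.of_dist_le_mul fun τ hτ τ' hτ' => ?_⟩
    rw [hucc] at hτ hτ'
    rw [Real.dist_eq, Real.dist_eq]
    refine (hσ.abs_integral_sub_le hC hτ hτ' hψ.1.continuous hB hψ'.eq_zero).trans ?_
    gcongr
    exact Real.le_coe_toNNReal _
  obtain ⟨K, hK⟩ := hmlip
  -- hence `m` is differentiable almost everywhere and satisfies the fundamental theorem of calculus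
  have hAC := hK.absolutelyContinuousOnInterval
  have hcont : ContinuousOn c (Icc 0 ℓ) := by
    have : LipschitzOnWith (Real.toNNReal
        ((C + volume.real (Metric.closedBall (0 : E D) R) * C ^ 2) * N)) c (Icc 0 ℓ) :=
      LipschitzOnWith.of_dist_le_mul fun τ hτ τ' hτ' => by
        rw [Real.dist_eq, Real.dist_eq]
        refine (hW.abs_flux_sub_le hC hσ hψ' hτ hτ').trans ?_
        gcongr
        exact Real.le_coe_toNNReal _
    exact this.continuousOn
  have hcint : IntervalIntegrable c volume 0 ℓ := by
    apply ContinuousOn.intervalIntegrable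
    rwa [hucc]
  have hmint := hAC.intervalIntegrable_deriv
  -- the distributional derivative of `m` is `c`
  have hweak : ∀ᵐ τ, τ ∈ Ioo 0 ℓ → deriv m τ - c τ = 0 := by
    refine IsOpen.ae_eq_zero_of_integral_contDiff_smul_eq_zero isOpen_Ioo ?_ ?_
    · have : IntegrableOn (fun τ => deriv m τ - c τ) (Ioo 0 ℓ) := by
        have h := hmint.sub hcint
        rw [intervalIntegrable_iff_integrableOn_Ioo_of_le hℓ] at h
        exact h
      exact this.locallyIntegrableOn
    · intro θ hθ hθc hθs
      have hθt : IsTest θ := ⟨hθ, hθc⟩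
      let φ : ℝ × E D → ℝ := fun p => θ p.1 * ψ p.2
      have hφt : IsTest φ := by
        refine ⟨(hθ.comp contDiff_fst).mul (hψ.1.comp contDiff_snd), ?_⟩
        refine HasCompactSupport.intro (hθc.isCompact.prod hψ.2.isCompact) fun p hp => ?_
        rw [mem_prod, not_and_or] at hp
        rcases hp with hp | hp
        · simp only [φ, image_eq_zero_of_notMem_tsupport hp, zero_mul]
        · simp only [φ, image_eq_zero_of_notMem_tsupport hp, mul_zero]
      have hφs : tsupport φ ⊆ Ioo 0 ℓ ×ˢ univ := by
        have h1 : tsupport φ ⊆ tsupport (fun p : ℝ × E D => θ p.1) :=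
          closure_mono fun p hp => by
            simp only [φ, Function.mem_support] at hp ⊢
            exact left_ne_zero_of_mul hp
        have h2 : tsupport (fun p : ℝ × E D => θ p.1) ⊆ Prod.fst ⁻¹' tsupport θ :=
          tsupport_comp_subset_preimage θ continuous_fst
        intro p hp
        exact ⟨hθs (h2 (h1 hp)), mem_univ _⟩
      have hder : ∀ t x, ∀ y : E D, fderiv ℝ φ (t, x) (1, 0) + fderiv ℝ φ (t, x) (0, y) =
          deriv θ t * ψ x + θ t * fderiv ℝ ψ x y := by
        intro t x y
        have h1 : HasFDerivAt (fun p : ℝ × E D => θ p.1)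
            ((fderiv ℝ θ t).comp (ContinuousLinearMap.fst ℝ ℝ (E D))) (t, x) :=
          ((hθt.differentiable t).hasFDerivAt).comp (t, x)
            (ContinuousLinearMap.fst ℝ ℝ (E D)).hasFDerivAt
        have h2 : HasFDerivAt (fun p : ℝ × E D => ψ p.2)
            ((fderiv ℝ ψ x).comp (ContinuousLinearMap.snd ℝ ℝ (E D))) (t, x) :=
          ((hψ.differentiable x).hasFDerivAt).comp (t, x)
            (ContinuousLinearMap.snd ℝ ℝ (E D)).hasFDerivAt
        have h3 : fderiv ℝ φ (t, x) = _ := (h1.mul h2).fderiv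
        rw [h3]
        simp
        ring
      have heq := hvel.continuityEq φ hφt hφs
      have hinner : ∀ t ∈ Ioo 0 ℓ, ∫ x, (fderiv ℝ φ (t, x) (1, 0) + fderiv ℝ φ (t, x) (0, W t x))
          ∂(σ t).toMeasure = deriv θ t * m t + θ t * c t := by
        intro t ht
        have ht' := Ioo_subset_Icc_self ht
        simp only [hder]
        have hi : Integrable (fun x => fderiv ℝ ψ x (W t x)) (σ t).toMeasure :=
          Integrable.of_bound
            (hψ'.continuous_deriv.clm_apply (hW.continuous ht')).aestronglyMeasurable (N * C)
            (Eventually.of_forall fun x =>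
              (fderiv ℝ ψ x).le_of_opNorm_le_of_le (hψ'.norm_le x) (hW.norm_le t ht' x))
        rw [integral_add ((hψ'.integrable _).const_mul _) (hi.const_mul _), integral_const_mul,
          integral_const_mul]
      rw [setIntegral_congr_fun measurableSet_Ioo hinner] at heq
      have hθAC : AbsolutelyContinuousOnInterval θ 0 ℓ := by
        obtain ⟨K', hK'⟩ := hθ.lipschitzWith_of_hasCompactSupport hθc (by simp)
        exact (hK'.lipschitzOnWith (s := uIcc 0 ℓ)).absolutelyContinuousOnInterval
      have hibp := hθAC.integral_mul_deriv_eq_deriv_mul hAC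
      have h0 : θ 0 = 0 := image_eq_zero_of_notMem_tsupport fun h => (hθs h).1.false
      have h1 : θ ℓ = 0 := image_eq_zero_of_notMem_tsupport fun h => (hθs h).2.false
      rw [h0, h1, zero_mul, zero_mul, sub_zero, zero_sub] at hibp
      have i1 : IntervalIntegrable (fun τ => deriv θ τ * m τ) volume 0 ℓ :=
        hθAC.intervalIntegrable_deriv.mul_continuousOn hAC.continuousOn
      have i2 : IntervalIntegrable (fun τ => θ τ * c τ) volume 0 ℓ :=
        hcint.continuousOn_mul hθ.continuous.continuousOn
      have i3 : IntervalIntegrable (fun τ => θ τ * deriv m τ) volume 0 ℓ :=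
        hmint.continuousOn_mul hθ.continuous.continuousOn
      rw [← integral_Ioc_eq_integral_Ioo, ← intervalIntegral.integral_of_le hℓ,
        intervalIntegral.integral_add i1 i2] at heq
      have hset : ∫ τ, θ τ • (deriv m τ - c τ) = ∫ τ in Ioo 0 ℓ, θ τ • (deriv m τ - c τ) := by
        refine (setIntegral_eq_integral_of_forall_compl_eq_zero fun τ hτ => ?_).symm
        rw [image_eq_zero_of_notMem_tsupport fun h => hτ (hθs h), zero_smul]
      rw [hset, ← integral_Ioc_eq_integral_Ioo, ← intervalIntegral.integral_of_le hℓ]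
      simp only [smul_eq_mul, mul_sub]
      rw [intervalIntegral.integral_sub i3 i2]
      linarith
  have hsub : uIcc a b ⊆ uIcc 0 ℓ := by
    rw [hucc]; exact (convex_Icc 0 ℓ).ordConnected.uIcc_subset ha hb
  have hFTC := (hAC.mono hsub).integral_deriv_eq_sub
  rw [← hFTC]
  refine intervalIntegral.integral_congr_ae ?_
  have hne : ∀ᵐ τ : ℝ, τ ≠ 0 ∧ τ ≠ ℓ := by
    have h1 : ∀ᵐ τ : ℝ, τ ≠ 0 := by simp [ae_iff]
    have h2 : ∀ᵐ τ : ℝ, τ ≠ ℓ := by simp [ae_iff]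
    exact h1.and h2
  filter_upwards [hweak, hne] with τ h1 h2 h3
  have h4 := hsub (uIoc_subset_uIcc h3)
  rw [hucc] at h4
  have := h1 ⟨lt_of_le_of_ne h4.1 h2.1.symm, lt_of_le_of_ne h4.2 h2.2⟩
  linarith

lemma integrable_of_forall_norm_le {μ : WSpace D} {V : Type*} [NormedAddCommGroup V] {g : E D → V}
    (hg : AEStronglyMeasurable g μ.toMeasure) {B : ℝ} (hB : ∀ x, ‖g x‖ ≤ B) :
    Integrable g μ.toMeasure := Integrable.of_bound hg B (Eventually.of_forall hB)

lemma abs_integral_sub_le_of_forall {μ : WSpace D} {g k : E D → ℝ} (hg : Integrable g μ.toMeasure)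
    (hk : Integrable k μ.toMeasure) {B : ℝ} (hB : ∀ x, |g x - k x| ≤ B) :
    |∫ x, g x ∂μ.toMeasure - ∫ x, k x ∂μ.toMeasure| ≤ B := by
  rw [← integral_sub hg hk, ← Real.norm_eq_abs]
  exact (norm_integral_le_of_norm_le_const (Eventually.of_forall hB)).trans (by simp)

lemma tendsto_const_div_natCast_add_one (K : ℝ) :
    Tendsto (fun n : ℕ => K / ((n : ℝ) + 1)) atTop (𝓝 0) := by
  simpa [div_eq_mul_inv] using (tendsto_one_div_add_atTop_nhds_zero_nat (𝕜 := ℝ)).const_mul K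

lemma eq_zero_of_forall_abs_le_div {a K : ℝ} (h : ∀ n : ℕ, |a| ≤ K / (n + 1)) : a = 0 := by
  have h1 : Tendsto (fun n : ℕ => K / ((n : ℝ) + 1)) atTop (𝓝 0) :=
    tendsto_const_div_natCast_add_one K
  exact abs_eq_zero.1 (le_antisymm (ge_of_tendsto' h1 h) (abs_nonneg a))

/-- The continuity equation, integrated in time against a function of class `C^{1,1}`. -/
lemma IsVelocity.integral_sub_eq {ℓ C : ℝ} {W : ℝ → E D → E D}
    {W' : ℝ → E D → E D →L[ℝ] E D} (hℓ : 0 ≤ ℓ) (hW : IsFlowField ℓ W W' C) (hC : 0 ≤ C)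
    {σ : ℝ → WSpace D} {r : ℝ → E D → ℝ} (hσ : HasLipschitzDensity ℓ σ r C)
    (hvel : IsVelocity 0 ℓ σ W) {φ : E D → ℝ} {φ' : E D → E D →L[ℝ] ℝ} {N R : ℝ}
    (hφ : IsC11Test φ φ' N R) {a b : ℝ} (ha : a ∈ Icc 0 ℓ) (hb : b ∈ Icc 0 ℓ) :
    ∫ x, φ x ∂(σ b).toMeasure - ∫ x, φ x ∂(σ a).toMeasure =
      ∫ τ in a..b, ∫ x, φ' x (W τ x) ∂(σ τ).toMeasure := by
  have hN := hφ.nonneg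
  have hcontc : ∀ {φ : E D → ℝ} {φ' : E D → E D →L[ℝ] ℝ} {N R : ℝ} (_ : IsC11Test φ φ' N R),
      IntervalIntegrable (fun τ => ∫ x, φ' x (W τ x) ∂(σ τ).toMeasure) volume a b := by
    intro φ φ' N R hφ
    have : LipschitzOnWith (Real.toNNReal
        ((C + volume.real (Metric.closedBall (0 : E D) R) * C ^ 2) * N))
        (fun τ => ∫ x, φ' x (W τ x) ∂(σ τ).toMeasure) (Icc 0 ℓ) :=
      LipschitzOnWith.of_dist_le_mul fun τ hτ τ' hτ' => by
        rw [Real.dist_eq, Real.dist_eq]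
        refine (hW.abs_flux_sub_le hC hσ hφ hτ hτ').trans ?_
        gcongr
        exact Real.le_coe_toNNReal _
    exact (this.continuousOn.mono
      ((convex_Icc 0 ℓ).ordConnected.uIcc_subset ha hb)).intervalIntegrable
  rw [← sub_eq_zero]
  refine eq_zero_of_forall_abs_le_div (K := 2 * N + N * C * |b - a|) fun n => ?_
  have hψ : IsTest (moll n φ) := isTest_moll n hφ.continuous hφ.hasCompactSupport
  have hd : ∀ x, fderiv ℝ (moll n φ) x = moll n φ' x := fun x =>
    (hasFDerivAt_moll n hφ.hasCompactSupport hφ.hasFDerivAt hφ.continuous_deriv x).fderiv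
  have hε : ∀ x y : E D, ‖y - x‖ < 1 / ((n : ℝ) + 1) → N * ‖y - x‖ ≤ N / (n + 1) := by
    intro x y hxy
    rw [div_eq_mul_one_div]; gcongr
  have h0 : ∀ x, |moll n φ x - φ x| ≤ N / (n + 1) := fun x =>
    norm_moll_sub_le n hφ.continuous fun y hy => (hφ.abs_sub_le y x).trans (hε x y hy)
  have h1 : ∀ x, ‖moll n φ' x - φ' x‖ ≤ N / (n + 1) := fun x =>
    norm_moll_sub_le n hφ.continuous_deriv fun y hy => (hφ.lipschitz y x).trans (hε x y hy)
  obtain ⟨N', R', hψ'⟩ := hψ.isC11Test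
  have key := hvel.integral_sub_eq_of_isTest hℓ hW hC hσ hψ ha hb
  have e1 := fun τ => abs_integral_sub_le_of_forall (hψ'.integrable (σ τ)) (hφ.integrable (σ τ)) h0
  have e2 : |(∫ τ in a..b, ∫ x, fderiv ℝ (moll n φ) x (W τ x) ∂(σ τ).toMeasure) -
      ∫ τ in a..b, ∫ x, φ' x (W τ x) ∂(σ τ).toMeasure| ≤ N / (n + 1) * C * |b - a| := by
    rw [← intervalIntegral.integral_sub (hcontc hψ') (hcontc hφ), ← Real.norm_eq_abs]
    refine intervalIntegral.norm_integral_le_of_norm_le_const fun τ hτ => ?_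
    have hτ' : τ ∈ Icc 0 ℓ :=
      (convex_Icc 0 ℓ).ordConnected.uIcc_subset ha hb (uIoc_subset_uIcc hτ)
    have hi : ∀ {φ : E D → ℝ} {φ' : E D → E D →L[ℝ] ℝ} {N R : ℝ} (_ : IsC11Test φ φ' N R),
        Integrable (fun x => φ' x (W τ x)) (σ τ).toMeasure := fun h =>
      integrable_of_forall_norm_le
        (h.continuous_deriv.clm_apply (hW.continuous hτ')).aestronglyMeasurable
        fun x => ContinuousLinearMap.le_of_opNorm_le_of_le _ (h.norm_le x) (hW.norm_le τ hτ' x)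
    refine abs_integral_sub_le_of_forall (hi hψ') (hi hφ) fun x => ?_
    rw [hd, ← sub_apply, ← Real.norm_eq_abs]
    exact ContinuousLinearMap.le_of_opNorm_le_of_le _ (h1 x) (hW.norm_le τ hτ' x)
  have e3 : 2 * N / ((n : ℝ) + 1) = N / (n + 1) + N / (n + 1) := by ring
  have ea := e1 a
  have eb := e1 b
  rw [abs_le] at ea eb e2 ⊢
  have e4 : (2 * N + N * C * |b - a|) / ((n : ℝ) + 1) =
      N / (n + 1) + N / (n + 1) + N / (n + 1) * C * |b - a| := by ring
  rw [e4]
  constructor <;> linarith [ea.1, ea.2, eb.1, eb.2, e2.1, e2.2]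

/-! ### Euler polygons and the flow -/

/-- The Euler polygon with step `h` started at time `s`: the map that sends the initial point to the
point reached after `k` steps. -/
def eulerMap (W : ℝ → E D → E D) (s h : ℝ) : ℕ → E D → E D
  | 0, x => x
  | k + 1, x => eulerMap W s h k x + h • W (s + k * h) (eulerMap W s h k x)

namespace IsFlowField

variable {ℓ C : ℝ} {W : ℝ → E D → E D} {W' : ℝ → E D → E D →L[ℝ] E D}

/-- One Euler step transports `σ_τ` to `σ_{τ+h}` up to an error of second order. -/
lemma abs_integral_step_le (hℓ : 0 ≤ ℓ) (hW : IsFlowField ℓ W W' C) (hC : 0 ≤ C)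
    {σ : ℝ → WSpace D} {r : ℝ → E D → ℝ} (hσ : HasLipschitzDensity ℓ σ r C)
    (hvel : IsVelocity 0 ℓ σ W) {φ : E D → ℝ} {φ' : E D → E D →L[ℝ] ℝ} {N R : ℝ}
    (hφ : IsC11Test φ φ' N R) {τ h : ℝ} (hτ : τ ∈ Icc 0 ℓ) (hτh : τ + h ∈ Icc 0 ℓ) :
    |∫ x, φ x ∂(σ (τ + h)).toMeasure - ∫ x, φ (x + h • W τ x) ∂(σ τ).toMeasure| ≤
      (C + volume.real (Metric.closedBall (0 : E D) R) * C ^ 2 + C ^ 2) * N * h ^ 2 := by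
  have hN := hφ.nonneg
  set K : ℝ := C + volume.real (Metric.closedBall (0 : E D) R) * C ^ 2 with hK
  have hK0 : 0 ≤ K := by positivity
  set c : ℝ → ℝ := fun τ => ∫ x, φ' x (W τ x) ∂(σ τ).toMeasure with hc
  have h1 := hvel.integral_sub_eq hℓ hW hC hσ hφ hτ hτh
  have hlip : ∀ a ∈ Icc 0 ℓ, ∀ b ∈ Icc 0 ℓ, |c a - c b| ≤ K * N * |a - b| := fun a ha b hb =>
    hW.abs_flux_sub_le hC hσ hφ ha hb
  have hsub : uIcc τ (τ + h) ⊆ Icc 0 ℓ := (convex_Icc 0 ℓ).ordConnected.uIcc_subset hτ hτh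
  have hcint : IntervalIntegrable c volume τ (τ + h) := by
    have : LipschitzOnWith (Real.toNNReal (K * N)) c (Icc 0 ℓ) :=
      LipschitzOnWith.of_dist_le_mul fun τ hτ τ' hτ' => by
        rw [Real.dist_eq, Real.dist_eq]
        refine (hlip τ hτ τ' hτ').trans ?_
        gcongr
        exact Real.le_coe_toNNReal _
    exact (this.continuousOn.mono hsub).intervalIntegrable
  have h2 : |(∫ x in τ..(τ + h), c x) - h * c τ| ≤ K * N * h ^ 2 := by
    have e : (∫ x in τ..(τ + h), c x) - h * c τ = ∫ x in τ..(τ + h), (c x - c τ) := by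
      rw [intervalIntegral.integral_sub hcint (intervalIntegrable_const)]
      simp
    rw [e, ← Real.norm_eq_abs]
    refine (intervalIntegral.norm_integral_le_of_norm_le_const (C := K * N * |h|)
      fun x hx => ?_).trans (le_of_eq ?_)
    · have hx' := uIoc_subset_uIcc hx
      have h3 : |x - τ| ≤ |h| := by simpa using abs_sub_left_of_mem_uIcc hx'
      exact (hlip x (hsub hx') τ hτ).trans (mul_le_mul_of_nonneg_left h3 (by positivity))
    · rw [add_sub_cancel_left, mul_assoc, abs_mul_abs_self, sq]
  have hWc := hW.continuous hτ
  have hφc := hφ.continuous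
  have hi1 : Integrable (fun x => φ' x (W τ x)) (σ τ).toMeasure :=
    integrable_of_forall_norm_le (hφ.continuous_deriv.clm_apply hWc).aestronglyMeasurable
      fun x => ContinuousLinearMap.le_of_opNorm_le_of_le _ (hφ.norm_le x) (hW.norm_le τ hτ x)
  obtain ⟨B, hB⟩ := hφ.hasCompactSupport.exists_bound_of_continuous hφc
  have hi2 : Integrable (fun x => φ (x + h • W τ x)) (σ τ).toMeasure :=
    integrable_of_forall_norm_le (by fun_prop) fun x => hB _
  have h3 : |∫ x, φ (x + h • W τ x) ∂(σ τ).toMeasure -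
      (∫ x, φ x ∂(σ τ).toMeasure + h * c τ)| ≤ C ^ 2 * N * h ^ 2 := by
    rw [hc]
    simp only
    rw [← integral_const_mul, ← integral_add (hφ.integrable _) (hi1.const_mul h)]
    refine abs_integral_sub_le_of_forall hi2 ((hφ.integrable _).add (hi1.const_mul h)) fun x => ?_
    have t := hφ.taylor x (x + h • W τ x)
    rw [add_sub_cancel_left, map_smul, smul_eq_mul, norm_smul] at t
    change |φ (x + h • W τ x) - (φ x + h * φ' x (W τ x))| ≤ _
    rw [← sub_sub]
    refine t.trans ?_
    rw [mul_pow, Real.norm_eq_abs, sq_abs]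
    have := pow_le_pow_left₀ (norm_nonneg _) (hW.norm_le τ hτ x) 2
    calc N * (h ^ 2 * ‖W τ x‖ ^ 2) ≤ N * (h ^ 2 * C ^ 2) := by gcongr
      _ = _ := by ring
  have e : (K + C ^ 2) * N * h ^ 2 = K * N * h ^ 2 + C ^ 2 * N * h ^ 2 := by ring
  rw [e]
  rw [abs_le] at h2 h3 ⊢
  constructor <;> linarith [h2.1, h2.2, h3.1, h3.2]

/-- Composition with an Euler step preserves `C^{1,1}` test functions, with quantitative control. -/
lemma isC11Test_comp (hW : IsFlowField ℓ W W' C) (hC : 0 ≤ C) {φ : E D → ℝ}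
    {φ' : E D → E D →L[ℝ] ℝ} {N R : ℝ} (hφ : IsC11Test φ φ' N R) {τ h : ℝ} (hτ : τ ∈ Icc 0 ℓ)
    (hh : |h| ≤ 1) :
    IsC11Test (fun x => φ (x + h • W τ x))
      (fun x => (φ' (x + h • W τ x)).comp (ContinuousLinearMap.id ℝ (E D) + h • W' τ x))
      (N * (1 + (3 * C + C ^ 2) * |h|)) (R + C * |h|) := by
  have hN := hφ.nonneg
  have ha := abs_nonneg h
  have hB : ∀ x, ‖ContinuousLinearMap.id ℝ (E D) + h • W' τ x‖ ≤ 1 + C * |h| := fun x => by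
    refine (norm_add_le _ _).trans (add_le_add ContinuousLinearMap.norm_id_le ?_)
    rw [norm_smul, Real.norm_eq_abs, mul_comm]
    gcongr
    exact hW.norm_fderiv_le τ hτ x
  have he : ∀ x, ‖h • W τ x‖ ≤ C * |h| := fun x => by
    rw [norm_smul, Real.norm_eq_abs, mul_comm]
    gcongr
    exact hW.norm_le τ hτ x
  have hle : |h| ^ 2 ≤ |h| := by
    rw [sq]; exact mul_le_of_le_one_left ha hh
  refine ⟨fun x => ?_, fun x => ?_, fun x y => ?_, fun x hx => ?_⟩
  · exact (hφ.hasFDerivAt _).comp x ((hasFDerivAt_id x).add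
      ((hW.hasFDerivAt τ hτ x).const_smul h))
  · refine (ContinuousLinearMap.opNorm_comp_le _ _).trans ?_
    refine (mul_le_mul (hφ.norm_le _) (hB x) (norm_nonneg _) hN).trans ?_
    gcongr
    nlinarith [sq_nonneg C]
  · set A := φ' (x + h • W τ x)
    set A' := φ' (y + h • W τ y)
    have h1 : ‖A - A'‖ ≤ N * ((1 + C * |h|) * ‖x - y‖) := by
      refine (hφ.lipschitz _ _).trans ?_
      gcongr
      calc _ = ‖(x - y) + h • (W τ x - W τ y)‖ := by congr 1; module
        _ ≤ ‖x - y‖ + |h| * (C * ‖x - y‖) := by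
            refine (norm_add_le _ _).trans ?_
            rw [norm_smul, Real.norm_eq_abs]
            gcongr
            simpa using hW.lipschitz τ hτ τ hτ x y
        _ = _ := by ring
    have h2 : ‖(ContinuousLinearMap.id ℝ (E D) + h • W' τ x) -
        (ContinuousLinearMap.id ℝ (E D) + h • W' τ y)‖ ≤ |h| * (C * ‖x - y‖) := by
      rw [add_sub_add_left_eq_sub, ← smul_sub h (W' τ x) (W' τ y), norm_smul, Real.norm_eq_abs]
      gcongr
      exact hW.fderiv_lipschitz τ hτ x y
    have e : A.comp (ContinuousLinearMap.id ℝ (E D) + h • W' τ x) -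
        A'.comp (ContinuousLinearMap.id ℝ (E D) + h • W' τ y) =
        (A - A').comp (ContinuousLinearMap.id ℝ (E D) + h • W' τ x) +
        A'.comp ((ContinuousLinearMap.id ℝ (E D) + h • W' τ x) -
        (ContinuousLinearMap.id ℝ (E D) + h • W' τ y)) := by
      rw [ContinuousLinearMap.sub_comp, ContinuousLinearMap.comp_sub]; abel
    rw [e]
    calc _ ≤ N * ((1 + C * |h|) * ‖x - y‖) * (1 + C * |h|) + N * (|h| * (C * ‖x - y‖)) := by
          refine (norm_add_le _ _).trans (add_le_add ?_ ?_)
          · exact (ContinuousLinearMap.opNorm_comp_le _ _).trans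
              (mul_le_mul h1 (hB x) (norm_nonneg _) (by positivity))
          · exact (ContinuousLinearMap.opNorm_comp_le _ _).trans
              (mul_le_mul (hφ.norm_le _) h2 (norm_nonneg _) hN)
      _ = N * (1 + 3 * C * |h| + C ^ 2 * |h| ^ 2) * ‖x - y‖ := by ring
      _ ≤ N * (1 + 3 * C * |h| + C ^ 2 * |h|) * ‖x - y‖ := by gcongr
      _ = _ := by ring
  · refine hφ.eq_zero _ ?_
    have h1 : ‖x‖ ≤ ‖x + h • W τ x‖ + ‖h • W τ x‖ := by
      have := norm_sub_le (x + h • W τ x) (h • W τ x)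
      rwa [add_sub_cancel_right] at this
    linarith [he x]

lemma continuous_eulerMap (hW : IsFlowField ℓ W W' C) {s h : ℝ} {n : ℕ}
    (hn : ∀ k ≤ n, s + k * h ∈ Icc 0 ℓ) : ∀ k ≤ n, Continuous (eulerMap W s h k) := by
  intro k
  induction k with
  | zero => exact fun _ => continuous_id
  | succ k ih =>
    intro hk
    have h1 := ih (by omega)
    have h2 := (hW.continuous (hn k (by omega))).comp h1
    exact h1.add (h2.const_smul h)

/-- After `k` Euler steps the error of the transported measures is at most `k` times the second
order error of one step. By induction on `k`, the integrand being composed with the last Euler step;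
this enlarges its support by `C |h|` (hence the condition on `R`, which keeps all supports in the
ball of radius `Rm`) and its `C^{1,1}` bound `N` by a factor `1 + (3 C + C²) |h|`. -/
lemma abs_integral_euler_le (hℓ : 0 ≤ ℓ) (hW : IsFlowField ℓ W W' C) (hC : 0 ≤ C)
    {σ : ℝ → WSpace D} {r : ℝ → E D → ℝ} (hσ : HasLipschitzDensity ℓ σ r C)
    (hvel : IsVelocity 0 ℓ σ W) {s h : ℝ} (hh : |h| ≤ 1) {n : ℕ}
    (hn : ∀ k ≤ n, s + k * h ∈ Icc 0 ℓ) (Rm : ℝ) :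
    ∀ k ≤ n, ∀ (φ : E D → ℝ) (φ' : E D → E D →L[ℝ] ℝ) (N R : ℝ), IsC11Test φ φ' N R →
      R ≤ Rm - C * (k * |h|) →
      |∫ x, φ x ∂(σ (s + k * h)).toMeasure - ∫ x, φ (eulerMap W s h k x) ∂(σ s).toMeasure| ≤
        k * ((C + volume.real (Metric.closedBall (0 : E D) Rm) * C ^ 2 + C ^ 2) *
          (N * (1 + (3 * C + C ^ 2) * |h|) ^ k) * h ^ 2) := by
  set K : ℝ := C + volume.real (Metric.closedBall (0 : E D) Rm) * C ^ 2 + C ^ 2 with hK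
  have hK0 : 0 ≤ K := by positivity
  intro k
  induction k with
  | zero =>
    intro _ φ φ' N R _ _
    simp [eulerMap]
  | succ k ih =>
    intro hk φ φ' N R hφ hR
    have hN := hφ.nonneg
    push_cast at hR ⊢
    have ha := abs_nonneg h
    have hτ := hn k (by omega)
    have hτ' := hn (k + 1) hk
    have e0 : s + ((k : ℝ) + 1) * h = s + k * h + h := by ring
    push_cast at hτ'
    rw [e0] at hτ' ⊢
    have h1 := hW.abs_integral_step_le hℓ hC hσ hvel hφ hτ hτ'
    have h2 := ih (by omega) _ _ _ _ (hW.isC11Test_comp hC hφ hτ hh) (by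
      linarith)
    set q : ℝ := 1 + (3 * C + C ^ 2) * |h| with hq
    have hq1 : 1 ≤ q := by rw [hq]; have : 0 ≤ (3 * C + C ^ 2) * |h| := by positivity
                           linarith
    have hRle : R ≤ Rm := by
      have : 0 ≤ C * ((k + 1) * |h|) := by positivity
      linarith
    have hV : volume.real (Metric.closedBall (0 : E D) R) ≤
        volume.real (Metric.closedBall (0 : E D) Rm) :=
      measureReal_mono (Metric.closedBall_subset_closedBall hRle) measure_closedBall_lt_top.ne
    have h1' : |∫ x, φ x ∂(σ (s + k * h + h)).toMeasure -
        ∫ x, φ (x + h • W (s + k * h) x) ∂(σ (s + k * h)).toMeasure| ≤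
        K * (N * q ^ (k + 1)) * h ^ 2 := by
      refine h1.trans ?_
      have : N * 1 ≤ N * q ^ (k + 1) := by gcongr; exact one_le_pow₀ hq1
      rw [mul_one] at this
      gcongr
      rw [hK]
      gcongr
    have e1 : N * q * q ^ k = N * q ^ (k + 1) := by ring
    rw [e1] at h2
    calc _ ≤ _ := abs_sub_le _ (∫ x, φ (x + h • W (s + k * h) x) ∂(σ (s + k * h)).toMeasure) _
      _ ≤ _ := add_le_add h1' h2
      _ = _ := by ring

/-- The integral curve of `W` through `x` at time `s`; it exists on the whole of `[0, ℓ]`, forwards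
and backwards from `s`. -/
lemma exists_integralCurve (hW : IsFlowField ℓ W W' C) (hC : 0 ≤ C) {s : ℝ} (hs : s ∈ Icc 0 ℓ)
    (x : E D) : ∃ y : ℝ → E D, y s = x ∧
      ∀ t ∈ Icc 0 ℓ, HasDerivWithinAt y (W t (y t)) (Icc 0 ℓ) t := by
  have hℓ : 0 ≤ ℓ := hs.1.trans hs.2
  have hP : IsPicardLindelof W (tmin := 0) (tmax := ℓ) ⟨s, hs⟩ x (C * ℓ).toNNReal 0
      C.toNNReal C.toNNReal := by
    refine ⟨fun t ht => ?_, fun z _ => ?_, fun t ht z _ => ?_, ?_⟩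
    · refine LipschitzOnWith.of_dist_le_mul fun z _ z' _ => ?_
      rw [dist_eq_norm, dist_eq_norm, Real.coe_toNNReal C hC]
      simpa using hW.lipschitz t ht t ht z z'
    · have : LipschitzOnWith C.toNNReal (fun t => W t z) (Icc 0 ℓ) :=
        LipschitzOnWith.of_dist_le_mul fun t ht t' ht' => by
          rw [dist_eq_norm, Real.dist_eq, Real.coe_toNNReal C hC]
          simpa using hW.lipschitz t ht t' ht' z z
      exact this.continuousOn
    · rw [Real.coe_toNNReal C hC]
      exact hW.norm_le t ht z
    · rw [Real.coe_toNNReal C hC, Real.coe_toNNReal _ (by positivity)]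
      simp only [NNReal.coe_zero, sub_zero]
      gcongr
      exact max_le (by linarith [hs.1]) (by linarith [hs.2])
  exact hP.exists_eq_forall_mem_Icc_hasDerivWithinAt₀

lemma norm_integralCurve_sub_le (hW : IsFlowField ℓ W W' C) {y : ℝ → E D}
    (hy : ∀ t ∈ Icc 0 ℓ, HasDerivWithinAt y (W t (y t)) (Icc 0 ℓ) t) {a b : ℝ} (ha : a ∈ Icc 0 ℓ)
    (hb : b ∈ Icc 0 ℓ) : ‖y b - y a‖ ≤ C * |b - a| :=
  (convex_Icc 0 ℓ).norm_image_sub_le_of_norm_hasDerivWithin_le hy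
    (fun t ht => hW.norm_le t ht _) ha hb

lemma norm_integralCurve_sub_sub_le (hW : IsFlowField ℓ W W' C) (hC : 0 ≤ C) {y : ℝ → E D}
    (hy : ∀ t ∈ Icc 0 ℓ, HasDerivWithinAt y (W t (y t)) (Icc 0 ℓ) t) {a b : ℝ} (ha : a ∈ Icc 0 ℓ)
    (hb : b ∈ Icc 0 ℓ) : ‖y b - y a - (b - a) • W a (y a)‖ ≤ C * (1 + C) * (b - a) ^ 2 := by
  have hsub : uIcc a b ⊆ Icc 0 ℓ := (convex_Icc 0 ℓ).ordConnected.uIcc_subset ha hb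
  have h := (convex_uIcc a b).norm_image_sub_le_of_norm_hasDerivWithin_le
    (f := fun t => y t - t • W a (y a)) (f' := fun t => W t (y t) - (1 : ℝ) • W a (y a))
    (C := C * (1 + C) * |b - a|)
    (fun t ht => ((hy t (hsub ht)).mono hsub).sub
      ((hasDerivWithinAt_id t _).smul_const (W a (y a))))
    (fun t ht => by
      have h1 := abs_sub_left_of_mem_uIcc ht
      have h2 := hW.norm_integralCurve_sub_le hy ha (hsub ht)
      rw [one_smul]
      calc _ ≤ C * (|t - a| + ‖y t - y a‖) := hW.lipschitz t (hsub ht) a ha _ _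
        _ ≤ C * (|b - a| + C * |b - a|) := by
          gcongr
          exact h2.trans (by gcongr)
        _ = _ := by ring)
    left_mem_uIcc right_mem_uIcc
  calc _ = ‖y b - b • W a (y a) - (y a - a • W a (y a))‖ := by congr 1; module
    _ ≤ _ := h
    _ = _ := by rw [Real.norm_eq_abs, mul_assoc, abs_mul_abs_self, sq]

/-- Euler polygons follow the integral curves up to a global error of first order in the step. -/
lemma norm_eulerMap_sub_le (hW : IsFlowField ℓ W W' C) (hC : 0 ≤ C) {s h : ℝ} {n : ℕ}
    (hn : ∀ k ≤ n, s + k * h ∈ Icc 0 ℓ) {y : ℝ → E D}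
    (hy : ∀ t ∈ Icc 0 ℓ, HasDerivWithinAt y (W t (y t)) (Icc 0 ℓ) t) :
    ∀ k ≤ n, ‖eulerMap W s h k (y s) - y (s + k * h)‖ ≤
      k * (C * (1 + C) * (1 + C * |h|) ^ k * h ^ 2) := by
  intro k
  induction k with
  | zero => intro _; simp [eulerMap]
  | succ k ih =>
    intro hk
    have h1 := ih (by omega)
    have hτ := hn k (by omega)
    have hτ' := hn (k + 1) hk
    push_cast at hτ' ⊢
    have e0 : s + ((k : ℝ) + 1) * h = s + k * h + h := by ring
    rw [e0] at hτ' ⊢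
    have ha := abs_nonneg h
    set τ := s + k * h
    set z := eulerMap W s h k (y s) with hz
    set q : ℝ := 1 + C * |h| with hq
    have hq1 : 1 ≤ q := by
      have : 0 ≤ C * |h| := by positivity
      linarith
    have h2 := hW.norm_integralCurve_sub_sub_le hC hy hτ hτ'
    rw [add_sub_cancel_left] at h2
    have h3 : eulerMap W s h (k + 1) (y s) - y (τ + h) =
        (z - y τ) + h • (W τ z - W τ (y τ)) - (y (τ + h) - y τ - h • W τ (y τ)) := by
      have : eulerMap W s h (k + 1) (y s) = z + h • W τ z := rfl
      rw [this]; module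
    rw [h3]
    have h4 : ‖h • (W τ z - W τ (y τ))‖ ≤ |h| * (C * ‖z - y τ‖) := by
      rw [norm_smul, Real.norm_eq_abs]
      gcongr
      simpa using hW.lipschitz τ hτ τ hτ z (y τ)
    calc _ ≤ ‖z - y τ‖ + |h| * (C * ‖z - y τ‖) + C * (1 + C) * h ^ 2 :=
          (norm_sub_le _ _).trans (add_le_add ((norm_add_le _ _).trans (by gcongr)) h2)
      _ = q * ‖z - y τ‖ + C * (1 + C) * h ^ 2 * 1 := by rw [hq]; ring
      _ ≤ q * (k * (C * (1 + C) * q ^ k * h ^ 2)) + C * (1 + C) * h ^ 2 * q ^ (k + 1) := by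
          gcongr
          exact one_le_pow₀ hq1
      _ = _ := by ring

/-- The curve `σ` is transported by the flow of its velocity. The flow map is the limit of the Euler
polygons as the number of steps tends to infinity; the errors of the steps are of second order, so
that their sum tends to `0`. -/
theorem exists_transport (hℓ : 0 ≤ ℓ) (hW : IsFlowField ℓ W W' C) (hC : 0 ≤ C)
    {σ : ℝ → WSpace D} {r : ℝ → E D → ℝ} (hσ : HasLipschitzDensity ℓ σ r C)
    (hvel : IsVelocity 0 ℓ σ W) {a b : ℝ} (ha : a ∈ Icc 0 ℓ) (hb : b ∈ Icc 0 ℓ) :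
    ∃ Θ : E D → E D, Measurable Θ ∧ (σ b).toMeasure = (σ a).toMeasure.map Θ ∧
      (∀ x, ‖Θ x - x‖ ≤ C * |b - a|) ∧
      ∀ x, ‖Θ x - x - (b - a) • W a x‖ ≤ C * (1 + C) * (b - a) ^ 2 := by
  choose y hy0 hy using fun x => hW.exists_integralCurve hC ha x
  have hbd1 : ∀ x, ‖y x b - x‖ ≤ C * |b - a| := fun x => by
    have := hW.norm_integralCurve_sub_le (hy x) ha hb
    rwa [hy0] at this
  have hbd2 : ∀ x, ‖y x b - x - (b - a) • W a x‖ ≤ C * (1 + C) * (b - a) ^ 2 := fun x => by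
    have := hW.norm_integralCurve_sub_sub_le hC (hy x) ha hb
    rwa [hy0] at this
  -- Euler polygons with `n + 1` steps from `a` to `b`
  set h : ℕ → ℝ := fun n => (b - a) / (n + 1) with hh
  have hnb : ∀ n : ℕ, a + ((n + 1 : ℕ) : ℝ) * h n = b := fun n => by
    rw [hh]; push_cast; field_simp; ring
  have hstep : ∀ n : ℕ, ∀ k ≤ n + 1, a + k * h n ∈ Icc 0 ℓ := by
    intro n k hk
    have hpos : (0 : ℝ) < n + 1 := by positivity
    have hk' : (k : ℝ) / (n + 1) ≤ 1 := by
      rw [div_le_one hpos]; exact_mod_cast hk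
    have e : a + k * h n = (1 - (k : ℝ) / (n + 1)) • a + ((k : ℝ) / (n + 1)) • b := by
      rw [hh]; simp only [smul_eq_mul]; field_simp; ring
    rw [e]
    exact (convex_Icc 0 ℓ) ha hb (by linarith) (by positivity) (by ring)
  have hsum : ∀ n : ℕ, ((n : ℝ) + 1) * |h n| = |b - a| := fun n => by
    have hpos : (0 : ℝ) < n + 1 := by positivity
    rw [hh]; simp only [abs_div, abs_of_pos hpos]; field_simp
  have hsq : ∀ n : ℕ, ((n : ℝ) + 1) * h n ^ 2 = (b - a) ^ 2 / (n + 1) := fun n => by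
    rw [hh]; field_simp
  have hexp : ∀ (K : ℝ), 0 ≤ K → ∀ n : ℕ, (1 + K * |h n|) ^ (n + 1) ≤ Real.exp (K * |b - a|) := by
    intro K hK n
    have h0 : 0 ≤ K * |h n| := by positivity
    calc (1 + K * |h n|) ^ (n + 1) ≤ (Real.exp (K * |h n|)) ^ (n + 1) := by
          gcongr
          rw [add_comm]
          exact Real.add_one_le_exp _
      _ = Real.exp (K * |b - a|) := by
          rw [← Real.exp_nat_mul, ← hsum n]; push_cast; ring_nf
  set X : ℕ → E D → E D := fun n => eulerMap W a (h n) (n + 1) with hX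
  have hXcont : ∀ n, Continuous (X n) := fun n =>
    hW.continuous_eulerMap (hstep n) (n + 1) le_rfl
  set A : ℝ := C * (1 + C) * Real.exp (C * |b - a|) * (b - a) ^ 2 with hA
  have hXy : ∀ n x, ‖X n x - y x b‖ ≤ A / (n + 1) := by
    intro n x
    have h1 := hW.norm_eulerMap_sub_le hC (hstep n) (hy x) (n + 1) le_rfl
    rw [hy0, hnb] at h1
    push_cast at h1
    calc _ ≤ _ := h1
      _ = C * (1 + C) * (1 + C * |h n|) ^ (n + 1) * (((n : ℝ) + 1) * h n ^ 2) := by ring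
      _ ≤ C * (1 + C) * Real.exp (C * |b - a|) * (((n : ℝ) + 1) * h n ^ 2) := by
          gcongr
          exact hexp C hC n
      _ = _ := by rw [hsq, hA]; ring
  have hA0 : Tendsto (fun n : ℕ => A / ((n : ℝ) + 1)) atTop (𝓝 0) :=
    tendsto_const_div_natCast_add_one A
  have hmeas : Measurable fun x => y x b := by
    refine measurable_of_tendsto_metrizable (fun n => (hXcont n).measurable) ?_
    rw [tendsto_pi_nhds]
    intro x
    rw [tendsto_iff_norm_sub_tendsto_zero]
    exact squeeze_zero (fun _ => norm_nonneg _) (fun n => hXy n x) hA0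
  refine ⟨fun x => y x b, hmeas, ?_, hbd1, hbd2⟩
  have : IsProbabilityMeasure ((σ a).toMeasure.map fun x => y x b) :=
    Measure.isProbabilityMeasure_map hmeas.aemeasurable
  -- both measures give the same integrals of smooth test functions: compare them by Euler polygons
  have htest : ∀ ψ : E D → ℝ, IsTest ψ →
      ∫ x, ψ x ∂(σ b).toMeasure = ∫ x, ψ (y x b) ∂(σ a).toMeasure := by
    intro ψ hψ
    obtain ⟨N, R, hψ'⟩ := hψ.isC11Test
    obtain ⟨B, hB⟩ := hψ.bounded
    have hN := hψ'.nonneg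
    -- a radius that contains the supports of all compositions of `ψ` with Euler polygons
    set Rm : ℝ := R + C * |b - a| with hRm
    set K : ℝ := C + volume.real (Metric.closedBall (0 : E D) Rm) * C ^ 2 + C ^ 2 with hK
    have hK0 : 0 ≤ K := by positivity
    have hψc := hψ.1.continuous
    have hsmall : ∀ᶠ n : ℕ in atTop, |h n| ≤ 1 := by
      have h1 : Tendsto h atTop (𝓝 0) := tendsto_const_div_natCast_add_one (b - a)
      filter_upwards [h1.eventually (Metric.closedBall_mem_nhds (0 : ℝ) one_pos)] with n hn
      simpa using hn
    have hb1 : ∀ᶠ n : ℕ in atTop,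
        |∫ x, ψ x ∂(σ b).toMeasure - ∫ x, ψ (y x b) ∂(σ a).toMeasure| ≤
          (K * (N * Real.exp ((3 * C + C ^ 2) * |b - a|)) * (b - a) ^ 2 + N * A) /
            ((n : ℝ) + 1) := by
      filter_upwards [hsmall] with n hn
      have h1 := hW.abs_integral_euler_le hℓ hC hσ hvel hn (hstep n) Rm (n + 1) le_rfl ψ
        (fderiv ℝ ψ) N R hψ' (by
          push_cast
          rw [hsum n, hRm]; linarith)
      rw [hnb] at h1
      push_cast at h1
      have h2 : ((n : ℝ) + 1) * (K * (N * (1 + (3 * C + C ^ 2) * |h n|) ^ (n + 1)) * h n ^ 2) ≤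
          K * (N * Real.exp ((3 * C + C ^ 2) * |b - a|)) * (b - a) ^ 2 / ((n : ℝ) + 1) := by
        calc _ = K * (N * (1 + (3 * C + C ^ 2) * |h n|) ^ (n + 1)) *
              (((n : ℝ) + 1) * h n ^ 2) := by ring
          _ ≤ K * (N * Real.exp ((3 * C + C ^ 2) * |b - a|)) * (((n : ℝ) + 1) * h n ^ 2) := by
              gcongr
              exact hexp _ (by positivity) n
          _ = _ := by rw [hsq]; ring
      have hi1 : Integrable (fun x => ψ (X n x)) (σ a).toMeasure :=
        integrable_of_forall_norm_le (hψc.comp (hXcont n)).aestronglyMeasurable fun x => hB _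
      have hi2 : Integrable (fun x => ψ (y x b)) (σ a).toMeasure :=
        integrable_of_forall_norm_le (hψc.measurable.comp hmeas).aestronglyMeasurable fun x => hB _
      have h3 := abs_integral_sub_le_of_forall hi1 hi2 (B := N * (A / (n + 1))) fun x =>
        (hψ'.abs_sub_le _ _).trans (by gcongr; exact hXy n x)
      calc _ ≤ _ := abs_sub_le _ (∫ x, ψ (X n x) ∂(σ a).toMeasure) _
        _ ≤ _ := add_le_add (h1.trans h2) h3
        _ = _ := by ring
    have hlim := tendsto_const_div_natCast_add_one
      (K * (N * Real.exp ((3 * C + C ^ 2) * |b - a|)) * (b - a) ^ 2 + N * A)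
    exact sub_eq_zero.1 (abs_eq_zero.1 (le_antisymm (ge_of_tendsto hlim hb1) (abs_nonneg _)))
  -- pass from smooth to continuous compactly supported functions by mollification
  refine Measure.ext_of_integral_eq_on_compactlySupported fun f => ?_
  have hfc : Continuous f := f.continuous
  have hfs : HasCompactSupport f := f.hasCompactSupport
  rw [integral_map hmeas.aemeasurable hfc.aestronglyMeasurable]
  obtain ⟨B, hB⟩ := hfs.exists_bound_of_continuous hfc
  have huc := hfs.uniformContinuous_of_continuous hfc
  rw [← sub_eq_zero, ← abs_eq_zero]
  refine le_antisymm (le_of_forall_pos_le_add fun ε hε => ?_) (abs_nonneg _)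
  obtain ⟨δ, hδ, hfδ⟩ := Metric.uniformContinuous_iff.1 huc (ε / 2) (by positivity)
  obtain ⟨n, hn⟩ := exists_nat_one_div_lt hδ
  have hm : ∀ x, |moll n f x - f x| ≤ ε / 2 := fun x =>
    norm_moll_sub_le n hfc fun y' hy' => by
      have : dist y' x < δ := by rw [dist_eq_norm]; exact hy'.trans hn
      exact (hfδ this).le
  have hψ : IsTest (moll n f) := isTest_moll n hfc hfs
  have hmB : ∀ x, ‖moll n f x‖ ≤ B := norm_moll_le n hB
  have hmc := hψ.1.continuous
  have h1 := abs_integral_sub_le_of_forall (μ := σ b)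
    (integrable_of_forall_norm_le hmc.aestronglyMeasurable hmB)
    (integrable_of_forall_norm_le hfc.aestronglyMeasurable hB) hm
  have h2 := abs_integral_sub_le_of_forall (μ := σ a) (g := fun x => moll n f (y x b))
    (k := fun x => f (y x b))
    (integrable_of_forall_norm_le (hmc.measurable.comp hmeas).aestronglyMeasurable fun x => hmB _)
    (integrable_of_forall_norm_le (hfc.measurable.comp hmeas).aestronglyMeasurable fun x => hB _)
    (fun x => hm _)
  have h3 := htest _ hψ
  rw [zero_add]
  rw [abs_le] at h1 h2 ⊢
  constructor <;> linarith [h1.1, h1.2, h2.1, h2.2]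

end IsFlowField

/-! ### Surfaces and their transport maps -/

/-- The parameter domain `[0,1] × [0,T]`. -/
def rect (T : ℝ) : Set (ℝ × ℝ) := Icc 0 1 ×ˢ Icc 0 T

lemma isCompact_rect (T : ℝ) : IsCompact (rect T) := isCompact_Icc.prod isCompact_Icc

lemma mem_box {T : ℝ} {s t : ℝ} {x : E D} : (s, t, x) ∈ box D T ↔ (s, t) ∈ rect T := by
  simp only [box, rect, Set.mem_prod, mem_univ, and_true]

lemma convex_box (T : ℝ) : Convex ℝ (box D T) :=
  (convex_Icc 0 1).prod ((convex_Icc 0 T).prod convex_univ)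

lemma uniqueDiffOn_box {T : ℝ} (hT : 0 < T) : UniqueDiffOn ℝ (box D T) :=
  (uniqueDiffOn_Icc one_pos).prod ((uniqueDiffOn_Icc hT).prod uniqueDiffOn_univ)

/-- A field on the box that is bounded with bounded Lipschitz derivative `v'`; the constant `C`
bounds all three. -/
structure IsC11Field (T : ℝ) (v : ℝ → ℝ → E D → E D)
    (v' : ℝ × ℝ × E D → ℝ × ℝ × E D →L[ℝ] E D) (C : ℝ) : Prop where
  hasFDerivWithinAt : ∀ p ∈ box D T,
    HasFDerivWithinAt (fun p : ℝ × ℝ × E D => v p.1 p.2.1 p.2.2) (v' p) (box D T) p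
  norm_le' : ∀ p ∈ box D T, ‖v p.1 p.2.1 p.2.2‖ ≤ C
  norm_fderiv_le' : ∀ p ∈ box D T, ‖v' p‖ ≤ C
  fderiv_lipschitz' : ∀ p ∈ box D T, ∀ q ∈ box D T, ‖v' p - v' q‖ ≤ C * ‖p - q‖

/-- The bounds for the first two derivatives suffice. -/
lemma HasBoundedC2.exists_isC11Field {T : ℝ} (hT : 0 < T) {v : ℝ → ℝ → E D → E D}
    (hv : HasBoundedC2 T v) : ∃ v' C, IsC11Field T v v' C := by
  obtain ⟨hc, ⟨C, hC⟩, -⟩ := hv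
  have hu := uniqueDiffOn_box (D := D) hT
  set V : ℝ × ℝ × E D → E D := fun p => v p.1 p.2.1 p.2.2 with hV
  have hd : ∀ p ∈ box D T, HasFDerivWithinAt V (fderivWithin ℝ V (box D T) p) (box D T) p :=
    fun p hp => (hc.differentiableOn (by norm_num) p hp).hasFDerivWithinAt
  have hd2 : DifferentiableOn ℝ (fderivWithin ℝ V (box D T)) (box D T) :=
    (hc.fderivWithin (m := 1) hu (by norm_num)).differentiableOn (by norm_num)
  refine ⟨fderivWithin ℝ V (box D T), C, hd, fun p hp => ?_, fun p hp => ?_, fun p hp q hq => ?_⟩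
  · simpa using hC 0 (by norm_num) p hp
  · have := hC 1 (by norm_num) p hp
    rwa [norm_iteratedFDerivWithin_one V (hu p hp)] at this
  · refine (convex_box T).norm_image_sub_le_of_norm_fderivWithin_le hd2 (fun z hz => ?_) hq hp
    have := hC 2 le_rfl z hz
    rw [← norm_iteratedFDerivWithin_fderivWithin hu hz,
      norm_iteratedFDerivWithin_one _ (hu z hz)] at this
    exact this

/-- The inclusion of the directions of space. -/
def spaceIncl (D : ℕ) : E D →L[ℝ] ℝ × ℝ × E D :=
  (ContinuousLinearMap.inr ℝ ℝ (ℝ × E D)).comp (ContinuousLinearMap.inr ℝ ℝ (E D))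

@[simp] lemma spaceIncl_apply (x : E D) : spaceIncl D x = (0, 0, x) := rfl

lemma norm_spaceIncl_le : ‖spaceIncl D‖ ≤ 1 :=
  ContinuousLinearMap.opNorm_le_bound _ zero_le_one fun x => by
    rw [spaceIncl_apply, one_mul, Prod.norm_def, Prod.norm_def]; simp

lemma norm_triple_le (a b : ℝ) (x : E D) :
    ‖((a, b, x) : ℝ × ℝ × E D)‖ ≤ ‖((a, b) : ℝ × ℝ)‖ + ‖x‖ := by
  rw [Prod.norm_def, Prod.norm_def, Prod.norm_def]
  refine max_le ?_ (max_le ?_ ?_)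
  · exact (le_max_left _ _).trans (le_add_of_nonneg_right (norm_nonneg _))
  · exact (le_max_right _ _).trans (le_add_of_nonneg_right (norm_nonneg _))
  · exact le_add_of_nonneg_left (le_max_of_le_left (norm_nonneg _))

namespace IsC11Field

variable {T C : ℝ} {v : ℝ → ℝ → E D → E D} {v' : ℝ × ℝ × E D → ℝ × ℝ × E D →L[ℝ] E D}

lemma mono (hv : IsC11Field T v v' C) {C' : ℝ} (h : C ≤ C') : IsC11Field T v v' C' :=
  ⟨hv.hasFDerivWithinAt, fun p hp => (hv.norm_le' p hp).trans h,
    fun p hp => (hv.norm_fderiv_le' p hp).trans h,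
    fun p hp q hq => (hv.fderiv_lipschitz' p hp q hq).trans (by gcongr)⟩

lemma norm_le (hv : IsC11Field T v v' C) {s t : ℝ} (hp : (s, t) ∈ rect T) (x : E D) :
    ‖v s t x‖ ≤ C := hv.norm_le' (s, t, x) (mem_box.2 hp)

lemma norm_fderiv_le (hv : IsC11Field T v v' C) {s t : ℝ} (hp : (s, t) ∈ rect T) (x : E D) :
    ‖v' (s, t, x)‖ ≤ C := hv.norm_fderiv_le' (s, t, x) (mem_box.2 hp)

lemma fderiv_lipschitz (hv : IsC11Field T v v' C) (hC : 0 ≤ C) {s t s' t' : ℝ}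
    (hp : (s, t) ∈ rect T)
    (hq : (s', t') ∈ rect T) (x y : E D) :
    ‖v' (s, t, x) - v' (s', t', y)‖ ≤ C * (‖((s - s', t - t') : ℝ × ℝ)‖ + ‖x - y‖) :=
  (hv.fderiv_lipschitz' (s, t, x) (mem_box.2 hp) (s', t', y) (mem_box.2 hq)).trans
    (mul_le_mul_of_nonneg_left (norm_triple_le _ _ _) hC)

lemma lipschitz (hv : IsC11Field T v v' C) (hC : 0 ≤ C) {s t s' t' : ℝ} (hp : (s, t) ∈ rect T)
    (hq : (s', t') ∈ rect T) (x y : E D) :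
    ‖v s t x - v s' t' y‖ ≤ C * (‖((s - s', t - t') : ℝ × ℝ)‖ + ‖x - y‖) :=
  ((convex_box T).norm_image_sub_le_of_norm_hasFDerivWithin_le hv.hasFDerivWithinAt
    hv.norm_fderiv_le' (x := (s', t', y)) (y := (s, t, x)) (mem_box.2 hq) (mem_box.2 hp)).trans
    (mul_le_mul_of_nonneg_left (norm_triple_le _ _ _) hC)

lemma taylor (hv : IsC11Field T v v' C) (hC : 0 ≤ C) {s t s' t' : ℝ} (hp : (s, t) ∈ rect T)
    (hq : (s', t') ∈ rect T) (x y : E D) :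
    ‖v s' t' y - v s t x - v' (s, t, x) (s' - s, t' - t, y - x)‖ ≤
      C * (‖((s' - s, t' - t) : ℝ × ℝ)‖ + ‖y - x‖) ^ 2 :=
  (norm_sub_sub_le_of_lipschitz_fderiv (convex_box T) hv.hasFDerivWithinAt hv.fderiv_lipschitz' hC
    (x := (s, t, x)) (y := (s', t', y)) (mem_box.2 hp) (mem_box.2 hq)).trans
    (mul_le_mul_of_nonneg_left (pow_le_pow_left₀ (norm_nonneg _) (norm_triple_le _ _ _) 2) hC)

/-- The spatial derivative. -/
lemma hasFDerivAt_space (hv : IsC11Field T v v' C) {s t : ℝ} (hp : (s, t) ∈ rect T) (x : E D) :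
    HasFDerivAt (v s t) ((v' (s, t, x)).comp (spaceIncl D)) x := by
  have h1 : HasFDerivAt (fun y : E D => ((s, t, y) : ℝ × ℝ × E D)) (spaceIncl D) x := by
    have h2 : HasFDerivAt (fun y : E D => spaceIncl D y + (s, t, 0)) (spaceIncl D) x :=
      (spaceIncl D).hasFDerivAt.add_const _
    convert h2 using 2 with y
    simp
  have h3 := (hv.hasFDerivWithinAt (s, t, x) (mem_box.2 hp)).comp x
    (h1.hasFDerivWithinAt (s := univ)) (fun y _ => mem_box.2 hp)
  rw [hasFDerivWithinAt_univ] at h3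
  exact h3

lemma norm_comp_spaceIncl_le {A : ℝ × ℝ × E D →L[ℝ] E D} {c : ℝ} (h : ‖A‖ ≤ c) :
    ‖A.comp (spaceIncl D)‖ ≤ c :=
  ((ContinuousLinearMap.opNorm_comp_le _ _).trans
    (mul_le_of_le_one_right (norm_nonneg _) norm_spaceIncl_le)).trans h

lemma continuous_space (hv : IsC11Field T v v' C) {s t : ℝ} (hp : (s, t) ∈ rect T) :
    Continuous (v s t) :=
  continuous_iff_continuousAt.2 fun x => (hv.hasFDerivAt_space hp x).continuousAt

lemma isFlowField_t (hv : IsC11Field T v v' C) (hC : 0 ≤ C) {s : ℝ} (hs : s ∈ Icc (0 : ℝ) 1) :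
    IsFlowField T (v s) (fun t x => (v' (s, t, x)).comp (spaceIncl D)) C where
  hasFDerivAt t ht x := hv.hasFDerivAt_space ⟨hs, ht⟩ x
  norm_le t ht x := hv.norm_le ⟨hs, ht⟩ x
  norm_fderiv_le t ht x := norm_comp_spaceIncl_le (hv.norm_fderiv_le ⟨hs, ht⟩ x)
  fderiv_lipschitz t ht x y := by
    rw [← ContinuousLinearMap.sub_comp]
    refine norm_comp_spaceIncl_le ?_
    simpa using hv.fderiv_lipschitz hC (s := s) (t := t) (s' := s) (t' := t) ⟨hs, ht⟩ ⟨hs, ht⟩ x y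
  lipschitz t ht t' ht' x y := by
    simpa [Prod.norm_def] using
      hv.lipschitz hC (s := s) (t := t) (s' := s) (t' := t') ⟨hs, ht⟩ ⟨hs, ht'⟩ x y

lemma isFlowField_s (hv : IsC11Field T v v' C) (hC : 0 ≤ C) {t : ℝ} (ht : t ∈ Icc 0 T) :
    IsFlowField 1 (fun s => v s t) (fun s x => (v' (s, t, x)).comp (spaceIncl D)) C where
  hasFDerivAt s hs x := hv.hasFDerivAt_space ⟨hs, ht⟩ x
  norm_le s hs x := hv.norm_le ⟨hs, ht⟩ x
  norm_fderiv_le s hs x := norm_comp_spaceIncl_le (hv.norm_fderiv_le ⟨hs, ht⟩ x)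
  fderiv_lipschitz s hs x y := by
    rw [← ContinuousLinearMap.sub_comp]
    refine norm_comp_spaceIncl_le ?_
    simpa using hv.fderiv_lipschitz hC (s := s) (t := t) (s' := s) (t' := t) ⟨hs, ht⟩ ⟨hs, ht⟩ x y
  lipschitz s hs s' hs' x y := by
    simpa [Prod.norm_def] using
      hv.lipschitz hC (s := s) (t := t) (s' := s') (t' := t) ⟨hs, ht⟩ ⟨hs', ht⟩ x y

end IsC11Field

/-- A surface whose measures are transported into one another by maps that follow the fields `w`
(in the direction of `s`) and `v` (in the direction of `t`) up to second order. -/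
def IsTransported (T : ℝ) (S : ℝ → ℝ → WSpace D) (v w : ℝ → ℝ → E D → E D) (C : ℝ) : Prop :=
  ∀ s t s' t', (s, t) ∈ rect T → (s', t') ∈ rect T → ∃ Θ : E D → E D, Measurable Θ ∧
    (S s' t').toMeasure = (S s t).toMeasure.map Θ ∧
    (∀ x, ‖Θ x - x‖ ≤ C * ‖((s' - s, t' - t) : ℝ × ℝ)‖) ∧
    ∀ x, ‖Θ x - x - ((s' - s) • w s t x + (t' - t) • v s t x)‖ ≤
      C * ‖((s' - s, t' - t) : ℝ × ℝ)‖ ^ 2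

lemma HasBoundedC1Density.exists_hasLipschitzDensity {T : ℝ} {S : ℝ → ℝ → WSpace D}
    (hS : HasBoundedC1Density T S) : ∃ ρ : ℝ → ℝ → E D → ℝ, ∃ C,
      (∀ s ∈ Icc (0 : ℝ) 1, HasLipschitzDensity T (S s) (ρ s) C) ∧
      ∀ t ∈ Icc 0 T, HasLipschitzDensity 1 (fun s => S s t) (fun s => ρ s t) C := by
  obtain ⟨ρ, h1, h2, C, hC⟩ := hS
  have hlip : ∀ p ∈ box D T, ∀ q ∈ box D T,
      ‖ρ p.1 p.2.1 p.2.2 - ρ q.1 q.2.1 q.2.2‖ ≤ C * ‖p - q‖ := fun p hp q hq =>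
    (convex_box T).norm_image_sub_le_of_norm_fderivWithin_le
      (h2.differentiableOn (by norm_num)) (fun z hz => (hC z hz).2) hq hp
  have hcont : ∀ s t, (s, t) ∈ rect T → Continuous (ρ s t) := fun s t hp =>
    h2.continuousOn.comp_continuous (f := fun x : E D => (s, t, x)) (by fun_prop)
      fun x => mem_box.2 hp
  refine ⟨ρ, C, fun s hs => ⟨fun t ht => (h1 s hs t ht).1, fun t ht => hcont s t ⟨hs, ht⟩,
    fun t ht t' ht' x => ?_, fun t ht => (h1 s hs t ht).2⟩, fun t ht =>
    ⟨fun s hs => (h1 s hs t ht).1, fun s hs => hcont s t ⟨hs, ht⟩,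
    fun s hs s' hs' x => ?_, fun s hs => (h1 s hs t ht).2⟩⟩
  · simpa [Prod.norm_def] using hlip (s, t, x) (mem_box.2 ⟨hs, ht⟩) (s, t', x) (mem_box.2 ⟨hs, ht'⟩)
  · simpa [Prod.norm_def] using hlip (s, t, x) (mem_box.2 ⟨hs, ht⟩) (s', t, x) (mem_box.2 ⟨hs', ht⟩)

lemma HasLipschitzDensity.mono {ℓ C C' : ℝ} {σ : ℝ → WSpace D} {r : ℝ → E D → ℝ}
    (h : HasLipschitzDensity ℓ σ r C) (hC : C ≤ C') : HasLipschitzDensity ℓ σ r C' :=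
  ⟨h.nonneg, h.continuous, fun τ hτ τ' hτ' x => (h.lipschitz τ hτ τ' hτ' x).trans (by gcongr),
    h.measure_eq⟩

/-- The flows of `v` and `w` transport the measures of a smooth surface: from `(s, t)` along the
flow of `v` to `(s, t')`, and from there along the flow of `w` to `(s', t')`. -/
theorem IsSmoothSurface.exists_isTransported {T : ℝ} (hT : 0 < T) {S : ℝ → ℝ → WSpace D}
    {v w : ℝ → ℝ → E D → E D} (hS : IsSmoothSurface T S v w) :
    ∃ v' w' C, 0 ≤ C ∧ IsC11Field T v v' C ∧ IsC11Field T w w' C ∧ IsTransported T S v w C := by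
  obtain ⟨v', C₁, hv⟩ := hS.reg_v.exists_isC11Field hT
  obtain ⟨w', C₂, hw⟩ := hS.reg_w.exists_isC11Field hT
  obtain ⟨ρ, C₃, hρt, hρs⟩ := hS.density.exists_hasLipschitzDensity
  set C : ℝ := max 0 (max C₁ (max C₂ C₃)) with hCdef
  have hC : 0 ≤ C := le_max_left _ _
  have l1 : C₁ ≤ C := (le_max_left _ _).trans (le_max_right _ _)
  have l2 : C₂ ≤ C := ((le_max_left _ _).trans (le_max_right _ _)).trans (le_max_right _ _)
  have l3 : C₃ ≤ C := ((le_max_right _ _).trans (le_max_right _ _)).trans (le_max_right _ _)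
  have hv' := hv.mono l1
  have hw' := hw.mono l2
  have hle : C ≤ 2 * C + 3 * C * (1 + C) := by nlinarith
  refine ⟨v', w', 2 * C + 3 * C * (1 + C), by positivity, hv'.mono hle, hw'.mono hle, ?_⟩
  rintro s t s' t' ⟨hs, ht⟩ ⟨hs', ht'⟩
  simp only at hs ht hs' ht'
  obtain ⟨Θ₁, m1, e1, b1, c1⟩ := (hv'.isFlowField_t hC hs).exists_transport hT.le hC
    ((hρt s hs).mono l3) (hS.vel_t s hs).1 ht ht'
  obtain ⟨Θ₂, m2, e2, b2, c2⟩ := (hw'.isFlowField_s hC ht').exists_transport zero_le_one hC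
    ((hρs t' ht').mono l3) (hS.vel_s t' ht').1 hs hs'
  set N : ℝ := ‖((s' - s, t' - t) : ℝ × ℝ)‖ with hN
  have hN0 : 0 ≤ N := norm_nonneg _
  have ns : |s' - s| ≤ N := norm_fst_le ((s' - s, t' - t) : ℝ × ℝ)
  have nt : |t' - t| ≤ N := norm_snd_le ((s' - s, t' - t) : ℝ × ℝ)
  have ns2 : (s' - s) ^ 2 ≤ N ^ 2 := sq_le_sq' (by linarith [(abs_le.1 ns).1]) (abs_le.1 ns).2
  have nt2 : (t' - t) ^ 2 ≤ N ^ 2 := sq_le_sq' (by linarith [(abs_le.1 nt).1]) (abs_le.1 nt).2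
  refine ⟨Θ₂ ∘ Θ₁, m2.comp m1, by rw [e2, e1, Measure.map_map m2 m1], fun x => ?_, fun x => ?_⟩
  · calc ‖Θ₂ (Θ₁ x) - x‖ = ‖(Θ₂ (Θ₁ x) - Θ₁ x) + (Θ₁ x - x)‖ := by congr 1; abel
      _ ≤ C * |s' - s| + C * |t' - t| := (norm_add_le _ _).trans (add_le_add (b2 _) (b1 _))
      _ ≤ C * N + C * N := by gcongr
      _ = 2 * C * N := by ring
      _ ≤ _ := by gcongr; nlinarith
  · have h1 : ‖w s t' (Θ₁ x) - w s t x‖ ≤ C * (1 + C) * N := by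
      refine (hw'.lipschitz hC (s := s) (t := t') (s' := s) (t' := t) ⟨hs, ht'⟩ ⟨hs, ht⟩
        (Θ₁ x) x).trans ?_
      have : ‖((s - s, t' - t) : ℝ × ℝ)‖ = |t' - t| := by simp [Prod.norm_def]
      rw [this]
      calc _ ≤ C * (N + C * N) := by
            gcongr
            exact (b1 x).trans (by gcongr)
        _ = _ := by ring
    calc _ = ‖(Θ₂ (Θ₁ x) - Θ₁ x - (s' - s) • w s t' (Θ₁ x)) + (Θ₁ x - x - (t' - t) • v s t x) +
            (s' - s) • (w s t' (Θ₁ x) - w s t x)‖ := by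
          congr 1; simp only [Function.comp]; module
      _ ≤ C * (1 + C) * (s' - s) ^ 2 + C * (1 + C) * (t' - t) ^ 2 +
          |s' - s| * (C * (1 + C) * N) := by
          refine (norm_add₃_le).trans (add_le_add (add_le_add (c2 _) (c1 _)) ?_)
          rw [norm_smul, Real.norm_eq_abs]
          gcongr
      _ ≤ C * (1 + C) * N ^ 2 + C * (1 + C) * N ^ 2 + N * (C * (1 + C) * N) := by gcongr
      _ = 3 * C * (1 + C) * N ^ 2 := by ring
      _ ≤ _ := by gcongr; linarith

namespace IsTransported

variable {T C : ℝ} {S : ℝ → ℝ → WSpace D} {v w : ℝ → ℝ → E D → E D}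

lemma W2_le (hS : IsTransported T S v w C) (hC : 0 ≤ C) {s t s' t' : ℝ} (hp : (s, t) ∈ rect T)
    (hq : (s', t') ∈ rect T) : W2 (S s t) (S s' t') ≤ C * ‖((s' - s, t' - t) : ℝ × ℝ)‖ := by
  obtain ⟨Θ, hm, he, hb, -⟩ := hS s t s' t' hp hq
  exact W2_le_of_dist_le hm he (by positivity) hb

/-- A transported surface is continuous for the topology defined by test functions of quadratic
growth, by dominated convergence. -/
lemma continuousOn (hS : IsTransported T S v w C) (hC : 0 ≤ C) :
    ContinuousOn (fun p : ℝ × ℝ => S p.1 p.2) (rect T) := by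
  rw [continuousOn_iff_continuous_domRestrict]
  refine continuous_iInf_rng.2 fun f => continuous_induced_rng.2 ?_
  obtain ⟨f, hf, A, B, hAB⟩ := f
  rw [continuous_iff_continuousAt]
  intro p
  choose Θ hΘm hΘe hΘb _ using fun q : rect T => hS p.1.1 p.1.2 q.1.1 q.1.2 p.2 q.2
  have e : ∀ q : rect T, ∫ x, f x ∂(S q.1.1 q.1.2).toMeasure =
      ∫ x, f (Θ q x) ∂(S p.1.1 p.1.2).toMeasure := fun q => by
    rw [hΘe q, integral_map (hΘm q).aemeasurable hf.aestronglyMeasurable]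
  have hdist : ∀ q : rect T, ‖((q.1.1 - p.1.1, q.1.2 - p.1.2) : ℝ × ℝ)‖ = dist q p := fun q => by
    rw [Subtype.dist_eq, dist_eq_norm]; rfl
  have e0 : ∀ x, Θ p x = x := fun x => by
    have := hΘb p x
    rw [hdist, dist_self, mul_zero] at this
    exact sub_eq_zero.1 (norm_eq_zero.1 (le_antisymm this (norm_nonneg _)))
  obtain ⟨M, hM⟩ := (isCompact_rect T).isBounded.exists_norm_le
  have hdM : ∀ q : rect T, dist q p ≤ 2 * M := fun q => by
    rw [Subtype.dist_eq, dist_eq_norm]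
    linarith [norm_sub_le q.1 p.1, hM q.1 q.2, hM p.1 p.2]
  have hlim : Tendsto (fun q : rect T => ∫ x, f (Θ q x) ∂(S p.1.1 p.1.2).toMeasure) (𝓝 p)
      (𝓝 (∫ x, f x ∂(S p.1.1 p.1.2).toMeasure)) := by
    refine tendsto_integral_filter_of_dominated_convergence
      (fun x => |A| + |B| * (‖x‖ + C * (2 * M)) ^ 2) ?_ ?_ ?_ ?_
    · exact Eventually.of_forall fun q => (hf.measurable.comp (hΘm q)).aestronglyMeasurable
    · refine Eventually.of_forall fun q => Eventually.of_forall fun x => ?_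
      have h1 : ‖Θ q x‖ ≤ ‖x‖ + C * (2 * M) := by
        have := norm_sub_norm_le (Θ q x) x
        have h2 := hΘb q x
        rw [hdist] at h2
        have h3 : C * dist q p ≤ C * (2 * M) := by gcongr; exact hdM q
        linarith
      calc ‖f (Θ q x)‖ ≤ A + B * ‖Θ q x‖ ^ 2 := hAB _
        _ ≤ |A| + |B| * ‖Θ q x‖ ^ 2 := by gcongr <;> exact le_abs_self _
        _ ≤ _ := by gcongr
    · have h1 : MemLp (fun x : E D => ‖x‖ + C * (2 * M)) 2 (S p.1.1 p.1.2).toMeasure :=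
        (memLp_id _).norm.add (memLp_const _)
      exact (integrable_const _).add (h1.integrable_sq.const_mul _)
    · refine Eventually.of_forall fun x => (hf.tendsto x).comp ?_
      rw [tendsto_iff_norm_sub_tendsto_zero]
      refine squeeze_zero (fun _ => norm_nonneg _) (fun q => (hΘb q x).trans (by rw [hdist])) ?_
      have : Tendsto (fun q : rect T => C * dist q p) (𝓝 p) (𝓝 (C * dist p p)) :=
        ((continuous_id.dist continuous_const).const_mul C).tendsto p
      simpa using this
  have : ContinuousAt (fun q : rect T => ∫ x, f x ∂(S q.1.1 q.1.2).toMeasure) p := by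
    rw [ContinuousAt]
    simp only [e]
    convert hlim using 2
    simp only [e0]
  exact this

lemma isCompact_image (hS : IsTransported T S v w C) (hC : 0 ≤ C) :
    IsCompact ((fun p : ℝ × ℝ => S p.1 p.2) '' rect T) :=
  (isCompact_rect T).image_of_continuousOn (hS.continuousOn hC)

end IsTransported

/-! ### Approximation by test fields -/

/-- A smooth cutoff function, equal to `1` on the unit ball and supported in the ball of radius
`2`. -/
def cutoff (D : ℕ) : ContDiffBump (0 : E D) where
  rIn := 1
  rOut := 2
  rIn_pos := one_pos
  rIn_lt_rOut := by norm_num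

lemma isTest_cutoff (D : ℕ) : IsTest (cutoff D : E D → ℝ) :=
  ⟨(cutoff D).contDiff, (cutoff D).hasCompactSupport⟩

/-- Bounds for the derivatives of the cutoff function. -/
lemma exists_cutoff_bound (D : ℕ) : ∃ G : ℝ, ∀ z : E D, ‖∇ (cutoff D : E D → ℝ) z‖ ≤ G ∧
    ‖z‖ * ‖∇ (cutoff D : E D → ℝ) z‖ ≤ G ∧ ‖z‖ * ‖fderiv ℝ (∇ (cutoff D : E D → ℝ)) z‖ ≤ G := by
  have h1 := (isTest_cutoff D).gradient
  have h2 : Continuous (fderiv ℝ (∇ (cutoff D : E D → ℝ))) := h1.1.continuous_fderiv (by simp)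
  have h3 : HasCompactSupport (fderiv ℝ (∇ (cutoff D : E D → ℝ))) := h1.2.fderiv (𝕜 := ℝ)
  obtain ⟨A, hA⟩ := h1.bounded
  have hc := h1.1.continuous
  obtain ⟨B, hB⟩ := (h1.2.smul_left (f := fun z : E D => ‖z‖)).exists_bound_of_continuous
    (by fun_prop)
  obtain ⟨B', hB'⟩ := (h3.smul_left (f := fun z : E D => ‖z‖)).exists_bound_of_continuous
    (by fun_prop)
  refine ⟨max A (max B B'), fun z => ⟨(hA z).trans (le_max_left _ _), ?_, ?_⟩⟩
  · have := hB z
    simp only [Pi.smul_apply', norm_smul, norm_norm] at this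
    exact this.trans ((le_max_left _ _).trans (le_max_right _ _))
  · have := hB' z
    simp only [Pi.smul_apply', norm_smul, norm_norm] at this
    exact this.trans ((le_max_right _ _).trans (le_max_right _ _))

/-- A constant that controls the cutoff function. -/
def cutoffBound (D : ℕ) : ℝ := (exists_cutoff_bound D).choose

lemma norm_gradient_cutoff_le (z : E D) : ‖∇ (cutoff D : E D → ℝ) z‖ ≤ cutoffBound D :=
  ((exists_cutoff_bound D).choose_spec z).1

lemma norm_mul_norm_gradient_cutoff_le (z : E D) :
    ‖z‖ * ‖∇ (cutoff D : E D → ℝ) z‖ ≤ cutoffBound D :=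
  ((exists_cutoff_bound D).choose_spec z).2.1

lemma norm_mul_norm_fderiv_gradient_cutoff_le (z : E D) :
    ‖z‖ * ‖fderiv ℝ (∇ (cutoff D : E D → ℝ)) z‖ ≤ cutoffBound D :=
  ((exists_cutoff_bound D).choose_spec z).2.2

lemma cutoffBound_nonneg : 0 ≤ cutoffBound D := (norm_nonneg _).trans (norm_gradient_cutoff_le 0)

/-- The integral of `u` along the segment from `0` to `x`; it is the potential of `u` when `u` is
a gradient field. -/
def radialPotential (u : E D → E D) (x : E D) : ℝ := ∫ θ in (0 : ℝ)..1, ⟪u (θ • x), x⟫_ℝ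

lemma continuous_radialPotential {u : E D → E D} (hu : Continuous u) :
    Continuous (radialPotential u) :=
  intervalIntegral.continuous_parametric_intervalIntegral_of_continuous' (by fun_prop) 0 1

lemma abs_radialPotential_le {u : E D → E D} {M : ℝ} (hM : ∀ x, ‖u x‖ ≤ M) (x : E D) :
    |radialPotential u x| ≤ M * ‖x‖ := by
  have := intervalIntegral.norm_integral_le_of_norm_le_const (a := (0 : ℝ)) (b := 1)
    (f := fun θ : ℝ => ⟪u (θ • x), x⟫_ℝ) (C := M * ‖x‖) fun θ _ =>
      (norm_inner_le_norm _ _).trans (by gcongr; exact hM _)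
  simpa [radialPotential] using this

lemma radialPotential_eq {u : E D → E D} {f : E D → ℝ} (hu : Continuous u)
    (hf : ∀ x, HasGradientAt f (u x) x) (x : E D) : radialPotential u x = f x - f 0 := by
  have h1 : ∀ θ ∈ uIcc (0 : ℝ) 1, HasDerivAt (fun θ : ℝ => f (θ • x)) ⟪u (θ • x), x⟫_ℝ θ := by
    intro θ _
    have h2 : HasDerivAt (fun θ : ℝ => θ • x) x θ := by
      simpa using (hasDerivAt_id θ).smul_const x
    have h3 := (hf (θ • x)).hasFDerivAt.comp_hasDerivAt θ h2
    simpa using! h3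
  have := intervalIntegral.integral_eq_sub_of_hasDerivAt h1
    (Continuous.intervalIntegrable (by fun_prop) _ _)
  simpa [radialPotential] using this

lemma radialPotential_add {u k : E D → E D} (hu : Continuous u) (hk : Continuous k) (x : E D) :
    radialPotential (u + k) x = radialPotential u x + radialPotential k x := by
  simp only [radialPotential, Pi.add_apply, inner_add_left]
  exact intervalIntegral.integral_add (Continuous.intervalIntegrable (by fun_prop) _ _)
    (Continuous.intervalIntegrable (by fun_prop) _ _)

lemma radialPotential_smul (c : ℝ) (u : E D → E D) (x : E D) :
    radialPotential (c • u) x = c * radialPotential u x := by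
  simp only [radialPotential, Pi.smul_apply, real_inner_smul_left]
  exact intervalIntegral.integral_const_mul _ _

/-- The truncation of a field at scale `n + 1`: the gradient of `χ f` for a gradient field
`u = ∇f` with `f 0 = 0`, where `χ` is the scaled cutoff function; written so as to be linear in `u`
and to make sense for all fields. -/
def truncField (n : ℕ) (u : E D → E D) (x : E D) : E D :=
  cutoff D (((n : ℝ) + 1)⁻¹ • x) • u x +
    radialPotential u x • (((n : ℝ) + 1)⁻¹ • ∇ (cutoff D : E D → ℝ) (((n : ℝ) + 1)⁻¹ • x))

lemma continuous_truncField (n : ℕ) {u : E D → E D} (hu : Continuous u) :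
    Continuous (truncField n u) := by
  have h1 := (isTest_cutoff D).1.continuous
  have h2 := (isTest_cutoff D).gradient.1.continuous
  have h3 := continuous_radialPotential hu
  unfold truncField
  fun_prop

lemma cutoff_eq_zero {z : E D} (hz : 2 < ‖z‖) : (cutoff D : E D → ℝ) z = 0 :=
  (cutoff D).zero_of_le_dist (by simpa [cutoff] using hz.le)

lemma gradient_cutoff_eq_zero {z : E D} (hz : 2 < ‖z‖) : ∇ (cutoff D : E D → ℝ) z = 0 := by
  have h1 : (cutoff D : E D → ℝ) =ᶠ[𝓝 z] fun _ => 0 := by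
    filter_upwards [(isOpen_lt continuous_const continuous_norm).mem_nhds hz] with y hy
    exact cutoff_eq_zero hy
  simp [_root_.gradient, h1.fderiv_eq]

lemma cutoff_eq_one {z : E D} (hz : ‖z‖ < 1) : (cutoff D : E D → ℝ) z = 1 :=
  (cutoff D).one_of_mem_closedBall (by simpa [cutoff] using hz.le)

lemma gradient_cutoff_eq_zero_of_lt {z : E D} (hz : ‖z‖ < 1) :
    ∇ (cutoff D : E D → ℝ) z = 0 := by
  have h1 : (cutoff D : E D → ℝ) =ᶠ[𝓝 z] fun _ => 1 := by
    filter_upwards [(isOpen_lt continuous_norm continuous_const).mem_nhds hz] with y hy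
    exact cutoff_eq_one hy
  simp [_root_.gradient, h1.fderiv_eq]

lemma norm_inv_smul (n : ℕ) (x : E D) : ‖((n : ℝ) + 1)⁻¹ • x‖ = ((n : ℝ) + 1)⁻¹ * ‖x‖ := by
  rw [norm_smul, Real.norm_of_nonneg (by positivity)]

lemma hasCompactSupport_truncField (n : ℕ) (u : E D → E D) :
    HasCompactSupport (truncField n u) := by
  refine HasCompactSupport.intro (isCompact_closedBall (0 : E D) (2 * (n + 1))) fun x hx => ?_
  have hx' : 2 < ‖((n : ℝ) + 1)⁻¹ • x‖ := by
    rw [norm_inv_smul, inv_mul_eq_div, lt_div_iff₀ (by positivity)]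
    simpa using hx
  simp [truncField, cutoff_eq_zero hx', gradient_cutoff_eq_zero hx']

lemma truncField_eq_self {n : ℕ} (u : E D → E D) {x : E D} (hx : ‖x‖ < n + 1) :
    truncField n u x = u x := by
  have hx' : ‖((n : ℝ) + 1)⁻¹ • x‖ < 1 := by
    rwa [norm_inv_smul, inv_mul_eq_div, div_lt_one (by positivity)]
  simp [truncField, cutoff_eq_one hx', gradient_cutoff_eq_zero_of_lt hx']

/-- Truncation is bounded uniformly in `n`: the potential grows at most linearly, and the gradient
of the cutoff function at scale `n + 1` decays like `1 / ‖x‖`. -/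
lemma norm_truncField_le (n : ℕ) {u : E D → E D} {M : ℝ} (hM : ∀ x, ‖u x‖ ≤ M) (x : E D) :
    ‖truncField n u x‖ ≤ (1 + cutoffBound D) * M := by
  have hM0 : 0 ≤ M := (norm_nonneg _).trans (hM 0)
  set z := ((n : ℝ) + 1)⁻¹ • x with hz
  have h1 : ‖(cutoff D : E D → ℝ) z • u x‖ ≤ M := by
    rw [norm_smul, Real.norm_of_nonneg (cutoff D).nonneg]
    exact (mul_le_of_le_one_left (norm_nonneg _) (cutoff D).le_one).trans (hM x)
  have h2 : ‖radialPotential u x • (((n : ℝ) + 1)⁻¹ • ∇ (cutoff D : E D → ℝ) z)‖ ≤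
      M * cutoffBound D := by
    rw [norm_smul, norm_inv_smul]
    calc _ ≤ M * ‖x‖ * (((n : ℝ) + 1)⁻¹ * ‖∇ (cutoff D : E D → ℝ) z‖) := by
          gcongr
          exact abs_radialPotential_le hM x
      _ = M * (‖z‖ * ‖∇ (cutoff D : E D → ℝ) z‖) := by rw [hz, norm_inv_smul]; ring
      _ ≤ _ := by gcongr; exact norm_mul_norm_gradient_cutoff_le z
  calc _ ≤ _ := norm_add_le _ _
    _ ≤ M + M * cutoffBound D := add_le_add h1 h2
    _ = _ := by ring

lemma truncField_add (n : ℕ) {u k : E D → E D} (hu : Continuous u) (hk : Continuous k) :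
    truncField n (u + k) = truncField n u + truncField n k := by
  funext x
  simp only [truncField, Pi.add_apply, radialPotential_add hu hk]
  module

lemma truncField_smul (n : ℕ) (c : ℝ) (u : E D → E D) :
    truncField n (c • u) = c • truncField n u := by
  funext x
  simp only [truncField, Pi.smul_apply, radialPotential_smul]
  module

/-- The approximation of a field by test fields: truncation followed by mollification. -/
def approx (n : ℕ) (u : E D → E D) : E D → E D := moll n (truncField n u)

lemma isTest_approx (n : ℕ) {u : E D → E D} (hu : Continuous u) : IsTest (approx n u) :=
  isTest_moll n (continuous_truncField n hu) (hasCompactSupport_truncField n u)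

lemma norm_approx_le (n : ℕ) {u : E D → E D} {M : ℝ} (hM : ∀ x, ‖u x‖ ≤ M) (x : E D) :
    ‖approx n u x‖ ≤ (1 + cutoffBound D) * M :=
  norm_moll_le n (norm_truncField_le n hM) x

lemma approx_add (n : ℕ) {u k : E D → E D} (hu : Continuous u) (hk : Continuous k) :
    approx n (u + k) = approx n u + approx n k := by
  rw [approx, truncField_add n hu hk,
    moll_add n (continuous_truncField n hu) (continuous_truncField n hk)]
  rfl

lemma approx_smul (n : ℕ) (c : ℝ) (u : E D → E D) : approx n (c • u) = c • approx n u := by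
  rw [approx, truncField_smul, moll_smul]
  rfl

lemma approx_sub (n : ℕ) {u k : E D → E D} (hu : Continuous u) (hk : Continuous k) :
    approx n (u - k) = approx n u - approx n k := by
  have h := approx_add n hu (k := (-1 : ℝ) • k) (hk.const_smul (-1 : ℝ))
  rw [approx_smul] at h
  simpa [sub_eq_add_neg] using h

/-- Mollifications of functions that agree with `g` on larger and larger balls converge to `g`. -/
lemma tendsto_moll {V : Type*} [NormedAddCommGroup V] [NormedSpace ℝ V] [CompleteSpace V]
    {g : E D → V} {k : ℕ → E D → V} {x : E D} (hg : ContinuousAt g x) (hk : ∀ n, Continuous (k n))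
    (h : ∀ (n : ℕ) y, ‖y‖ < n + 1 → k n y = g y) :
    Tendsto (fun n => moll n (k n) x) atTop (𝓝 (g x)) := by
  rw [Metric.tendsto_atTop]
  intro ε hε
  obtain ⟨δ, hδ, H⟩ := Metric.continuousAt_iff.1 hg (ε / 2) (by positivity)
  obtain ⟨N₁, hN₁⟩ := exists_nat_one_div_lt hδ
  obtain ⟨N₂, hN₂⟩ := exists_nat_gt ‖x‖
  refine ⟨max N₁ N₂, fun n hn => ?_⟩
  have hn1 : (N₁ : ℝ) ≤ n := by exact_mod_cast (le_max_left _ _).trans hn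
  have hn2 : (N₂ : ℝ) ≤ n := by exact_mod_cast (le_max_right _ _).trans hn
  rw [dist_eq_norm]
  refine (norm_moll_sub_le n (hk n) (ε := ε / 2) fun y hy => ?_).trans_lt (by linarith)
  have h1 : ‖y‖ < n + 1 := by
    have h2 : 1 / ((n : ℝ) + 1) ≤ 1 := by
      rw [div_le_one (by positivity)]; linarith [(Nat.cast_nonneg n : (0 : ℝ) ≤ n)]
    have h3 := norm_sub_norm_le y x
    linarith
  rw [h n y h1, ← dist_eq_norm]
  refine (H ?_).le
  rw [dist_eq_norm]
  calc _ < 1 / ((n : ℝ) + 1) := hy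
    _ ≤ 1 / ((N₁ : ℝ) + 1) := by gcongr
    _ < δ := hN₁

lemma tendsto_approx {u : E D → E D} (hu : Continuous u) (x : E D) :
    Tendsto (fun n => approx n u x) atTop (𝓝 (u x)) :=
  tendsto_moll hu.continuousAt (fun n => continuous_truncField n hu)
    fun _ _ hy => truncField_eq_self u hy

lemma moll_clm_comp {V W : Type*} [NormedAddCommGroup V] [NormedSpace ℝ V] [CompleteSpace V]
    [NormedAddCommGroup W] [NormedSpace ℝ W] [CompleteSpace W] (n : ℕ) (A : V →L[ℝ] W)
    {g : E D → V} (hg : Continuous g) (x : E D) : moll n (fun y => A (g y)) x = A (moll n g x) := by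
  rw [moll, moll, ← A.integral_comp_comm (integrable_moll n hg x)]
  simp

section gradient

variable {u : E D → E D} {f : E D → ℝ}

lemma hasFDerivAt_smul_id (r : ℝ) (x : E D) :
    HasFDerivAt (fun x : E D => r • x) (r • ContinuousLinearMap.id ℝ (E D)) x :=
  (r • ContinuousLinearMap.id ℝ (E D)).hasFDerivAt

lemma hasGradientAt_cutoff_smul (n : ℕ) (x : E D) :
    HasGradientAt (fun x => (cutoff D : E D → ℝ) (((n : ℝ) + 1)⁻¹ • x))
      (((n : ℝ) + 1)⁻¹ • ∇ (cutoff D : E D → ℝ) (((n : ℝ) + 1)⁻¹ • x)) x := by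
  have h1 := ((isTest_cutoff D).differentiable (((n : ℝ) + 1)⁻¹ • x)).hasGradientAt.hasFDerivAt
  have h2 := hasFDerivAt_smul_id ((n : ℝ) + 1)⁻¹ x
  rw [hasGradientAt_iff_hasFDerivAt]
  refine (h1.comp x h2).congr_fderiv ?_
  ext y
  simp

/-- Truncated gradient fields are gradients of compactly supported functions, and so are their
mollifications. -/
lemma exists_approx_eq_gradient (n : ℕ) (hu : Continuous u) (hf : ∀ x, HasGradientAt f (u x) x) :
    ∃ φ : E D → ℝ, IsTest φ ∧ ∇ φ = approx n u := by
  set g : E D → ℝ := fun x => (cutoff D : E D → ℝ) (((n : ℝ) + 1)⁻¹ • x) * (f x - f 0) with hg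
  have hgd : ∀ x, HasFDerivAt g (InnerProductSpace.toDual ℝ (E D) (truncField n u x)) x :=
      fun x => by
    have h1 := (hasGradientAt_cutoff_smul n x).hasFDerivAt.mul ((hf x).hasFDerivAt.sub_const (f 0))
    refine h1.congr_fderiv ?_
    rw [truncField, radialPotential_eq hu hf]
    simp only [map_add, map_smul]
  have hgc : Continuous g := continuous_iff_continuousAt.2 fun x => (hgd x).continuousAt
  have hgs : HasCompactSupport g := by
    refine HasCompactSupport.intro (isCompact_closedBall (0 : E D) (2 * (n + 1))) fun x hx => ?_
    have hx' : 2 < ‖((n : ℝ) + 1)⁻¹ • x‖ := by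
      rw [norm_inv_smul, inv_mul_eq_div, lt_div_iff₀ (by positivity)]
      simpa using hx
    simp [hg, cutoff_eq_zero hx']
  refine ⟨moll n g, isTest_moll n hgc hgs, ?_⟩
  funext x
  have hc := continuous_truncField n hu
  have h := hasFDerivAt_moll n hgs hgd ((InnerProductSpace.toDual ℝ (E D)).continuous.comp hc) x
  have e : moll n (fun x => InnerProductSpace.toDual ℝ (E D) (truncField n u x)) x =
      InnerProductSpace.toDual ℝ (E D) (approx n u x) := by
    ext y
    have h1 := moll_clm_comp n (ContinuousLinearMap.apply ℝ ℝ y)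
      ((InnerProductSpace.toDual ℝ (E D)).continuous.comp hc) x
    have h2 := moll_clm_comp n (innerSL ℝ y) hc x
    rw [InnerProductSpace.toDual_apply_apply, real_inner_comm]
    refine Eq.trans h1.symm (Eq.trans ?_ h2)
    congr 1
    funext z
    exact real_inner_comm y (truncField n u z)
  rw [e] at h
  exact (hasGradientAt_iff_hasFDerivAt.2 h).gradient

variable {u' : E D → E D →L[ℝ] E D} {M L : ℝ}

/-- Truncation of a `C¹` gradient field with bounded derivative gives `C¹` fields with derivatives
bounded uniformly in `n`; again the linear growth of the potential is compensated by the decay of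
the second derivatives of the cutoff function. -/
lemma exists_hasFDerivAt_truncField (n : ℕ) (hf : ∀ x, HasGradientAt f (u x) x)
    (hd : ∀ x, HasFDerivAt u (u' x) x) (hu' : Continuous u') (hM : ∀ x, ‖u x‖ ≤ M)
    (hL : ∀ x, ‖u' x‖ ≤ L) : ∃ U : E D → E D →L[ℝ] E D, Continuous U ∧
      (∀ x, HasFDerivAt (truncField n u) (U x) x) ∧
      ∀ x, ‖U x‖ ≤ (1 + 3 * cutoffBound D) * (M + L) := by
  have hM0 : 0 ≤ M := (norm_nonneg _).trans (hM 0)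
  have hL0 : 0 ≤ L := (norm_nonneg _).trans (hL 0)
  have hG := cutoffBound_nonneg (D := D)
  have huc : Continuous u := continuous_iff_continuousAt.2 fun x => (hd x).continuousAt
  have hpot : radialPotential u = fun x => f x - f 0 := funext (radialPotential_eq huc hf)
  have hpd : ∀ x, HasFDerivAt (radialPotential u) (InnerProductSpace.toDual ℝ (E D) (u x)) x :=
    fun x => by rw [hpot]; exact (hf x).hasFDerivAt.sub_const _
  set r : ℝ := ((n : ℝ) + 1)⁻¹ with hr
  have hr0 : 0 < r := by positivity
  have hr1 : r ≤ 1 := inv_le_one_of_one_le₀ (by linarith [(Nat.cast_nonneg n : (0 : ℝ) ≤ n)])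
  set χ : E D → ℝ := ⇑(cutoff D) with hχ
  have hgd : ∀ x, HasFDerivAt (fun x => r • ∇ χ (r • x)) (r • r • fderiv ℝ (∇ χ) (r • x)) x :=
    fun x => by
      have h1 := ((isTest_cutoff D).gradient.differentiable (r • x)).hasFDerivAt
      have h2 := hasFDerivAt_smul_id r x
      refine ((h1.comp x h2).const_smul r).congr_fderiv ?_
      rw [ContinuousLinearMap.comp_smul, ContinuousLinearMap.comp_id]
  have hcd := fun x => (hasGradientAt_cutoff_smul (D := D) n x).hasFDerivAt
  have hc0 := (isTest_cutoff D).1.continuous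
  have hc1 := (isTest_cutoff D).gradient.1.continuous
  have hc2 : Continuous (fderiv ℝ (∇ χ)) :=
    (isTest_cutoff D).gradient.1.continuous_fderiv (by simp)
  have hc3 := continuous_radialPotential huc
  refine ⟨fun x => (χ (r • x) • u' x +
      (InnerProductSpace.toDual ℝ (E D) (r • ∇ χ (r • x))).smulRight (u x)) +
      (radialPotential u x • r • r • fderiv ℝ (∇ χ) (r • x) +
      (InnerProductSpace.toDual ℝ (E D) (u x)).smulRight (r • ∇ χ (r • x))), ?_,
    fun x => ((hcd x).smul (hd x)).add ((hpd x).smul (hgd x)), fun x => ?_⟩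
  · have e : ∀ (a b : E D → E D), Continuous a → Continuous b → Continuous fun x =>
        (InnerProductSpace.toDual ℝ (E D) (a x)).smulRight (b x) := fun a b ha hb => by
      have : Continuous fun x => ContinuousLinearMap.smulRightL ℝ (E D) (E D)
          (InnerProductSpace.toDual ℝ (E D) (a x)) (b x) := by
        have h1 := (InnerProductSpace.toDual ℝ (E D)).continuous
        fun_prop
      exact this
    have e1 := e (fun x => r • ∇ χ (r • x)) u (by fun_prop) huc
    have e2 := e u (fun x => r • ∇ χ (r • x)) huc (by fun_prop)
    fun_prop
  · have hg1 : ‖r • ∇ χ (r • x)‖ ≤ cutoffBound D := by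
      rw [norm_smul, Real.norm_of_nonneg hr0.le]
      exact (mul_le_of_le_one_left (norm_nonneg _) hr1).trans (norm_gradient_cutoff_le _)
    have t1 : ‖χ (r • x) • u' x‖ ≤ L := by
      rw [norm_smul, Real.norm_of_nonneg (cutoff D).nonneg]
      exact (mul_le_of_le_one_left (norm_nonneg _) (cutoff D).le_one).trans (hL x)
    have t2 : ‖(InnerProductSpace.toDual ℝ (E D) (r • ∇ χ (r • x))).smulRight (u x)‖ ≤
        cutoffBound D * M := by
      rw [ContinuousLinearMap.norm_smulRight_apply, LinearIsometryEquiv.norm_map]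
      gcongr
      exact hM x
    have t3 : ‖(InnerProductSpace.toDual ℝ (E D) (u x)).smulRight (r • ∇ χ (r • x))‖ ≤
        M * cutoffBound D := by
      rw [ContinuousLinearMap.norm_smulRight_apply, LinearIsometryEquiv.norm_map]
      gcongr
      exact hM x
    have t4 : ‖radialPotential u x • r • r • fderiv ℝ (∇ χ) (r • x)‖ ≤ M * cutoffBound D := by
      rw [norm_smul, norm_smul, norm_smul, Real.norm_of_nonneg hr0.le]
      calc _ ≤ M * ‖x‖ * (r * (r * ‖fderiv ℝ (∇ χ) (r • x)‖)) := by
            gcongr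
            exact abs_radialPotential_le hM x
        _ = M * (r * (‖r • x‖ * ‖fderiv ℝ (∇ χ) (r • x)‖)) := by
            rw [norm_smul, Real.norm_of_nonneg hr0.le]; ring
        _ ≤ M * (1 * cutoffBound D) := by
            gcongr
            exact norm_mul_norm_fderiv_gradient_cutoff_le _
        _ = _ := by ring
    calc _ ≤ (L + cutoffBound D * M) + (M * cutoffBound D + M * cutoffBound D) :=
          (norm_add_le _ _).trans (add_le_add ((norm_add_le _ _).trans (add_le_add t1 t2))
            ((norm_add_le _ _).trans (add_le_add t4 t3)))
      _ ≤ _ := by nlinarith [mul_nonneg hG hL0]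

/-- The approximations of a gradient field of class `C¹` with bounded derivative converge together
with their derivatives, with uniform bounds. -/
lemma fderiv_approx (hf : ∀ x, HasGradientAt f (u x) x)
    (hd : ∀ x, HasFDerivAt u (u' x) x) (hu' : Continuous u') (hM : ∀ x, ‖u x‖ ≤ M)
    (hL : ∀ x, ‖u' x‖ ≤ L) :
    (∀ n x, ‖fderiv ℝ (approx n u) x‖ ≤ (1 + 3 * cutoffBound D) * (M + L)) ∧
      ∀ x, Tendsto (fun n => fderiv ℝ (approx n u) x) atTop (𝓝 (u' x)) := by
  choose U hUc hUd hUb using fun n => exists_hasFDerivAt_truncField n hf hd hu' hM hL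
  have e : ∀ n x, fderiv ℝ (approx n u) x = moll n (U n) x := fun n x =>
    (hasFDerivAt_moll n (hasCompactSupport_truncField n u) (hUd n) (hUc n) x).fderiv
  refine ⟨fun n x => by rw [e]; exact norm_moll_le n (hUb n) x, fun x => ?_⟩
  simp only [e]
  refine tendsto_moll hu'.continuousAt hUc fun n y hy => ?_
  have h1 : truncField n u =ᶠ[𝓝 y] u := by
    filter_upwards [(isOpen_lt continuous_norm continuous_const).mem_nhds hy] with z hz
    exact truncField_eq_self u hz
  exact ((hUd n y).congr_of_eventuallyEq h1.symm).unique (hd y)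

end gradient

/-- Dominated convergence in `L²(μ)`. -/
lemma tendsto_toL2 (μ : WSpace D) {X : ℕ → E D → E D} {Y : E D → E D} {M : ℝ}
    (hX : ∀ n, Continuous (X n)) (hY : Continuous Y) (hXM : ∀ n x, ‖X n x‖ ≤ M)
    (h : ∀ x, Tendsto (fun n => X n x) atTop (𝓝 (Y x))) :
    Tendsto (fun n => toL2 μ (X n)) atTop (𝓝 (toL2 μ Y)) := by
  have hYM : ∀ x, ‖Y x‖ ≤ M := fun x => le_of_tendsto' (h x).norm fun n => hXM n x
  have mX : ∀ n, MemLp (X n) 2 μ.toMeasure := fun n =>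
    MemLp.of_bound (hX n).aestronglyMeasurable M (Eventually.of_forall (hXM n))
  have mY : MemLp Y 2 μ.toMeasure :=
    MemLp.of_bound hY.aestronglyMeasurable M (Eventually.of_forall hYM)
  have h1 : Tendsto (fun n => ∫ x, ‖(X n - Y) x‖ ^ 2 ∂μ.toMeasure) atTop
      (𝓝 (∫ _, (0 : ℝ) ∂μ.toMeasure)) := by
    refine tendsto_integral_of_dominated_convergence (fun _ => (M + M) ^ 2)
      (fun n => (((hX n).sub hY).norm.pow 2).aestronglyMeasurable) (integrable_const _)
      (fun n => Eventually.of_forall fun x => ?_) (Eventually.of_forall fun x => ?_)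
    · rw [Real.norm_of_nonneg (by positivity)]
      exact pow_le_pow_left₀ (norm_nonneg _)
        ((norm_sub_le _ _).trans (add_le_add (hXM n x) (hYM x))) 2
    · have := (tendsto_iff_norm_sub_tendsto_zero.1 (h x)).pow 2
      simpa using this
  rw [integral_zero] at h1
  rw [tendsto_iff_norm_sub_tendsto_zero]
  have h2 : ∀ n, ‖toL2 μ (X n) - toL2 μ Y‖ = √(∫ x, ‖(X n - Y) x‖ ^ 2 ∂μ.toMeasure) := fun n => by
    rw [← toL2_sub μ (mX n) mY, ← norm_toL2_sq μ ((mX n).sub mY), Real.sqrt_sq (norm_nonneg _)]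
  simp only [h2]
  simpa using h1.sqrt

lemma tendsto_toL2_approx (μ : WSpace D) {u : E D → E D} (hu : Continuous u) {M : ℝ}
    (hM : ∀ x, ‖u x‖ ≤ M) :
    Tendsto (fun n => toL2 μ (approx n u)) atTop (𝓝 (toL2 μ u)) :=
  tendsto_toL2 μ (fun n => (isTest_approx n hu).1.continuous) hu
    (fun n => norm_approx_le n hM) (tendsto_approx hu)

/-- Bounded continuous gradient fields are tangent at every measure. -/
lemma toL2_mem_tangentSpace (μ : WSpace D) {u : E D → E D} {f : E D → ℝ} (hu : Continuous u)
    {M : ℝ} (hM : ∀ x, ‖u x‖ ≤ M) (hf : ∀ x, HasGradientAt f (u x) x) :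
    toL2 μ u ∈ tangentSpace μ := by
  refine (Submodule.isClosed_topologicalClosure _).mem_of_tendsto (tendsto_toL2_approx μ hu hM)
    (Eventually.of_forall fun n => ?_)
  obtain ⟨φ, hφ, he⟩ := exists_approx_eq_gradient n hu hf
  rw [← he]
  exact hφ.toL2_gradient_mem μ

/-! ### Commutation of the derivatives along a surface -/

namespace IsC11Field

variable {T C : ℝ} {v : ℝ → ℝ → E D → E D} {v' : ℝ × ℝ × E D → ℝ × ℝ × E D →L[ℝ] E D}

lemma continuous_fderiv (hv : IsC11Field T v v' C) (hC : 0 ≤ C) {s t : ℝ}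
    (hp : (s, t) ∈ rect T) : Continuous fun x => v' (s, t, x) :=
  continuous_of_norm_sub_le (L := C) fun x y => by
    simpa using hv.fderiv_lipschitz hC hp hp x y

end IsC11Field

namespace IsTransported

variable {T C : ℝ} {S : ℝ → ℝ → WSpace D} {v w : ℝ → ℝ → E D → E D}

/-- Differentiation of `∫ k_{(s,t)} dS(s,t)`, where `k` has a first order expansion with derivative
`K` at the point `(s, t)`. -/
lemma hasFDerivAt_integral (hS : IsTransported T S v w C) {s t : ℝ}
    (hp : (s, t) ∈ interior (rect T)) {k : ℝ → ℝ → E D → ℝ} {K : E D → ℝ × ℝ × E D →L[ℝ] ℝ} {N : ℝ}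
    (hk : ∀ s t, (s, t) ∈ rect T → Continuous (k s t))
    (hkN : ∀ s t, (s, t) ∈ rect T → ∀ x, |k s t x| ≤ N)
    (hKN : ∀ x, ‖K x‖ ≤ N)
    (hKw : Integrable (fun x => K x (1, 0, w s t x)) (S s t).toMeasure)
    (hKv : Integrable (fun x => K x (0, 1, v s t x)) (S s t).toMeasure)
    (hexp : ∀ s' t', (s', t') ∈ rect T → ∀ x y,
      |k s' t' y - k s t x - K x (s' - s, t' - t, y - x)| ≤
        N * (‖((s' - s, t' - t) : ℝ × ℝ)‖ + ‖y - x‖) ^ 2) :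
    HasFDerivAt (fun q : ℝ × ℝ => ∫ x, k q.1 q.2 x ∂(S q.1 q.2).toMeasure)
      ((∫ x, K x (1, 0, w s t x) ∂(S s t).toMeasure) • ContinuousLinearMap.fst ℝ ℝ ℝ +
        (∫ x, K x (0, 1, v s t x) ∂(S s t).toMeasure) • ContinuousLinearMap.snd ℝ ℝ ℝ) (s, t) := by
  have hpr : (s, t) ∈ rect T := interior_subset hp
  have hN : 0 ≤ N := (norm_nonneg _).trans (hKN 0)
  refine HasFDerivAt.of_isLittleO (Asymptotics.IsBigO.trans_isLittleO
    (g := fun q : ℝ × ℝ => ‖q - (s, t)‖ ^ 2)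
    (Asymptotics.IsBigO.of_bound (N * (1 + C) ^ 2 + N * C) ?_) ?_)
  · filter_upwards [mem_interior_iff_mem_nhds.1 hp] with q hq
    obtain ⟨s', t'⟩ := q
    obtain ⟨Θ, hΘm, hΘe, hb, hc⟩ := hS s t s' t' hpr hq
    rw [norm_pow, norm_norm]
    change |∫ x, k s' t' x ∂(S s' t').toMeasure - ∫ x, k s t x ∂(S s t).toMeasure -
      ((∫ x, K x (1, 0, w s t x) ∂(S s t).toMeasure) * (s' - s) +
        (∫ x, K x (0, 1, v s t x) ∂(S s t).toMeasure) * (t' - t))| ≤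
      (N * (1 + C) ^ 2 + N * C) * ‖((s' - s, t' - t) : ℝ × ℝ)‖ ^ 2
    set δ : ℝ := ‖((s' - s, t' - t) : ℝ × ℝ)‖ with hδ
    have hδ0 : 0 ≤ δ := norm_nonneg _
    have hi1 : Integrable (fun x => k s' t' (Θ x)) (S s t).toMeasure :=
      integrable_of_forall_norm_le ((hk s' t' hq).measurable.comp hΘm).aestronglyMeasurable
        fun x => hkN s' t' hq _
    have hi2 : Integrable (fun x => k s t x) (S s t).toMeasure :=
      integrable_of_forall_norm_le (hk s t hpr).aestronglyMeasurable fun x => hkN s t hpr _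
    have hi3 : Integrable (fun x => K x (1, 0, w s t x) * (s' - s) +
        K x (0, 1, v s t x) * (t' - t)) (S s t).toMeasure :=
      (hKw.mul_const (s' - s)).add (hKv.mul_const (t' - t))
    rw [hΘe, integral_map hΘm.aemeasurable (hk s' t' hq).aestronglyMeasurable, sub_sub,
      ← integral_mul_const, ← integral_mul_const, ← integral_add (hKw.mul_const _)
        (hKv.mul_const _), ← integral_add hi2 hi3]
    refine abs_integral_sub_le_of_forall hi1 (hi2.add hi3) fun x => ?_
    have h1 := hexp s' t' hq x (Θ x)
    have h2 : (N * (δ + ‖Θ x - x‖) ^ 2) ≤ N * (1 + C) ^ 2 * δ ^ 2 := by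
      calc _ ≤ N * (δ + C * δ) ^ 2 := by gcongr; exact hb x
        _ = _ := by ring
    have h3 : |K x (0, 0, Θ x - x - ((s' - s) • w s t x + (t' - t) • v s t x))| ≤
        N * C * δ ^ 2 := by
      rw [mul_assoc]
      refine ContinuousLinearMap.le_of_opNorm_le_of_le _ (hKN x) ?_
      rw [Prod.norm_def, Prod.norm_def]
      simpa using hc x
    have e : K x (s' - s, t' - t, Θ x - x) = K x (1, 0, w s t x) * (s' - s) +
        K x (0, 1, v s t x) * (t' - t) +
        K x (0, 0, Θ x - x - ((s' - s) • w s t x + (t' - t) • v s t x)) := by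
      rw [mul_comm _ (s' - s), mul_comm _ (t' - t), ← smul_eq_mul, ← smul_eq_mul, ← map_smul,
        ← map_smul, ← map_add, ← map_add]
      congr 1
      simp only [Prod.smul_mk, Prod.mk_add_mk, smul_eq_mul]
      refine Prod.ext (by simp) (Prod.ext (by simp) ?_)
      simp
    rw [e] at h1
    simp only [Pi.add_apply]
    rw [abs_le] at h1 h3 ⊢
    constructor <;> linarith [h1.1, h1.2, h3.1, h3.2]
  · refine Asymptotics.IsLittleO.of_norm_right ?_
    refine Asymptotics.isLittleO_iff.2 fun c hc => ?_
    have h0 : Tendsto (fun q : ℝ × ℝ => ‖q - (s, t)‖) (𝓝 (s, t)) (𝓝 0) := by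
      have : Continuous fun q : ℝ × ℝ => ‖q - (s, t)‖ := by fun_prop
      simpa using this.tendsto (s, t)
    filter_upwards [h0.eventually (gt_mem_nhds hc)] with q hq
    rw [norm_pow, norm_norm, sq]
    exact mul_le_mul_of_nonneg_right hq.le (norm_nonneg _)

variable {v' w' : ℝ × ℝ × E D → ℝ × ℝ × E D →L[ℝ] E D}

/-- The derivative of `∫ ⟨∇φ, u⟩ dS`. -/
lemma hasFDerivAt_integral_fderiv (hS : IsTransported T S v w C) (hC : 0 ≤ C)
    (hv : IsC11Field T v v' C) (hw : IsC11Field T w w' C) {u : ℝ → ℝ → E D → E D}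
    {u' : ℝ × ℝ × E D → ℝ × ℝ × E D →L[ℝ] E D} (hu : IsC11Field T u u' C) {φ : E D → ℝ}
    (hφ : IsTest φ) {s t : ℝ} (hp : (s, t) ∈ interior (rect T)) :
    HasFDerivAt (fun q : ℝ × ℝ => ∫ x, fderiv ℝ φ x (u q.1 q.2 x) ∂(S q.1 q.2).toMeasure)
      ((∫ x, (fderiv ℝ (fderiv ℝ φ) x (w s t x) (u s t x) +
          fderiv ℝ φ x (u' (s, t, x) (1, 0, w s t x))) ∂(S s t).toMeasure) •
        ContinuousLinearMap.fst ℝ ℝ ℝ +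
      (∫ x, (fderiv ℝ (fderiv ℝ φ) x (v s t x) (u s t x) +
          fderiv ℝ φ x (u' (s, t, x) (0, 1, v s t x))) ∂(S s t).toMeasure) •
        ContinuousLinearMap.snd ℝ ℝ ℝ) (s, t) := by
  have hpr : (s, t) ∈ rect T := interior_subset hp
  have hφ1 : IsTest (fderiv ℝ φ) := ⟨hφ.1.fderiv_right (by simp), hφ.2.fderiv (𝕜 := ℝ)⟩
  have hφ2 : IsTest (fderiv ℝ (fderiv ℝ φ)) := ⟨hφ1.1.fderiv_right (by simp), hφ1.2.fderiv (𝕜 := ℝ)⟩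
  obtain ⟨N₁, hN₁⟩ := hφ1.bounded
  obtain ⟨N₂, hN₂⟩ := hφ2.bounded
  obtain ⟨N₃, hN₃⟩ := hφ2.1.lipschitzWith_of_hasCompactSupport hφ2.2 (by simp)
  set N : ℝ := max N₁ (max N₂ N₃) with hN
  have b1 : ∀ x, ‖fderiv ℝ φ x‖ ≤ N := fun x => (hN₁ x).trans (le_max_left _ _)
  have b2 : ∀ x, ‖fderiv ℝ (fderiv ℝ φ) x‖ ≤ N := fun x =>
    (hN₂ x).trans ((le_max_left _ _).trans (le_max_right _ _))
  have hN0 : 0 ≤ N := (norm_nonneg _).trans (b1 0)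
  have b3 : ∀ x y, ‖fderiv ℝ (fderiv ℝ φ) x - fderiv ℝ (fderiv ℝ φ) y‖ ≤ N * ‖x - y‖ :=
      fun x y => by
    have h1 : ‖fderiv ℝ (fderiv ℝ φ) x - fderiv ℝ (fderiv ℝ φ) y‖ ≤ N₃ * ‖x - y‖ := by
      simpa [dist_eq_norm] using! hN₃.dist_le_mul x y
    exact h1.trans (by gcongr; exact (le_max_right _ _).trans (le_max_right _ _))
  have l1 : ∀ x y, ‖fderiv ℝ φ y - fderiv ℝ φ x‖ ≤ N * ‖y - x‖ := fun x y =>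
    convex_univ.norm_image_sub_le_of_norm_hasFDerivWithin_le
      (fun z _ => (hφ1.differentiable z).hasFDerivAt.hasFDerivWithinAt) (fun z _ => b2 z)
      (mem_univ x) (mem_univ y)
  have l2 : ∀ x y, ‖fderiv ℝ φ y - fderiv ℝ φ x - fderiv ℝ (fderiv ℝ φ) x (y - x)‖ ≤
      N * ‖y - x‖ ^ 2 := fun x y =>
    norm_sub_sub_le_of_lipschitz_fderiv convex_univ
      (fun z _ => (hφ1.differentiable z).hasFDerivAt.hasFDerivWithinAt)
      (fun z _ z' _ => b3 z z') hN0 (mem_univ x) (mem_univ y)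
  have c1 := hφ1.1.continuous
  have c2 := hφ2.1.continuous
  have cu := hu.continuous_space hpr
  have cu' := hu.continuous_fderiv hC hpr
  have cv := hv.continuous_space hpr
  have cw := hw.continuous_space hpr
  set K : E D → ℝ × ℝ × E D →L[ℝ] ℝ := fun x =>
    ((fderiv ℝ (fderiv ℝ φ) x).flip (u s t x)).comp ((ContinuousLinearMap.snd ℝ ℝ (E D)).comp
      (ContinuousLinearMap.snd ℝ ℝ (ℝ × E D))) + (fderiv ℝ φ x).comp (u' (s, t, x)) with hK
  have hKa : ∀ x z, K x z = fderiv ℝ (fderiv ℝ φ) x z.2.2 (u s t x) +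
      fderiv ℝ φ x (u' (s, t, x) z) := fun x z => rfl
  have hKN : ∀ x, ‖K x‖ ≤ N * C + N * C := fun x => by
    refine ContinuousLinearMap.opNorm_le_bound _ (by positivity) fun z => ?_
    have hz : ‖z.2.2‖ ≤ ‖z‖ := (norm_snd_le _).trans (norm_snd_le _)
    rw [hKa]
    calc _ ≤ N * ‖z‖ * C + N * (C * ‖z‖) := by
          refine (norm_add_le _ _).trans (add_le_add ?_ ?_)
          · exact ContinuousLinearMap.le_of_opNorm_le_of_le _
              (ContinuousLinearMap.le_of_opNorm_le_of_le _ (b2 x) hz) (hu.norm_le hpr x)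
          · exact ContinuousLinearMap.le_of_opNorm_le_of_le _ (b1 x)
              (ContinuousLinearMap.le_of_opNorm_le _ (hu.norm_fderiv_le hpr x) z)
      _ = _ := by ring
  have hle1 : N * C + N * C ≤ 3 * (N * C) := by
    have := mul_nonneg hN0 hC
    linarith
  have hint : ∀ (z : E D → ℝ × ℝ × E D), Continuous z → (∀ x, ‖z x‖ ≤ 1 + C) →
      Integrable (fun x => K x (z x)) (S s t).toMeasure := fun z hz hzb => by
    refine integrable_of_forall_norm_le (B := (N * C + N * C) * (1 + C)) ?_
      fun x => ContinuousLinearMap.le_of_opNorm_le_of_le _ (hKN x) (hzb x)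
    simp only [hKa]
    exact (((c2.clm_apply hz.snd.snd).clm_apply cu).add
      (c1.clm_apply (cu'.clm_apply hz))).aestronglyMeasurable
  refine hS.hasFDerivAt_integral hp (k := fun s t x => fderiv ℝ φ x (u s t x)) (K := K)
    (N := 3 * (N * C)) (fun s t h => ?_) (fun s t h x => ?_) (fun x => (hKN x).trans hle1) ?_ ?_ ?_
  · exact c1.clm_apply (hu.continuous_space h)
  · refine (ContinuousLinearMap.le_of_opNorm_le_of_le _ (b1 x) (hu.norm_le h x)).trans ?_
    have := mul_nonneg hN0 hC
    linarith
  · refine hint _ (by fun_prop) fun x => ?_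
    refine (norm_triple_le _ _ _).trans (add_le_add ?_ (hw.norm_le hpr x))
    simp [Prod.norm_def]
  · refine hint _ (by fun_prop) fun x => ?_
    refine (norm_triple_le _ _ _).trans (add_le_add ?_ (hv.norm_le hpr x))
    simp [Prod.norm_def]
  · intro s' t' hq x y
    set δ : ℝ := ‖((s' - s, t' - t) : ℝ × ℝ)‖ with hδ
    have hδ0 : 0 ≤ δ := norm_nonneg _
    set z : ℝ × ℝ × E D := (s' - s, t' - t, y - x) with hz
    have hzn : ‖z‖ ≤ δ + ‖y - x‖ := norm_triple_le _ _ _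
    have e : fderiv ℝ φ y (u s' t' y) - fderiv ℝ φ x (u s t x) - K x z =
        fderiv ℝ φ y (u s' t' y - u s t x - u' (s, t, x) z) +
        (fderiv ℝ φ y - fderiv ℝ φ x) (u' (s, t, x) z) +
        (fderiv ℝ φ y - fderiv ℝ φ x - fderiv ℝ (fderiv ℝ φ) x (y - x)) (u s t x) := by
      simp only [hKa, hz, map_sub, sub_apply]
      ring
    rw [e]
    have hle : ‖y - x‖ ≤ δ + ‖y - x‖ := le_add_of_nonneg_left hδ0
    have t1 := ContinuousLinearMap.le_of_opNorm_le_of_le _ (b1 y) (hu.taylor hC hpr hq x y)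
    have t2 := ContinuousLinearMap.le_of_opNorm_le_of_le _ ((l1 x y).trans
      (mul_le_mul_of_nonneg_left hle hN0))
      (ContinuousLinearMap.le_of_opNorm_le_of_le _ (hu.norm_fderiv_le hpr x) hzn)
    have t3 := ContinuousLinearMap.le_of_opNorm_le_of_le _ ((l2 x y).trans
      (mul_le_mul_of_nonneg_left (pow_le_pow_left₀ (norm_nonneg _) hle 2) hN0)) (hu.norm_le hpr x)
    rw [← Real.norm_eq_abs]
    refine norm_add₃_le.trans ((add_le_add (add_le_add t1 t2) t3).trans (le_of_eq ?_))
    ring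

/-- The velocities `w` and `v` of a surface commute: the field
`∂_s v + ∇v · w - ∂_t w - ∇w · v` is orthogonal to all gradients. This is the symmetry of the second
derivative of `(s, t) ↦ ∫ φ dS(s, t)`, in which the terms with `D²φ` cancel. -/
theorem integral_commutator (hS : IsTransported T S v w C) (hC : 0 ≤ C)
    (hv : IsC11Field T v v' C) (hw : IsC11Field T w w' C) {φ : E D → ℝ}
    (hφ : IsTest φ) {s t : ℝ} (hp : (s, t) ∈ interior (rect T)) :
    ∫ x, fderiv ℝ φ x (v' (s, t, x) (1, 0, w s t x) - w' (s, t, x) (0, 1, v s t x))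
      ∂(S s t).toMeasure = 0 := by
  have hpr : (s, t) ∈ rect T := interior_subset hp
  have hφ1 : IsTest (fderiv ℝ φ) := ⟨hφ.1.fderiv_right (by simp), hφ.2.fderiv (𝕜 := ℝ)⟩
  have hφ2 : IsTest (fderiv ℝ (fderiv ℝ φ)) := ⟨hφ1.1.fderiv_right (by simp), hφ1.2.fderiv (𝕜 := ℝ)⟩
  obtain ⟨N₁, hN₁⟩ := hφ1.bounded
  obtain ⟨N₂, hN₂⟩ := hφ2.bounded
  obtain ⟨N₀, hN₀⟩ := hφ.bounded
  have hN1 : 0 ≤ N₁ := (norm_nonneg (fderiv ℝ φ 0)).trans (hN₁ 0)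
  have hN2 : 0 ≤ N₂ := (norm_nonneg (fderiv ℝ (fderiv ℝ φ) 0)).trans (hN₂ 0)
  have c1 := hφ1.1.continuous
  have c2 := hφ2.1.continuous
  -- the first derivative of `∫ φ dS`
  have h1 : ∀ᶠ q : ℝ × ℝ in 𝓝 (s, t), HasFDerivAt
      (fun q : ℝ × ℝ => ∫ x, φ x ∂(S q.1 q.2).toMeasure)
      ((∫ x, fderiv ℝ φ x (w q.1 q.2 x) ∂(S q.1 q.2).toMeasure) • ContinuousLinearMap.fst ℝ ℝ ℝ +
        (∫ x, fderiv ℝ φ x (v q.1 q.2 x) ∂(S q.1 q.2).toMeasure) •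
          ContinuousLinearMap.snd ℝ ℝ ℝ) q := by
    filter_upwards [isOpen_interior.mem_nhds hp] with q hq
    obtain ⟨a, b⟩ := q
    have hqr : (a, b) ∈ rect T := interior_subset hq
    have cv := hv.continuous_space hqr
    have cw := hw.continuous_space hqr
    refine hS.hasFDerivAt_integral hq (k := fun _ _ x => φ x)
      (K := fun x => (fderiv ℝ φ x).comp ((ContinuousLinearMap.snd ℝ ℝ (E D)).comp
        (ContinuousLinearMap.snd ℝ ℝ (ℝ × E D)))) (N := max N₀ (max N₁ N₂))
      (fun _ _ _ => hφ.1.continuous) (fun _ _ _ x => (hN₀ x).trans (le_max_left _ _))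
      (fun x => ?_) ?_ ?_ fun s' t' _ x y => ?_
    · refine ((ContinuousLinearMap.opNorm_le_bound _ hN1 fun z => ?_)).trans
        ((le_max_left _ _).trans (le_max_right _ _))
      exact ContinuousLinearMap.le_of_opNorm_le_of_le (fderiv ℝ φ x) (hN₁ x)
        ((norm_snd_le _).trans (norm_snd_le _))
    · exact integrable_of_forall_norm_le (c1.clm_apply cw).aestronglyMeasurable
        fun x => ContinuousLinearMap.le_of_opNorm_le_of_le (fderiv ℝ φ x) (hN₁ x) (hw.norm_le hqr x)
    · exact integrable_of_forall_norm_le (c1.clm_apply cv).aestronglyMeasurable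
        fun x => ContinuousLinearMap.le_of_opNorm_le_of_le (fderiv ℝ φ x) (hN₁ x) (hv.norm_le hqr x)
    · have l1 : ∀ x y, ‖fderiv ℝ φ x - fderiv ℝ φ y‖ ≤ N₂ * ‖x - y‖ := fun x y =>
        convex_univ.norm_image_sub_le_of_norm_hasFDerivWithin_le
          (fun z _ => (hφ1.differentiable z).hasFDerivAt.hasFDerivWithinAt) (fun z _ => hN₂ z)
          (mem_univ y) (mem_univ x)
      have := norm_sub_sub_le_of_lipschitz_fderiv convex_univ
        (fun z _ => (hφ.differentiable z).hasFDerivAt.hasFDerivWithinAt)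
        (fun z _ z' _ => l1 z z') hN2 (mem_univ x) (mem_univ y)
      refine LE.le.trans this ?_
      gcongr
      · exact (le_max_right _ _).trans (le_max_right _ _)
      · exact le_add_of_nonneg_left (norm_nonneg _)
  have cv := hv.continuous_space hpr
  have cw := hw.continuous_space hpr
  have cv' := hv.continuous_fderiv hC hpr
  have cw' := hw.continuous_fderiv hC hpr
  have hA := hS.hasFDerivAt_integral_fderiv hC hv hw hw hφ hp
  have hB := hS.hasFDerivAt_integral_fderiv hC hv hw hv hφ hp
  have hsymm := second_derivative_symmetric_of_eventually_of_real h1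
    ((hA.smul_const (ContinuousLinearMap.fst ℝ ℝ ℝ)).add
      (hB.smul_const (ContinuousLinearMap.snd ℝ ℝ ℝ))) (1, 0) (0, 1)
  simp only [add_apply, smul_apply, ContinuousLinearMap.smulRight_apply,
    ContinuousLinearMap.coe_fst', ContinuousLinearMap.coe_snd', smul_eq_mul, mul_one, mul_zero,
    add_zero, zero_add] at hsymm
  have hi2 : ∀ {a b : E D → E D}, Continuous a → Continuous b → (∀ x, ‖a x‖ ≤ C) →
      (∀ x, ‖b x‖ ≤ C) → Integrable (fun x => fderiv ℝ (fderiv ℝ φ) x (a x) (b x))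
        (S s t).toMeasure := fun ha hb hac hbc =>
    integrable_of_forall_norm_le ((c2.clm_apply ha).clm_apply hb).aestronglyMeasurable
      fun x => ContinuousLinearMap.le_of_opNorm_le_of_le _
        (ContinuousLinearMap.le_of_opNorm_le_of_le _ (hN₂ x) (hac x)) (hbc x)
  have hi1 : ∀ {A : E D → ℝ × ℝ × E D →L[ℝ] E D} {z : E D → ℝ × ℝ × E D}, Continuous A →
      Continuous z → (∀ x, ‖A x‖ ≤ C) → (∀ x, ‖z x‖ ≤ 1 + C) →
      Integrable (fun x => fderiv ℝ φ x (A x (z x))) (S s t).toMeasure := fun hA hz hAc hzc =>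
    integrable_of_forall_norm_le (c1.clm_apply (hA.clm_apply hz)).aestronglyMeasurable
      fun x => ContinuousLinearMap.le_of_opNorm_le_of_le _ (hN₁ x)
        (ContinuousLinearMap.le_of_opNorm_le_of_le _ (hAc x) (hzc x))
  have iv := hi1 cv' (z := fun x => (1, 0, w s t x)) (by fun_prop) (hv.norm_fderiv_le hpr)
    fun x => (norm_triple_le _ _ _).trans (add_le_add (by simp [Prod.norm_def]) (hw.norm_le hpr x))
  have iw := hi1 cw' (z := fun x => (0, 1, v s t x)) (by fun_prop) (hw.norm_fderiv_le hpr)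
    fun x => (norm_triple_le _ _ _).trans (add_le_add (by simp [Prod.norm_def]) (hv.norm_le hpr x))
  rw [integral_add (hi2 cw cv (hw.norm_le hpr) (hv.norm_le hpr)) iv,
    integral_add (hi2 cv cw (hv.norm_le hpr) (hw.norm_le hpr)) iw] at hsymm
  have hD2 : ∀ x, fderiv ℝ (fderiv ℝ φ) x (w s t x) (v s t x) =
      fderiv ℝ (fderiv ℝ φ) x (v s t x) (w s t x) := fun x =>
    second_derivative_symmetric_of_eventually_of_real
      (Eventually.of_forall fun y => (hφ.differentiable y).hasFDerivAt)
      (hφ1.differentiable x).hasFDerivAt _ _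
  simp only [hD2] at hsymm
  simp only [map_sub]
  rw [integral_sub iv iw]
  linarith

end IsTransported

/-- A field that is orthogonal to all gradients of test functions has no tangential component. -/
lemma tangentProj_eq_zero {μ : WSpace D} {Z : E D → E D} (hZ : MemLp Z 2 μ.toMeasure)
    (h : ∀ φ : E D → ℝ, IsTest φ → ∫ x, fderiv ℝ φ x (Z x) ∂μ.toMeasure = 0) :
    tangentProj μ (toL2 μ Z) = 0 := by
  have h1 : toL2 μ Z ∈ (tangentSpace μ)ᗮ := by
    rw [tangentSpace, Submodule.orthogonal_closure]
    refine fun X hX => ?_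
    induction hX using Submodule.span_induction with
    | mem X hX =>
      obtain ⟨φ, hφ, rfl⟩ := hX
      rw [L2.inner_def, ← h φ hφ]
      refine integral_congr_ae ?_
      filter_upwards [toL2_coeFn μ (hφ.gradient.memLp μ), toL2_coeFn μ hZ] with x h1 h2
      rw [h1, h2]
      exact (congrArg (fun A => A (Z x))
        ((hφ.differentiable x).hasGradientAt.hasFDerivAt.fderiv)).symm
    | zero => simp
    | add X Y _ _ hX hY => rw [inner_add_left, hX, hY, add_zero]
    | smul c X _ hX => rw [inner_smul_left, hX, mul_zero]
  exact Submodule.orthogonalProjectionOnto_eq_zero_iff.2 h1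

/-! ### Integration over a rectangle -/

lemma restrict_Icc_prod_Icc (a b c d : ℝ) :
    (volume : Measure (ℝ × ℝ)).restrict (Icc a b ×ˢ Icc c d) =
      (volume.restrict (Ioo a b)).prod (volume.restrict (Ioo c d)) := by
  rw [Measure.volume_eq_prod, ← Measure.prod_restrict, Measure.restrict_congr_set Ioo_ae_eq_Icc,
    Measure.restrict_congr_set Ioo_ae_eq_Icc]

lemma ae_restrict_Icc_prod_Icc {a b c d : ℝ} {P : ℝ × ℝ → Prop}
    (h : ∀ s ∈ Ioo a b, ∀ t ∈ Ioo c d, P (s, t)) :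
    ∀ᵐ p ∂(volume : Measure (ℝ × ℝ)).restrict (Icc a b ×ˢ Icc c d), P p := by
  rw [restrict_Icc_prod_Icc, Measure.prod_restrict]
  filter_upwards [ae_restrict_mem (measurableSet_Ioo.prod measurableSet_Ioo)] with p hp
  exact h p.1 hp.1 p.2 hp.2

/-- The derivative of a Lipschitz function of two variables in its first variable is measurable and
bounded, and its integral over a rectangle is given by the values on two sides. -/
lemma integral_rect_deriv {ℓ T L : ℝ} (hℓ : 0 < ℓ) (hT : 0 < T) {G g : ℝ → ℝ → ℝ}
    (hL : ∀ s ∈ Icc 0 ℓ, ∀ t ∈ Icc 0 T, ∀ s' ∈ Icc 0 ℓ, ∀ t' ∈ Icc 0 T,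
      |G s t - G s' t'| ≤ L * ‖((s - s', t - t') : ℝ × ℝ)‖)
    (hg : ∀ s ∈ Ioo 0 ℓ, ∀ t ∈ Ioo 0 T, HasDerivAt (fun s => G s t) (g s t) s) :
    AEStronglyMeasurable (fun p : ℝ × ℝ => g p.1 p.2)
        ((volume : Measure (ℝ × ℝ)).restrict (Icc 0 ℓ ×ˢ Icc 0 T)) ∧
      (∀ s ∈ Ioo 0 ℓ, ∀ t ∈ Ioo 0 T, ‖g s t‖ ≤ L) ∧
      ∫ p in Icc 0 ℓ ×ˢ Icc 0 T, g p.1 p.2 = ∫ t in 0..T, (G ℓ t - G 0 t) := by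
  have hL0 : 0 ≤ L := by
    have h := (abs_nonneg _).trans (hL 0 ⟨le_rfl, hℓ.le⟩ 0 ⟨le_rfl, hT.le⟩ ℓ ⟨hℓ.le, le_rfl⟩ 0
      ⟨le_rfl, hT.le⟩)
    have h2 : 0 < ‖((0 - ℓ, 0 - 0) : ℝ × ℝ)‖ := by simp [Prod.norm_def, hℓ.ne']
    exact nonneg_of_mul_nonneg_left h h2
  have hbd : ∀ s ∈ Ioo 0 ℓ, ∀ t ∈ Ioo 0 T, ‖g s t‖ ≤ L := fun s hs t ht => by
    refine (hg s hs t ht).le_of_lip' hL0 ?_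
    filter_upwards [Ioo_mem_nhds hs.1 hs.2] with s' hs'
    simpa [Prod.norm_def] using hL s' (Ioo_subset_Icc_self hs') t (Ioo_subset_Icc_self ht) s
      (Ioo_subset_Icc_self hs) t (Ioo_subset_Icc_self ht)
  -- a continuous extension of `G` to the plane
  set G' : ℝ → ℝ → ℝ := fun t s => G (projIcc 0 ℓ hℓ.le s) (projIcc 0 T hT.le t) with hG'
  have hG'c : Continuous (Function.uncurry G') := by
    have h1 : LipschitzOnWith L.toNNReal (fun p : ℝ × ℝ => G p.1 p.2) (Icc 0 ℓ ×ˢ Icc 0 T) :=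
      LipschitzOnWith.of_dist_le_mul fun p hp q hq => by
        rw [Real.dist_eq, dist_eq_norm, Real.coe_toNNReal L hL0]
        exact hL p.1 hp.1 p.2 hp.2 q.1 hq.1 q.2 hq.2
    exact h1.continuousOn.comp_continuous
      (f := fun p : ℝ × ℝ => ((projIcc 0 ℓ hℓ.le p.2 : ℝ), (projIcc 0 T hT.le p.1 : ℝ)))
      ((continuous_subtype_val.comp (continuous_projIcc.comp continuous_snd)).prodMk
        (continuous_subtype_val.comp (continuous_projIcc.comp continuous_fst)))
      fun p => ⟨Subtype.coe_prop _, Subtype.coe_prop _⟩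
  have hG'e : ∀ s ∈ Icc 0 ℓ, ∀ t ∈ Icc 0 T, G' t s = G s t := fun s hs t ht => by
    simp only [hG', projIcc_of_mem _ hs, projIcc_of_mem _ ht]
  have hd : ∀ s ∈ Ioo 0 ℓ, ∀ t ∈ Ioo 0 T, HasDerivAt (G' t) (g s t) s := fun s hs t ht => by
    refine (hg s hs t ht).congr_of_eventuallyEq ?_
    filter_upwards [Ioo_mem_nhds hs.1 hs.2] with s' hs'
    exact hG'e s' (Ioo_subset_Icc_self hs') t (Ioo_subset_Icc_self ht)
  have hmeas : Measurable fun p : ℝ × ℝ => deriv (G' p.2) p.1 :=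
    (measurable_deriv_with_param hG'c).comp measurable_swap
  have hae : AEStronglyMeasurable (fun p : ℝ × ℝ => g p.1 p.2)
      ((volume : Measure (ℝ × ℝ)).restrict (Icc 0 ℓ ×ˢ Icc 0 T)) :=
    hmeas.aestronglyMeasurable.congr
      (ae_restrict_Icc_prod_Icc fun s hs t ht => (hd s hs t ht).deriv)
  refine ⟨hae, hbd, ?_⟩
  have hint : Integrable (fun p : ℝ × ℝ => g p.1 p.2)
      ((volume : Measure (ℝ × ℝ)).restrict (Icc 0 ℓ ×ˢ Icc 0 T)) := by
    have : IsFiniteMeasure ((volume : Measure (ℝ × ℝ)).restrict (Icc 0 ℓ ×ˢ Icc 0 T)) :=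
      ⟨by
        rw [Measure.restrict_apply_univ]
        exact (isCompact_Icc.prod isCompact_Icc).measure_lt_top⟩
    exact Integrable.of_bound hae L (ae_restrict_Icc_prod_Icc hbd)
  rw [restrict_Icc_prod_Icc] at hint ⊢
  rw [integral_prod_symm _ hint, intervalIntegral.integral_of_le hT.le,
    integral_Ioc_eq_integral_Ioo]
  refine setIntegral_congr_fun measurableSet_Ioo fun t ht => ?_
  have ht' := Ioo_subset_Icc_self ht
  change ∫ s in Ioo 0 ℓ, g s t = _
  rw [setIntegral_congr_fun (g := deriv (G' t)) measurableSet_Ioo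
    fun s hs => (hd s hs t ht).deriv.symm, ← integral_Ioc_eq_integral_Ioo,
    ← intervalIntegral.integral_of_le hℓ.le,
    intervalIntegral.integral_eq_sub_of_hasDerivAt_of_le (f := G' t) hℓ.le
      (hG'c.comp (Continuous.prodMk_right t)).continuousOn
      (fun s hs => (hd s hs t ht).differentiableAt.hasDerivAt) ?_,
    hG'e ℓ ⟨hℓ.le, le_rfl⟩ t ht', hG'e 0 ⟨le_rfl, hℓ.le⟩ t ht']
  rw [intervalIntegrable_iff, uIoc_of_le hℓ.le, IntegrableOn,
    ← Measure.restrict_congr_set Ioo_ae_eq_Ioc]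
  refine Integrable.of_bound (measurable_deriv _).aestronglyMeasurable L ?_
  filter_upwards [ae_restrict_mem measurableSet_Ioo] with s hs
  rw [(hd s hs t ht).deriv]
  exact hbd s hs t ht

/-- Green's formula on a rectangle, for limits of uniformly Lipschitz functions for which only the
combination `∂_s G - ∂_t H` of derivatives converges. -/
theorem integral_rect_of_tendsto {T L B : ℝ} (hT : 0 < T) {G H d : ℝ → ℝ → ℝ}
    {Gn Hn g h : ℕ → ℝ → ℝ → ℝ}
    (hGL : ∀ n s t s' t', (s, t) ∈ rect T → (s', t') ∈ rect T →
      |Gn n s t - Gn n s' t'| ≤ L * ‖((s - s', t - t') : ℝ × ℝ)‖)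
    (hHL : ∀ n s t s' t', (s, t) ∈ rect T → (s', t') ∈ rect T →
      |Hn n s t - Hn n s' t'| ≤ L * ‖((s - s', t - t') : ℝ × ℝ)‖)
    (hGB : ∀ n s t, (s, t) ∈ rect T → |Gn n s t| ≤ B)
    (hHB : ∀ n s t, (s, t) ∈ rect T → |Hn n s t| ≤ B)
    (hGt : ∀ s t, (s, t) ∈ rect T → Tendsto (fun n => Gn n s t) atTop (𝓝 (G s t)))
    (hHt : ∀ s t, (s, t) ∈ rect T → Tendsto (fun n => Hn n s t) atTop (𝓝 (H s t)))
    (hg : ∀ n, ∀ s ∈ Ioo (0 : ℝ) 1, ∀ t ∈ Ioo 0 T, HasDerivAt (fun s => Gn n s t) (g n s t) s)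
    (hh : ∀ n, ∀ s ∈ Ioo (0 : ℝ) 1, ∀ t ∈ Ioo 0 T, HasDerivAt (fun t => Hn n s t) (h n s t) t)
    (hd : ∀ s ∈ Ioo (0 : ℝ) 1, ∀ t ∈ Ioo 0 T,
      Tendsto (fun n => g n s t - h n s t) atTop (𝓝 (d s t))) :
    IntegrableOn (fun p : ℝ × ℝ => d p.1 p.2) (Icc 0 1 ×ˢ Icc 0 T) ∧
      ∫ p in Icc (0 : ℝ) 1 ×ˢ Icc 0 T, d p.1 p.2 =
        (∫ t in 0..T, G 1 t) + (∫ s in 0..1, H s 0) - (∫ t in 0..T, G 0 t) -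
          ∫ s in 0..1, H s T := by
  have r0 : ∀ {s}, s ∈ Icc (0 : ℝ) 1 → (s, (0 : ℝ)) ∈ rect T := fun hs => ⟨hs, le_rfl, hT.le⟩
  have rT : ∀ {s}, s ∈ Icc (0 : ℝ) 1 → (s, T) ∈ rect T := fun hs => ⟨hs, hT.le, le_rfl⟩
  have q0 : ∀ {t}, t ∈ Icc (0 : ℝ) T → ((0 : ℝ), t) ∈ rect T :=
    fun ht => ⟨⟨le_rfl, zero_le_one⟩, ht⟩
  have q1 : ∀ {t}, t ∈ Icc (0 : ℝ) T → ((1 : ℝ), t) ∈ rect T :=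
    fun ht => ⟨⟨zero_le_one, le_rfl⟩, ht⟩
  have A := fun n => integral_rect_deriv one_pos hT (G := Gn n) (g := g n)
    (fun s hs t ht s' hs' t' ht' => hGL n s t s' t' ⟨hs, ht⟩ ⟨hs', ht'⟩) (hg n)
  have A' := fun n => integral_rect_deriv hT one_pos (G := fun t s => Hn n s t)
    (g := fun t s => h n s t) (L := L)
    (fun t ht s hs t' ht' s' hs' => by
      refine (hHL n s t s' t' ⟨hs, ht⟩ ⟨hs', ht'⟩).trans (le_of_eq ?_)
      rw [Prod.norm_def, Prod.norm_def, max_comm])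
    (fun t ht s hs => hh n s hs t ht)
  have hsw : ∀ n, AEStronglyMeasurable (fun p : ℝ × ℝ => h n p.1 p.2)
      ((volume : Measure (ℝ × ℝ)).restrict (Icc 0 1 ×ˢ Icc 0 T)) := fun n => by
    have h1 := (A' n).1
    rw [restrict_Icc_prod_Icc] at h1 ⊢
    exact h1.prod_swap
  have hfin : IsFiniteMeasure ((volume : Measure (ℝ × ℝ)).restrict (Icc 0 1 ×ˢ Icc 0 T)) :=
    ⟨by
      rw [Measure.restrict_apply_univ]
      exact (isCompact_Icc.prod isCompact_Icc).measure_lt_top⟩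
  have ig : ∀ n, Integrable (fun p : ℝ × ℝ => g n p.1 p.2)
      ((volume : Measure (ℝ × ℝ)).restrict (Icc 0 1 ×ˢ Icc 0 T)) := fun n =>
    Integrable.of_bound (A n).1 L (ae_restrict_Icc_prod_Icc (A n).2.1)
  have ih : ∀ n, Integrable (fun p : ℝ × ℝ => h n p.1 p.2)
      ((volume : Measure (ℝ × ℝ)).restrict (Icc 0 1 ×ˢ Icc 0 T)) := fun n =>
    Integrable.of_bound (hsw n) L (ae_restrict_Icc_prod_Icc fun s hs t ht => (A' n).2.1 t ht s hs)
  have hH : ∀ n, ∫ p in Icc (0 : ℝ) 1 ×ˢ Icc 0 T, h n p.1 p.2 =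
      ∫ s in 0..1, (Hn n s T - Hn n s 0) := fun n => by
    have h1 := (A' n).2.2
    have h2 := ih n
    rw [restrict_Icc_prod_Icc] at h1 h2 ⊢
    rw [← h1]
    exact (integral_prod_swap (μ := volume.restrict (Ioo (0 : ℝ) 1))
      (ν := volume.restrict (Ioo 0 T)) (fun p : ℝ × ℝ => h n p.1 p.2)).symm
  have hlim : ∀ᵐ p ∂(volume : Measure (ℝ × ℝ)).restrict (Icc 0 1 ×ˢ Icc 0 T),
      Tendsto (fun n => g n p.1 p.2 - h n p.1 p.2) atTop (𝓝 (d p.1 p.2)) :=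
    ae_restrict_Icc_prod_Icc hd
  have hbd : ∀ n, ∀ᵐ p ∂(volume : Measure (ℝ × ℝ)).restrict (Icc 0 1 ×ˢ Icc 0 T),
      ‖g n p.1 p.2 - h n p.1 p.2‖ ≤ L + L := fun n =>
    ae_restrict_Icc_prod_Icc fun s hs t ht => (norm_sub_le _ _).trans
      (add_le_add ((A n).2.1 s hs t ht) ((A' n).2.1 t ht s hs))
  have hmeas : ∀ n, AEStronglyMeasurable (fun p : ℝ × ℝ => g n p.1 p.2 - h n p.1 p.2)
      ((volume : Measure (ℝ × ℝ)).restrict (Icc 0 1 ×ˢ Icc 0 T)) := fun n => (A n).1.sub (hsw n)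
  refine ⟨Integrable.of_bound (aestronglyMeasurable_of_tendsto_ae atTop hmeas hlim) (L + L) ?_, ?_⟩
  · filter_upwards [hlim, ae_all_iff.2 hbd] with p hp hp'
    exact le_of_tendsto' hp.norm hp'
  have l1 := tendsto_integral_of_dominated_convergence (fun _ => L + L) hmeas
    (integrable_const _) hbd hlim
  have icont : ∀ {k : ℝ → ℝ} {c : ℝ} (hc : 0 ≤ c),
      (∀ x ∈ Icc 0 c, ∀ y ∈ Icc 0 c, |k x - k y| ≤ L * |x - y|) →
      IntervalIntegrable k volume 0 c := fun {k c} hc hk => by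
    have : LipschitzOnWith L.toNNReal k (Icc 0 c) :=
        LipschitzOnWith.of_dist_le_mul fun x hx y hy => by
      rw [Real.dist_eq, Real.dist_eq]
      exact (hk x hx y hy).trans (by gcongr; exact Real.le_coe_toNNReal L)
    refine ContinuousOn.intervalIntegrable ?_
    rw [uIcc_of_le hc]
    exact this.continuousOn
  have i1 : ∀ n, IntervalIntegrable (fun t => Gn n 1 t) volume 0 T := fun n => icont hT.le
    fun x hx y hy => by simpa [Prod.norm_def] using hGL n 1 x 1 y (q1 hx) (q1 hy)
  have i0 : ∀ n, IntervalIntegrable (fun t => Gn n 0 t) volume 0 T := fun n => icont hT.le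
    fun x hx y hy => by simpa [Prod.norm_def] using hGL n 0 x 0 y (q0 hx) (q0 hy)
  have j1 : ∀ n, IntervalIntegrable (fun s => Hn n s T) volume 0 1 := fun n => icont zero_le_one
    fun x hx y hy => by simpa [Prod.norm_def] using hHL n x T y T (rT hx) (rT hy)
  have j0 : ∀ n, IntervalIntegrable (fun s => Hn n s 0) volume 0 1 := fun n => icont zero_le_one
    fun x hx y hy => by simpa [Prod.norm_def] using hHL n x 0 y 0 (r0 hx) (r0 hy)
  have dct : ∀ {k : ℕ → ℝ → ℝ} {k' : ℝ → ℝ} {c : ℝ} (hc : 0 ≤ c),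
      (∀ n, IntervalIntegrable (k n) volume 0 c) → (∀ n, ∀ x ∈ Icc 0 c, |k n x| ≤ B) →
      (∀ x ∈ Icc 0 c, Tendsto (fun n => k n x) atTop (𝓝 (k' x))) →
      Tendsto (fun n => ∫ x in 0..c, k n x) atTop (𝓝 (∫ x in 0..c, k' x)) := by
    intro k k' c hc hi hb hl
    refine intervalIntegral.tendsto_integral_filter_of_dominated_convergence (fun _ => B)
      (Eventually.of_forall fun n => (intervalIntegrable_iff.1 (hi n)).aestronglyMeasurable) ?_
      intervalIntegrable_const ?_
    · refine Eventually.of_forall fun n => Eventually.of_forall fun x hx => ?_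
      rw [uIoc_of_le hc] at hx
      exact hb n x (Ioc_subset_Icc_self hx)
    · refine Eventually.of_forall fun x hx => ?_
      rw [uIoc_of_le hc] at hx
      exact hl x (Ioc_subset_Icc_self hx)
  have l2 := (((dct hT.le i1 (fun n t ht => hGB n 1 t (q1 ht)) fun t ht => hGt 1 t (q1 ht)).add
    (dct zero_le_one j0 (fun n s hs => hHB n s 0 (r0 hs)) fun s hs => hHt s 0 (r0 hs))).sub
    (dct hT.le i0 (fun n t ht => hGB n 0 t (q0 ht)) fun t ht => hGt 0 t (q0 ht))).sub
    (dct zero_le_one j1 (fun n s hs => hHB n s T (rT hs)) fun s hs => hHt s T (rT hs))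
  refine tendsto_nhds_unique l1 (l2.congr fun n => ?_)
  rw [integral_sub (ig n) (ih n), (A n).2.2, hH n, intervalIntegral.integral_sub (i1 n) (i0 n),
    intervalIntegral.integral_sub (j1 n) (j0 n)]
  ring

/-! ### Derivatives of 1-forms along curves -/

lemma OneForm.abs_bar_le (Λ : OneForm D) (μ : WSpace D) (X : L2 μ) :
    |Λ.bar μ X| ≤ ‖Λ μ‖ * ‖X‖ :=
  ContinuousLinearMap.le_of_opNorm_le_of_le (Λ μ) le_rfl (norm_tangentProj_le μ X)

/-- The Lipschitz bound in terms of bounds for `u` and its derivative instead of suprema. -/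
lemma OneForm.LocallyLipschitzOnFields.exists_bound {Λ : OneForm D}
    (h : Λ.LocallyLipschitzOnFields) {K : Set (WSpace D)} (hK : IsCompact K) :
    ∃ C : ℝ, 0 ≤ C ∧ ∀ μ ∈ K, ∀ ν ∈ K, ∀ (u : E D → E D) (A B : ℝ), Differentiable ℝ u →
      (∀ x, ‖u x‖ ≤ A) → (∀ x, ‖fderiv ℝ u x‖ ≤ B) →
      |Λ.bar ν (toL2 ν u) - Λ.bar μ (toL2 μ u)| ≤ C * W2 μ ν * (A + B) := by
  obtain ⟨C, hC⟩ := h K hK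
  refine ⟨|C|, abs_nonneg C, fun μ hμ ν hν u A B hd hA hB => ?_⟩
  have hA0 : 0 ≤ A := (norm_nonneg _).trans (hA 0)
  have hB0 : 0 ≤ B := (norm_nonneg _).trans (hB 0)
  have hW := W2_nonneg μ ν
  calc _ ≤ _ := hC μ hμ ν hν u hd ⟨A, by rintro _ ⟨x, rfl⟩; exact hA x⟩
        ⟨B, by rintro _ ⟨x, rfl⟩; exact hB x⟩
    _ ≤ |C| * W2 μ ν * ((⨆ x, ‖u x‖) + ⨆ x, ‖fderiv ℝ u x‖) := by
        have h1 : 0 ≤ ⨆ x, ‖u x‖ := Real.iSup_nonneg fun _ => norm_nonneg _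
        have h2 : 0 ≤ ⨆ x, ‖fderiv ℝ u x‖ := Real.iSup_nonneg fun _ => norm_nonneg _
        gcongr
        exact le_abs_self C
    _ ≤ _ := by
        gcongr
        · exact ciSup_le hA
        · exact ciSup_le hB

/-- Displacements by uniformly bounded fields with step tending to `0` converge to the undisplaced
measure in the topology defined by test functions of quadratic growth. -/
lemma WSpace.tendsto_displace (μ : WSpace D) {u : ℕ → E D → E D} (hu : ∀ n, Continuous (u n))
    {M : ℝ} (hM : ∀ n x, ‖u n x‖ ≤ M) {h : ℕ → ℝ} (hh : Tendsto h atTop (𝓝 0)) :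
    Tendsto (fun n => μ.displace (hu n) (hM n) (h n)) atTop (𝓝 μ) := by
  have hM0 : 0 ≤ M := (norm_nonneg _).trans (hM 0 0)
  refine Tendsto.mono_right ?_ (nhds_iInf (a := μ)
    (t := fun f : {f : E D → ℝ // IsC2Growth f} => TopologicalSpace.induced
      (fun μ : WSpace D => ∫ x, f.1 x ∂μ.toMeasure) inferInstance)).ge
  rw [tendsto_iInf]
  rintro ⟨f, hf, A, B, hAB⟩
  rw [nhds_induced, tendsto_comap_iff]
  have e : ∀ n, ∫ x, f x ∂(μ.displace (hu n) (hM n) (h n)).toMeasure =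
      ∫ x, f (x + h n • u n x) ∂μ.toMeasure := fun n => by
    have := hu n
    exact integral_map (by fun_prop) hf.aestronglyMeasurable
  obtain ⟨R, hR⟩ := hh.abs.bddAbove_range
  have hhR : ∀ n, |h n| ≤ R := fun n => hR ⟨n, rfl⟩
  have hnorm : ∀ n x, ‖h n • u n x‖ ≤ |h n| * M := fun n x => by
    rw [norm_smul, Real.norm_eq_abs]
    gcongr
    exact hM n x
  change Tendsto (fun n => ∫ x, f x ∂(μ.displace (hu n) (hM n) (h n)).toMeasure) atTop
    (𝓝 (∫ x, f x ∂μ.toMeasure))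
  simp only [e]
  refine tendsto_integral_of_dominated_convergence (fun x => |A| + |B| * (‖x‖ + R * M) ^ 2)
    (fun n => ?_) ?_ (fun n => Eventually.of_forall fun x => ?_) (Eventually.of_forall fun x => ?_)
  · have := hu n
    exact (hf.comp (by fun_prop)).aestronglyMeasurable
  · have h1 : MemLp (fun x : E D => ‖x‖ + R * M) 2 μ.toMeasure :=
      (memLp_id _).norm.add (memLp_const _)
    exact (integrable_const _).add (h1.integrable_sq.const_mul _)
  · calc ‖f (x + h n • u n x)‖ ≤ A + B * ‖x + h n • u n x‖ ^ 2 := hAB _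
      _ ≤ |A| + |B| * ‖x + h n • u n x‖ ^ 2 := by gcongr <;> exact le_abs_self _
      _ ≤ _ := by
        gcongr
        refine (norm_add_le _ _).trans ?_
        gcongr
        exact (hnorm n x).trans (by gcongr; exact hhR n)
  · refine (hf.tendsto x).comp ?_
    have h0 : Tendsto (fun n => |h n| * M) atTop (𝓝 0) := by
      simpa using hh.abs.mul_const M
    have h1 : Tendsto (fun n => h n • u n x) atTop (𝓝 0) :=
      squeeze_zero_norm (fun n => hnorm n x) h0
    simpa using h1.const_add x

/-- The derivatives of `Λ(X_n)` in directions `r_n` that tend to `0` in `L²(μ)` tend to `0`, if the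
fields `X_n` are bounded in `C¹`. Difference quotients of `Λ(X_n)` at `μ` are taken at measures that
form a compact set together with `μ`, on which the Lipschitz bound for `Λ` is uniform. -/
lemma OneForm.tendsto_dirDeriv_zero {Λ : OneForm D} (hΛ : Λ.IsDifferentiable)
    (hlip : Λ.LocallyLipschitzOnFields) (μ : WSpace D) {r : ℕ → E D → E D} {f : ℕ → E D → ℝ}
    {M A B : ℝ} {L : ℕ → ℝ} (hr : ∀ n, IsGradientField (r n) (f n) M (L n))
    (hT : ∀ n, toL2 μ (r n) ∈ tangentSpace μ)
    (h0 : Tendsto (fun n => ‖toL2 μ (r n)‖) atTop (𝓝 0)) {X : ℕ → E D → E D}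
    (hX : ∀ n, IsTest (X n)) (hA : ∀ n x, ‖X n x‖ ≤ A) (hB : ∀ n x, ‖fderiv ℝ (X n) x‖ ≤ B) :
    Tendsto (fun n => dirDeriv (r n) (fun ν => Λ.bar ν (toL2 ν (X n))) μ) atTop (𝓝 0) := by
  have hpos : ∀ n : ℕ, (0 : ℝ) < 1 / ((n : ℝ) + 1) := fun n => by positivity
  choose δ hδ H using fun n => abs_sub_dirDeriv_le (hΛ.1 (X n) (hX n) μ) (hr n) (hT n)
    (C := 0) le_rfl (hpos n)
  -- a step so small that the difference quotient is `1 / (n + 1)`-close to the derivative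
  set h : ℕ → ℝ := fun n => min (δ n / 2) (1 / ((n : ℝ) + 1)) with hh
  have hh0 : ∀ n, 0 < h n := fun n => lt_min (half_pos (hδ n)) (hpos n)
  have hhlim : Tendsto h atTop (𝓝 0) :=
    squeeze_zero (fun n => (hh0 n).le) (fun n => min_le_right _ _)
      tendsto_one_div_add_atTop_nhds_zero_nat
  set ν : ℕ → WSpace D := fun n => μ.displace (hr n).continuous (hr n).norm_le (h n) with hν
  have hK : IsCompact (insert μ (range ν)) :=
    (μ.tendsto_displace (fun n => (hr n).continuous) (fun n => (hr n).norm_le)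
      hhlim).isCompact_insert_range
  obtain ⟨C, hC, hCK⟩ := hlip.exists_bound hK
  have hAB : 0 ≤ A + B :=
    add_nonneg ((norm_nonneg _).trans (hA 0 0)) ((norm_nonneg _).trans (hB 0 0))
  have hlim : Tendsto (fun n : ℕ => C * ‖toL2 μ (r n)‖ * (A + B) + 1 / ((n : ℝ) + 1)) atTop
      (𝓝 0) := by
    simpa using ((h0.const_mul C).mul_const (A + B)).add
      (tendsto_one_div_add_atTop_nhds_zero_nat (𝕜 := ℝ))
  refine squeeze_zero_norm (fun n => ?_) hlim
  set d := dirDeriv (r n) (fun ν => Λ.bar ν (toL2 ν (X n))) μ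
  have hc := (hr n).continuous
  have h1 := H n (h n) (by
    rw [abs_of_pos (hh0 n)]
    exact (min_le_left _ _).trans_lt (half_lt_self (hδ n))) (ν n) (fun x => x + h n • r n x)
    (by fun_prop) rfl (by simp)
  have h2 := hCK μ (mem_insert _ _) (ν n) (mem_insert_of_mem _ ⟨n, rfl⟩) (X n) A B
    (hX n).differentiable (hA n) (hB n)
  have h3 := μ.W2_displace_le (hr n).continuous (hr n).norm_le (h n)
  rw [abs_of_pos (hh0 n)] at h1 h3
  have h4 : C * W2 μ (ν n) * (A + B) ≤ C * (h n * ‖toL2 μ (r n)‖) * (A + B) := by gcongr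
  have h5 : |h n * d| ≤ h n * (C * ‖toL2 μ (r n)‖ * (A + B) + 1 / ((n : ℝ) + 1)) := by
    have e : h n * (C * ‖toL2 μ (r n)‖ * (A + B) + 1 / ((n : ℝ) + 1)) =
      C * (h n * ‖toL2 μ (r n)‖) * (A + B) + 1 / ((n : ℝ) + 1) * h n := by ring
    rw [e]
    have h2' := h2.trans h4
    rw [abs_le] at h1 h2' ⊢
    constructor <;> linarith [h1.1, h1.2, h2'.1, h2'.2]
  rw [abs_mul, abs_of_pos (hh0 n)] at h5
  exact le_of_mul_le_mul_left h5 (hh0 n)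

/-- Product rule: the derivative of `Λ(X)` along a curve of measures that moves with velocity `u`,
for a field `X` that depends on time. -/
lemma OneForm.hasDerivAt_bar {Λ : OneForm D} (hΛ : Λ.IsDifferentiable) (hbdd : Λ.LocallyBounded)
    (hlip : Λ.LocallyLipschitzOnFields) {σ : ℝ → WSpace D} {τ₀ : ℝ} {K : Set (WSpace D)}
    (hK : IsCompact K) (hσK : ∀ᶠ τ in 𝓝 τ₀, σ τ ∈ K) {u : E D → E D} {f : E D → ℝ} {M L : ℝ}
    (hu : IsGradientField u f M L) (hT : toL2 (σ τ₀) u ∈ tangentSpace (σ τ₀)) {C : ℝ} (hC : 0 ≤ C)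
    (htr : ∀ᶠ τ in 𝓝 τ₀, ∃ Θ : E D → E D, Measurable Θ ∧
      (σ τ).toMeasure = (σ τ₀).toMeasure.map Θ ∧ (∀ x, ‖Θ x - x‖ ≤ C * |τ - τ₀|) ∧
      ∀ x, ‖Θ x - x - (τ - τ₀) • u x‖ ≤ C * (τ - τ₀) ^ 2)
    {X : ℝ → E D → E D} {Y : E D → E D} (hX : ∀ᶠ τ in 𝓝 τ₀, IsTest (X τ)) (hY : IsTest Y)
    (hexp : ∀ᶠ τ in 𝓝 τ₀, ∀ x, ‖X τ x - X τ₀ x - (τ - τ₀) • Y x‖ ≤ C * (τ - τ₀) ^ 2) :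
    HasDerivAt (fun τ => Λ.bar (σ τ) (toL2 (σ τ) (X τ)))
      (dirDeriv u (fun ν => Λ.bar ν (toL2 ν (X τ₀))) (σ τ₀) +
        Λ.bar (σ τ₀) (toL2 (σ τ₀) Y)) τ₀ := by
  have hX0 := hX.self_of_nhds
  have hσ0 := hσK.self_of_nhds
  obtain ⟨A, hA⟩ := hY.bounded
  obtain ⟨B, hB⟩ := hY.2.fderiv (𝕜 := ℝ) |>.exists_bound_of_continuous
    (hY.1.continuous_fderiv (by simp))
  obtain ⟨CK, hCK0, hCK⟩ := hlip.exists_bound hK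
  obtain ⟨MK, hMK⟩ := hbdd K hK
  have hMK0 : 0 ≤ MK := (norm_nonneg (Λ (σ τ₀))).trans (hMK _ hσ0)
  have hAB : 0 ≤ A + B := add_nonneg ((norm_nonneg _).trans (hA 0)) ((norm_nonneg _).trans (hB 0))
  set Q : ℝ := CK * C * (A + B) + MK * C with hQ
  have hQ0 : 0 ≤ Q := by positivity
  rw [hasDerivAt_iff_isLittleO, Asymptotics.isLittleO_iff]
  intro c hc
  obtain ⟨δ, hδ, H⟩ := abs_sub_dirDeriv_le (hΛ.1 _ hX0 (σ τ₀)) hu hT hC (half_pos hc)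
  have hη : 0 < min δ (c / (2 * (Q + 1))) := lt_min hδ (by positivity)
  filter_upwards [hσK, htr, hX, hexp, Metric.ball_mem_nhds τ₀ hη] with τ h1 h2 h3 h4 h5
  obtain ⟨Θ, hΘm, hΘe, hΘb, hΘc⟩ := h2
  rw [Metric.mem_ball, Real.dist_eq, lt_min_iff] at h5
  set h := τ - τ₀ with hh
  set F : WSpace D → ℝ := fun ν => Λ.bar ν (toL2 ν (X τ₀)) with hF
  have t1 := H h h5.1 (σ τ) Θ hΘm hΘe hΘc
  have hW : W2 (σ τ₀) (σ τ) ≤ C * |h| := W2_le_of_dist_le hΘm hΘe (by positivity) hΘb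
  have t2 := hCK _ hσ0 _ h1 Y A B hY.differentiable hA hB
  have t2' : |Λ.bar (σ τ) (toL2 (σ τ) Y) - Λ.bar (σ τ₀) (toL2 (σ τ₀) Y)| ≤
      CK * (C * |h|) * (A + B) := t2.trans (by gcongr)
  set R : E D → E D := X τ - X τ₀ - h • Y with hR
  have mXτ := h3.memLp (σ τ)
  have mX0 := hX0.memLp (σ τ)
  have mY := hY.memLp (σ τ)
  have t3 : |Λ.bar (σ τ) (toL2 (σ τ) R)| ≤ MK * (C * h ^ 2) :=
    (Λ.abs_bar_le _ _).trans (mul_le_mul (hMK _ h1)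
      (norm_toL2_le _ ((mXτ.sub mX0).sub (mY.const_smul h)) h4) (norm_nonneg _) hMK0)
  -- `X τ = X τ₀ + (τ - τ₀) • Y + R`
  have e : Λ.bar (σ τ) (toL2 (σ τ) (X τ)) = F (σ τ) + h * Λ.bar (σ τ) (toL2 (σ τ) Y) +
      Λ.bar (σ τ) (toL2 (σ τ) R) := by
    rw [hR, toL2_sub _ (mXτ.sub mX0) (mY.const_smul h), toL2_sub _ mXτ mX0, toL2_smul _ mY,
      map_sub, map_sub, map_smul, smul_eq_mul]
    ring
  rw [e, Real.norm_eq_abs, Real.norm_eq_abs, smul_eq_mul]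
  have habs := abs_nonneg h
  have t4 : |h * (Λ.bar (σ τ) (toL2 (σ τ) Y) - Λ.bar (σ τ₀) (toL2 (σ τ₀) Y))| ≤
      CK * C * (A + B) * |h| ^ 2 := by
    rw [abs_mul]
    calc _ ≤ |h| * (CK * (C * |h|) * (A + B)) := by gcongr
      _ = _ := by ring
  have t5 : Q * |h| ^ 2 ≤ c / 2 * |h| := by
    have h6 : |h| * (2 * (Q + 1)) ≤ c := by
      have := h5.2.le
      rwa [le_div_iff₀ (by positivity)] at this
    nlinarith
  have e2 : F (σ τ) + h * Λ.bar (σ τ) (toL2 (σ τ) Y) + Λ.bar (σ τ) (toL2 (σ τ) R) -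
      F (σ τ₀) - h * (dirDeriv u F (σ τ₀) + Λ.bar (σ τ₀) (toL2 (σ τ₀) Y)) =
      (F (σ τ) - F (σ τ₀) - h * dirDeriv u F (σ τ₀)) +
      h * (Λ.bar (σ τ) (toL2 (σ τ) Y) - Λ.bar (σ τ₀) (toL2 (σ τ₀) Y)) +
      Λ.bar (σ τ) (toL2 (σ τ) R) := by ring
  have e3 : F (σ τ₀) = Λ.bar (σ τ₀) (toL2 (σ τ₀) (X τ₀)) := rfl
  rw [← e3, e2]
  refine (abs_add_three _ _ _).trans ?_
  rw [← sq_abs h] at t3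
  have e4 : Q * |h| ^ 2 = CK * C * (A + B) * |h| ^ 2 + MK * (C * |h| ^ 2) := by rw [hQ]; ring
  linarith

/-- Along a transported surface, `Λ(U)` is bounded and Lipschitz in the parameters, in terms of a
bound `A` for the field `U`. -/
lemma IsTransported.exists_lipschitz_bar {T C : ℝ} {S : ℝ → ℝ → WSpace D}
    {v w : ℝ → ℝ → E D → E D} (hS : IsTransported T S v w C) (hC : 0 ≤ C) {Λ : OneForm D}
    (hbdd : Λ.LocallyBounded) (hlip : Λ.LocallyLipschitzOnFields) (hT : 0 ≤ T) :
    ∃ Q : ℝ, ∀ (U : ℝ → ℝ → E D → E D) (A : ℝ),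
      (∀ s t, (s, t) ∈ rect T → Differentiable ℝ (U s t) ∧ (∀ x, ‖U s t x‖ ≤ A) ∧
        ∀ x, ‖fderiv ℝ (U s t) x‖ ≤ A) →
      (∀ s t s' t', (s, t) ∈ rect T → (s', t') ∈ rect T → ∀ x,
        ‖U s t x - U s' t' x‖ ≤ A * ‖((s - s', t - t') : ℝ × ℝ)‖) →
      (∀ s t s' t', (s, t) ∈ rect T → (s', t') ∈ rect T →
        |Λ.bar (S s t) (toL2 (S s t) (U s t)) - Λ.bar (S s' t') (toL2 (S s' t') (U s' t'))| ≤
          Q * A * ‖((s - s', t - t') : ℝ × ℝ)‖) ∧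
      ∀ s t, (s, t) ∈ rect T → |Λ.bar (S s t) (toL2 (S s t) (U s t))| ≤ Q * A := by
  have hK := hS.isCompact_image hC
  obtain ⟨CK, hCK0, hCK⟩ := hlip.exists_bound hK
  obtain ⟨MK, hMK⟩ := hbdd _ hK
  have hmem : ∀ s t, (s, t) ∈ rect T → S s t ∈ (fun p : ℝ × ℝ => S p.1 p.2) '' rect T :=
    fun s t h => ⟨(s, t), h, rfl⟩
  have h00 : ((0 : ℝ), (0 : ℝ)) ∈ rect T := ⟨⟨le_rfl, zero_le_one⟩, le_rfl, hT⟩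
  have hMK0 : 0 ≤ MK := (norm_nonneg (Λ (S 0 0))).trans (hMK _ (hmem 0 0 h00))
  refine ⟨2 * CK * C + MK, fun U A hU hUL => ⟨fun s t s' t' hp hq => ?_, fun s t hp => ?_⟩⟩
  · have hA0 : 0 ≤ A := (norm_nonneg _).trans ((hU s t hp).2.1 0)
    set N := ‖((s - s', t - t') : ℝ × ℝ)‖ with hN
    have hN0 : 0 ≤ N := norm_nonneg _
    have m1 : MemLp (U s t) 2 (S s' t').toMeasure :=
      MemLp.of_bound (hU s t hp).1.continuous.aestronglyMeasurable A
        (Eventually.of_forall (hU s t hp).2.1)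
    have m2 : MemLp (U s' t') 2 (S s' t').toMeasure :=
      MemLp.of_bound (hU s' t' hq).1.continuous.aestronglyMeasurable A
        (Eventually.of_forall (hU s' t' hq).2.1)
    have t1 := hCK _ (hmem _ _ hq) _ (hmem _ _ hp) (U s t) A A (hU s t hp).1 (hU s t hp).2.1
      (hU s t hp).2.2
    have t2 : |Λ.bar (S s' t') (toL2 (S s' t') (U s t)) -
        Λ.bar (S s' t') (toL2 (S s' t') (U s' t'))| ≤ MK * (A * N) := by
      rw [← map_sub, ← toL2_sub _ m1 m2]
      exact (Λ.abs_bar_le _ _).trans (mul_le_mul (hMK _ (hmem _ _ hq))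
        (norm_toL2_le _ (m1.sub m2) (hUL s t s' t' hp hq)) (norm_nonneg _) hMK0)
    have t3 := hS.W2_le hC hq hp
    calc _ ≤ _ := abs_sub_le _ (Λ.bar (S s' t') (toL2 (S s' t') (U s t))) _
      _ ≤ CK * (C * N) * (A + A) + MK * (A * N) :=
          add_le_add (t1.trans (by gcongr)) t2
      _ = _ := by ring
  · have hA0 : 0 ≤ A := (norm_nonneg _).trans ((hU s t hp).2.1 0)
    have m1 : MemLp (U s t) 2 (S s t).toMeasure :=
      MemLp.of_bound (hU s t hp).1.continuous.aestronglyMeasurable A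
        (Eventually.of_forall (hU s t hp).2.1)
    calc _ ≤ MK * A := (Λ.abs_bar_le _ _).trans (mul_le_mul (hMK _ (hmem _ _ hp))
        (norm_toL2_le _ m1 (hU s t hp).2.1) (norm_nonneg _) hMK0)
      _ ≤ _ := by
        gcongr
        have : 0 ≤ 2 * CK * C := by positivity
        linarith

/-! ### Stokes' formula -/

/-- `u` is the gradient of `f`, and it is of class `C¹` with derivative `u'`, both bounded by
`A`. -/
structure IsC1GradientField (u : E D → E D) (u' : E D → E D →L[ℝ] E D) (f : E D → ℝ) (A : ℝ) :
    Prop where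
  hasGradient : ∀ x, HasGradientAt f (u x) x
  hasFDerivAt : ∀ x, HasFDerivAt u (u' x) x
  continuous_deriv : Continuous u'
  norm_le : ∀ x, ‖u x‖ ≤ A
  norm_deriv_le : ∀ x, ‖u' x‖ ≤ A

/-- The bound for the approximations of fields bounded by `A`. -/
def approxBound (D : ℕ) (A : ℝ) : ℝ := (1 + 3 * cutoffBound D) * (A + A)

lemma norm_approx_le_approxBound (n : ℕ) {u : E D → E D} {A : ℝ} (hA : ∀ x, ‖u x‖ ≤ A) (x : E D) :
    ‖approx n u x‖ ≤ approxBound D A := by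
  have hA0 : 0 ≤ A := (norm_nonneg _).trans (hA 0)
  have hG := cutoffBound_nonneg (D := D)
  refine (norm_approx_le n hA x).trans ?_
  unfold approxBound
  gcongr <;> linarith

lemma norm_sub_le_of_norm_fderiv_le {X : E D → E D} {X' : E D → E D →L[ℝ] E D} {B : ℝ}
    (hd : ∀ x, HasFDerivAt X (X' x) x) (hB : ∀ x, ‖X' x‖ ≤ B) (x y : E D) :
    ‖X x - X y‖ ≤ B * ‖x - y‖ :=
  convex_univ.norm_image_sub_le_of_norm_hasFDerivWithin_le
    (fun z _ => (hd z).hasFDerivWithinAt) (fun z _ => hB z) (mem_univ y) (mem_univ x)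

namespace IsC1GradientField

variable {u z : E D → E D} {u' z' : E D → E D →L[ℝ] E D} {f k : E D → ℝ} {A : ℝ}

lemma continuous (hu : IsC1GradientField u u' f A) : Continuous u :=
  continuous_iff_continuousAt.2 fun x => (hu.hasFDerivAt x).continuousAt

lemma nonneg (hu : IsC1GradientField u u' f A) : 0 ≤ A := (norm_nonneg _).trans (hu.norm_le 0)

lemma memLp (hu : IsC1GradientField u u' f A) (μ : WSpace D) : MemLp u 2 μ.toMeasure :=
  MemLp.of_bound hu.continuous.aestronglyMeasurable A (Eventually.of_forall hu.norm_le)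

lemma isGradientField (hu : IsC1GradientField u u' f A) : IsGradientField u f A A :=
  ⟨hu.hasGradient, hu.norm_le, norm_sub_le_of_norm_fderiv_le hu.hasFDerivAt hu.norm_deriv_le,
    hu.nonneg⟩

lemma toL2_mem (hu : IsC1GradientField u u' f A) (μ : WSpace D) : toL2 μ u ∈ tangentSpace μ :=
  toL2_mem_tangentSpace μ hu.continuous hu.norm_le hu.hasGradient

lemma norm_fderiv_approx_le (hu : IsC1GradientField u u' f A) (n : ℕ) (x : E D) :
    ‖fderiv ℝ (approx n u) x‖ ≤ approxBound D A :=
  (fderiv_approx hu.hasGradient hu.hasFDerivAt hu.continuous_deriv hu.norm_le hu.norm_deriv_le).1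
    n x

lemma tendsto_fderiv_approx (hu : IsC1GradientField u u' f A) (x : E D) :
    Tendsto (fun n => fderiv ℝ (approx n u) x) atTop (𝓝 (u' x)) :=
  (fderiv_approx hu.hasGradient hu.hasFDerivAt hu.continuous_deriv hu.norm_le hu.norm_deriv_le).2 x

/-- The error of the approximation is a gradient field as well. -/
lemma exists_isGradientField_sub_approx (hu : IsC1GradientField u u' f A) (n : ℕ) :
    ∃ k L, IsGradientField (u - approx n u) k (A + approxBound D A) L := by
  obtain ⟨φ, hφ, he⟩ := exists_approx_eq_gradient n hu.continuous hu.hasGradient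
  obtain ⟨M, L, hL⟩ := hφ.isGradientField
  rw [he] at hL
  refine ⟨f - φ, A + L, fun x => ?_, fun x => ?_, fun x y => ?_, add_nonneg hu.nonneg hL.nonneg⟩
  · have h1 := (hu.hasGradient x).hasFDerivAt.sub (hL.hasGradient x).hasFDerivAt
    rw [← map_sub] at h1
    exact hasGradientAt_iff_hasFDerivAt.2 h1
  · exact (norm_sub_le _ _).trans
      (add_le_add (hu.norm_le x) (norm_approx_le_approxBound n hu.norm_le x))
  · calc _ = ‖(u x - u y) - (approx n u x - approx n u y)‖ := by
          simp only [Pi.sub_apply]; congr 1; abel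
      _ ≤ A * ‖x - y‖ + L * ‖x - y‖ := (norm_sub_le _ _).trans
          (add_le_add (hu.isGradientField.lipschitz x y) (hL.lipschitz x y))
      _ = _ := by ring

/-- Replacing the direction `u` by its approximations does not change the limit of directional
derivatives of `Λ` at approximations of another field. Only `u - approx n u → 0` in `L²(μ)` is
needed, so that the gradients of the functions `Λ(approx n z)`, which need not converge, do not
matter. -/
lemma tendsto_dirDeriv_sub (hu : IsC1GradientField u u' f A) (hz : IsC1GradientField z z' k A)
    {Λ : OneForm D} (hΛ : Λ.IsDifferentiable) (hlip : Λ.LocallyLipschitzOnFields) (μ : WSpace D) :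
    Tendsto (fun n => dirDeriv u (fun ν => Λ.bar ν (toL2 ν (approx n z))) μ -
      dirDeriv (approx n u) (fun ν => Λ.bar ν (toL2 ν (approx n z))) μ) atTop (𝓝 0) := by
  choose φ L hr using hu.exists_isGradientField_sub_approx
  have hsub : ∀ n, toL2 μ (u - approx n u) = toL2 μ u - toL2 μ (approx n u) := fun n =>
    toL2_sub μ (hu.memLp μ) ((isTest_approx n hu.continuous).memLp μ)
  have hlim := Λ.tendsto_dirDeriv_zero hΛ hlip μ hr (fun n => ?_) ?_
    (X := fun n => approx n z) (fun n => isTest_approx n hz.continuous)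
    (fun n => norm_approx_le_approxBound n hz.norm_le) hz.norm_fderiv_approx_le
  · refine hlim.congr fun n => ?_
    have h := dirDeriv_add_left (fun ν => Λ.bar ν (toL2 ν (approx n z))) μ
      ((hu.memLp μ).sub ((isTest_approx n hu.continuous).memLp μ))
      ((isTest_approx n hu.continuous).memLp μ)
    rw [sub_add_cancel] at h
    linarith
  · rw [hsub]
    refine sub_mem (hu.toL2_mem μ) ?_
    obtain ⟨φ, hφ, he⟩ := exists_approx_eq_gradient n hu.continuous hu.hasGradient
    rw [← he]
    exact hφ.toL2_gradient_mem μ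
  · simp only [hsub, norm_sub_rev (toL2 μ u)]
    exact tendsto_iff_norm_sub_tendsto_zero.1 (tendsto_toL2_approx μ hu.continuous hu.norm_le)

/-- The defining formula of `dΛ_μ` holds in the limit for gradient fields of class `C¹`. -/
lemma tendsto_d (hu : IsC1GradientField u u' f A) (hz : IsC1GradientField z z' k A)
    {Λ : OneForm D} (hΛ : Λ.IsDifferentiable) (hlip : Λ.LocallyLipschitzOnFields) (μ : WSpace D) :
    Tendsto (fun n => dirDeriv u (fun ν => Λ.bar ν (toL2 ν (approx n z))) μ -
      dirDeriv z (fun ν => Λ.bar ν (toL2 ν (approx n u))) μ -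
      Λ.bar μ (toL2 μ (VectorField.lieBracket ℝ (approx n u) (approx n z)))) atTop
      (𝓝 (Λ.d μ (tangentProj μ (toL2 μ u)) (tangentProj μ (toL2 μ z)))) := by
  have h1 : Tendsto (fun n => Λ.d μ (tangentProj μ (toL2 μ (approx n u)))
      (tangentProj μ (toL2 μ (approx n z)))) atTop
      (𝓝 (Λ.d μ (tangentProj μ (toL2 μ u)) (tangentProj μ (toL2 μ z)))) := by
    have h2 := ((tangentProj μ).continuous.tendsto _).comp
      (tendsto_toL2_approx μ hu.continuous hu.norm_le)
    have h3 := ((tangentProj μ).continuous.tendsto _).comp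
      (tendsto_toL2_approx μ hz.continuous hz.norm_le)
    have h5 : Tendsto (fun n => Λ.d μ (tangentProj μ (toL2 μ (approx n u)))) atTop
        (𝓝 (Λ.d μ (tangentProj μ (toL2 μ u)))) := ((Λ.d μ).continuous.tendsto _).comp h2
    exact (isBoundedBilinearMap_apply.continuous.tendsto (_, _)).comp (h5.prodMk_nhds h3)
  have h4 := ((hu.tendsto_dirDeriv_sub hz hΛ hlip μ).sub
    (hz.tendsto_dirDeriv_sub hu hΛ hlip μ)).add h1
  rw [sub_zero, zero_add] at h4
  refine h4.congr fun n => ?_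
  obtain ⟨φ, hφ, he⟩ := exists_approx_eq_gradient n hu.continuous hu.hasGradient
  obtain ⟨ψ, hψ, he'⟩ := exists_approx_eq_gradient n hz.continuous hz.hasGradient
  rw [← he, ← he', Λ.d_apply hΛ μ hφ hψ, PseudoOneForm.dField]
  ring

end IsC1GradientField

section surface

variable {T C : ℝ} {S : ℝ → ℝ → WSpace D} {v w : ℝ → ℝ → E D → E D}
  {v' w' : ℝ × ℝ × E D → ℝ × ℝ × E D →L[ℝ] E D}

lemma IsC11Field.exists_isC1GradientField (hv : IsC11Field T v v' C) (hC : 0 ≤ C)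
    (hg : IsGradientFamily T v) {s t : ℝ} (hp : (s, t) ∈ rect T) :
    ∃ f, IsC1GradientField (v s t) (fun x => (v' (s, t, x)).comp (spaceIncl D)) f C := by
  obtain ⟨f, hf⟩ := hg s hp.1 t hp.2
  exact ⟨f, hf, hv.hasFDerivAt_space hp, (hv.continuous_fderiv hC hp).clm_comp continuous_const,
    hv.norm_le hp, fun x => norm_comp_spaceIncl_le (hv.norm_fderiv_le hp x)⟩

/-- Expansion in the parameters of the approximations of a field. -/
lemma IsC11Field.norm_approx_sub_sub_le (hv : IsC11Field T v v' C) (hC : 0 ≤ C) (n : ℕ)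
    {s t a b h : ℝ} (hp : (s, t) ∈ rect T) (hq : (s + h * a, t + h * b) ∈ rect T)
    (hab : ‖((a, b) : ℝ × ℝ)‖ ≤ 1) (x : E D) :
    ‖approx n (v (s + h * a) (t + h * b)) x - approx n (v s t) x -
      h • approx n (fun x => v' (s, t, x) (a, b, 0)) x‖ ≤ (1 + cutoffBound D) * (C * h ^ 2) := by
  have c1 := hv.continuous_space hp
  have c2 := hv.continuous_space hq
  have c3 : Continuous fun x => v' (s, t, x) (a, b, 0) :=
    (hv.continuous_fderiv hC hp).clm_apply continuous_const
  have e : approx n (v (s + h * a) (t + h * b)) x - approx n (v s t) x -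
      h • approx n (fun x => v' (s, t, x) (a, b, 0)) x =
      approx n (v (s + h * a) (t + h * b) - v s t - h • fun x => v' (s, t, x) (a, b, 0)) x := by
    rw [approx_sub n (c2.sub c1) (c3.const_smul h), approx_sub n c2 c1, approx_smul]
    rfl
  rw [e]
  refine norm_approx_le n (fun y => ?_) x
  have h1 := hv.taylor hC hp hq y y
  have e1 : ((s + h * a - s, t + h * b - t, y - y) : ℝ × ℝ × E D) = h • (a, b, 0) := by
    simp
  have e2 : ((s + h * a - s, t + h * b - t) : ℝ × ℝ) = h • (a, b) := by simp
  rw [e1, e2, map_smul, sub_self, norm_zero, add_zero, norm_smul, mul_pow, Real.norm_eq_abs,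
    sq_abs] at h1
  refine h1.trans ?_
  gcongr
  exact mul_le_of_le_one_right (sq_nonneg h) (pow_le_one₀ (norm_nonneg _) hab)

/-- The derivative in the direction `(a, b)` of `Λ` at the approximations of a field. The direction
is represented by the velocity `u = a w + b v`. -/
lemma IsTransported.hasDerivAt_bar_approx (hS : IsTransported T S v w C) (hC : 0 ≤ C)
    {Λ : OneForm D} (hΛ : Λ.IsDifferentiable) (hbdd : Λ.LocallyBounded)
    (hlip : Λ.LocallyLipschitzOnFields) {u : E D → E D} {f : E D → ℝ}
    {U' : E D → E D →L[ℝ] E D} {z : ℝ → ℝ → E D → E D}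
    {z' : ℝ × ℝ × E D → ℝ × ℝ × E D →L[ℝ] E D} (hz : IsC11Field T z z' C)
    {a b : ℝ} (hab : ‖((a, b) : ℝ × ℝ)‖ ≤ 1) {s t : ℝ} (hp : (s, t) ∈ interior (rect T))
    (hu : IsC1GradientField u U' f C) (huv : ∀ x, u x = a • w s t x + b • v s t x) (n : ℕ) :
    HasDerivAt (fun h => Λ.bar (S (s + h * a) (t + h * b)) (toL2 (S (s + h * a) (t + h * b))
        (approx n (z (s + h * a) (t + h * b)))))
      (dirDeriv u (fun ν => Λ.bar ν (toL2 ν (approx n (z s t)))) (S s t) +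
        Λ.bar (S s t) (toL2 (S s t) (approx n fun x => z' (s, t, x) (a, b, 0)))) 0 := by
  have hpr : (s, t) ∈ rect T := interior_subset hp
  have hG := cutoffBound_nonneg (D := D)
  have hnear : ∀ᶠ h : ℝ in 𝓝 0, (s + h * a, t + h * b) ∈ rect T := by
    have hc : Continuous fun h : ℝ => ((s + h * a, t + h * b) : ℝ × ℝ) := by fun_prop
    refine hc.tendsto 0 ?_
    simpa using mem_interior_iff_mem_nhds.1 hp
  have hCle : C ≤ (1 + cutoffBound D) * C := by nlinarith
  have key := Λ.hasDerivAt_bar hΛ hbdd hlip (σ := fun h => S (s + h * a) (t + h * b)) (τ₀ := 0)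
    (hS.isCompact_image hC) (hnear.mono fun h hh => ⟨_, hh, rfl⟩) hu.isGradientField
    (hu.toL2_mem _) (C := (1 + cutoffBound D) * C) (by positivity) (hnear.mono fun h hh => ?_)
    (X := fun h => approx n (z (s + h * a) (t + h * b)))
    (Y := approx n fun x => z' (s, t, x) (a, b, 0))
    (hnear.mono fun h hh => isTest_approx n (hz.continuous_space hh))
    (isTest_approx n ((hz.continuous_fderiv hC hpr).clm_apply continuous_const))
    (hnear.mono fun h hh x => ?_)
  · beta_reduce at key
    have e1 : s + 0 * a = s := by ring
    have e2 : t + 0 * b = t := by ring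
    rw [e1, e2] at key
    exact key
  · simp only [zero_mul, add_zero, sub_zero]
    obtain ⟨Θ, hΘm, hΘe, hΘb, hΘc⟩ := hS s t _ _ hpr hh
    have e2 : ((s + h * a - s, t + h * b - t) : ℝ × ℝ) = h • (a, b) := by simp
    have hN : ‖((s + h * a - s, t + h * b - t) : ℝ × ℝ)‖ ≤ |h| := by
      rw [e2, norm_smul, Real.norm_eq_abs]
      exact mul_le_of_le_one_right (abs_nonneg h) hab
    refine ⟨Θ, hΘm, hΘe, fun x => (hΘb x).trans (by gcongr), fun x => ?_⟩
    have e3 : h • u x = (s + h * a - s) • w s t x + (t + h * b - t) • v s t x := by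
      rw [huv]; module
    rw [e3, ← sq_abs h]
    exact (hΘc x).trans (by gcongr)
  · simp only [zero_mul, add_zero, sub_zero]
    rw [mul_assoc]
    exact hz.norm_approx_sub_sub_le hC n hpr hh hab x

variable {z : ℝ → ℝ → E D → E D} {z' : ℝ × ℝ × E D → ℝ × ℝ × E D →L[ℝ] E D}

lemma le_approxBound (hC : 0 ≤ C) : C ≤ approxBound D C := by
  have hG := cutoffBound_nonneg (D := D)
  unfold approxBound
  nlinarith [mul_nonneg hG hC]

lemma IsC11Field.norm_approx_sub_le (hz : IsC11Field T z z' C) (hC : 0 ≤ C) (n : ℕ) {s t s' t' : ℝ}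
    (hp : (s, t) ∈ rect T) (hq : (s', t') ∈ rect T) (x : E D) :
    ‖approx n (z s t) x - approx n (z s' t') x‖ ≤
      approxBound D C * ‖((s - s', t - t') : ℝ × ℝ)‖ := by
  have hG := cutoffBound_nonneg (D := D)
  have e : approx n (z s t) x - approx n (z s' t') x = approx n (z s t - z s' t') x := by
    rw [approx_sub n (hz.continuous_space hp) (hz.continuous_space hq)]
    rfl
  rw [e]
  refine (norm_approx_le n (M := C * ‖((s - s', t - t') : ℝ × ℝ)‖) (fun y => ?_) x).trans ?_
  · simpa using hz.lipschitz hC hp hq y y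
  · rw [← mul_assoc]
    gcongr
    unfold approxBound
    nlinarith [mul_nonneg hG hC]

lemma mem_interior_rect {s t : ℝ} (hs : s ∈ Ioo (0 : ℝ) 1) (ht : t ∈ Ioo 0 T) :
    (s, t) ∈ interior (rect T) := by
  rw [rect, interior_prod_eq, interior_Icc, interior_Icc]
  exact ⟨hs, ht⟩

/-- In the limit of the approximations, the bracket of `w` and `v` is compensated by the derivatives
of `v` and `w` in the parameters, since the velocities commute. -/
lemma IsTransported.tendsto_bar_lieBracket (hS : IsTransported T S v w C) (hC : 0 ≤ C)
    (hv : IsC11Field T v v' C) (hw : IsC11Field T w w' C) (hgv : IsGradientFamily T v)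
    (hgw : IsGradientFamily T w) (Λ : OneForm D) {s t : ℝ} (hp : (s, t) ∈ interior (rect T)) :
    Tendsto (fun n =>
      Λ.bar (S s t) (toL2 (S s t)
        (VectorField.lieBracket ℝ (approx n (w s t)) (approx n (v s t)))) +
      Λ.bar (S s t) (toL2 (S s t) (approx n fun x => v' (s, t, x) (1, 0, 0))) -
      Λ.bar (S s t) (toL2 (S s t) (approx n fun x => w' (s, t, x) (0, 1, 0)))) atTop (𝓝 0) := by
  have hpr : (s, t) ∈ rect T := interior_subset hp
  obtain ⟨f, hvC⟩ := hv.exists_isC1GradientField hC hgv hpr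
  obtain ⟨k, hwC⟩ := hw.exists_isC1GradientField hC hgw hpr
  have cv := hv.continuous_space hpr
  have cw := hw.continuous_space hpr
  have cv' := hv.continuous_fderiv hC hpr
  have cw' := hw.continuous_fderiv hC hpr
  have ca : Continuous fun x => v' (s, t, x) (1, 0, 0) := cv'.clm_apply continuous_const
  have cb : Continuous fun x => w' (s, t, x) (0, 1, 0) := cw'.clm_apply continuous_const
  have ba : ∀ x, ‖v' (s, t, x) (1, 0, 0)‖ ≤ C := fun x => by
    have := (v' (s, t, x)).le_of_opNorm_le (hv.norm_fderiv_le hpr x) (1, 0, 0)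
    simpa [Prod.norm_def] using this
  have bb : ∀ x, ‖w' (s, t, x) (0, 1, 0)‖ ≤ C := fun x => by
    have := (w' (s, t, x)).le_of_opNorm_le (hw.norm_fderiv_le hpr x) (0, 1, 0)
    simpa [Prod.norm_def] using this
  -- the limit of the fields, which is orthogonal to all gradients
  set Z : E D → E D := fun x =>
    v' (s, t, x) (1, 0, w s t x) - w' (s, t, x) (0, 1, v s t x) with hZ
  have hZc : Continuous Z :=
    (cv'.clm_apply (by fun_prop)).sub (cw'.clm_apply (by fun_prop))
  set X : ℕ → E D → E D := fun n =>
    VectorField.lieBracket ℝ (approx n (w s t)) (approx n (v s t)) +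
      (approx n fun x => v' (s, t, x) (1, 0, 0)) - approx n fun x => w' (s, t, x) (0, 1, 0) with hX
  have tv := fun n => isTest_approx n cv
  have tw := fun n => isTest_approx n cw
  have ta := fun n => isTest_approx n ca
  have tb := fun n => isTest_approx n cb
  have tl := fun n => (tw n).lieBracket (tv n)
  set A := approxBound D C with hA
  have hA0 : 0 ≤ A := hC.trans (le_approxBound hC)
  have hXM : ∀ n x, ‖X n x‖ ≤ A * A + A * A + A + A := fun n x => by
    have b1 := (fderiv ℝ (approx n (v s t)) x).le_of_opNorm_le_of_le
      (hvC.norm_fderiv_approx_le n x) (norm_approx_le_approxBound n hwC.norm_le x)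
    have b2 := (fderiv ℝ (approx n (w s t)) x).le_of_opNorm_le_of_le
      (hwC.norm_fderiv_approx_le n x) (norm_approx_le_approxBound n hvC.norm_le x)
    exact (norm_sub_le _ _).trans (add_le_add ((norm_add_le _ _).trans (add_le_add
      ((norm_sub_le _ _).trans (add_le_add b1 b2)) (norm_approx_le_approxBound n ba x)))
      (norm_approx_le_approxBound n bb x))
  have hXZ : ∀ x, Tendsto (fun n => X n x) atTop (𝓝 (Z x)) := fun x => by
    have l1 : Tendsto (fun n => fderiv ℝ (approx n (v s t)) x (approx n (w s t) x)) atTop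
        (𝓝 ((v' (s, t, x)).comp (spaceIncl D) (w s t x))) :=
      (isBoundedBilinearMap_apply.continuous.tendsto (_, _)).comp
        ((hvC.tendsto_fderiv_approx x).prodMk_nhds (tendsto_approx cw x))
    have l2 : Tendsto (fun n => fderiv ℝ (approx n (w s t)) x (approx n (v s t) x)) atTop
        (𝓝 ((w' (s, t, x)).comp (spaceIncl D) (v s t x))) :=
      (isBoundedBilinearMap_apply.continuous.tendsto (_, _)).comp
        ((hwC.tendsto_fderiv_approx x).prodMk_nhds (tendsto_approx cv x))
    have l3 := ((l1.sub l2).add (tendsto_approx ca x)).sub (tendsto_approx cb x)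
    have e1 : v' (s, t, x) (1, 0, w s t x) =
        v' (s, t, x) (0, 0, w s t x) + v' (s, t, x) (1, 0, 0) := by
      rw [← map_add]; simp
    have e2 : w' (s, t, x) (0, 1, v s t x) =
        w' (s, t, x) (0, 0, v s t x) + w' (s, t, x) (0, 1, 0) := by
      rw [← map_add]; simp
    have e : Z x = (v' (s, t, x)).comp (spaceIncl D) (w s t x) -
        (w' (s, t, x)).comp (spaceIncl D) (v s t x) + v' (s, t, x) (1, 0, 0) -
        w' (s, t, x) (0, 1, 0) := by
      simp only [hZ, e1, e2, ContinuousLinearMap.comp_apply, spaceIncl_apply]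
      abel
    rw [e]
    exact l3
  have hXc : ∀ n, Continuous (X n) := fun n =>
    ((tl n).1.continuous.add (ta n).1.continuous).sub (tb n).1.continuous
  have hlim := ((Λ.bar (S s t)).continuous.tendsto _).comp (tendsto_toL2 (S s t) hXc hZc hXM hXZ)
  have hZ0 : Λ.bar (S s t) (toL2 (S s t) Z) = 0 := by
    have hZm : MemLp Z 2 (S s t).toMeasure :=
      MemLp.of_bound hZc.aestronglyMeasurable (A * A + A * A + A + A) (Eventually.of_forall fun x =>
        le_of_tendsto' (hXZ x).norm fun n => hXM n x)
    have h1 : tangentProj (S s t) (toL2 (S s t) Z) = 0 :=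
      tangentProj_eq_zero hZm fun φ hφ => hS.integral_commutator hC hv hw hφ hp
    change Λ (S s t) (tangentProj (S s t) (toL2 (S s t) Z)) = 0
    rw [h1, map_zero]
  rw [hZ0] at hlim
  refine hlim.congr fun n => ?_
  have m1 := (tl n).memLp (S s t)
  have m2 := (ta n).memLp (S s t)
  have m3 := (tb n).memLp (S s t)
  change Λ.bar (S s t) (toL2 (S s t) (X n)) = _
  rw [hX]
  beta_reduce
  rw [toL2_sub _ (m1.add m2) m3, toL2_add _ m1 m2, map_sub, map_add]

lemma hasDerivAt_comp_sub_self {p : ℝ → ℝ} {d : ℝ} (x : ℝ) (h : HasDerivAt p d 0) :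
    HasDerivAt (fun y => p (y - x)) d x :=
  HasDerivAt.comp_sub_const x x (by rwa [sub_self])

/-- Stokes' formula, with the integrability of all integrands: Green's formula for the functions
`(s, t) ↦ Λ(v)` and `(s, t) ↦ Λ(w)`, as limits of the same functions for approximations of `v` and
`w`. -/
theorem IsSmoothSurface.stokes (hT : 0 < T) {Λ : OneForm D} (hΛ : Λ.IsDifferentiable)
    (hbdd : Λ.LocallyBounded) (hlip : Λ.LocallyLipschitzOnFields) (hS : IsSmoothSurface T S v w) :
    IntegrableOn (fun p : ℝ × ℝ => Λ.dSurface S v w p.1 p.2)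
      (Icc (0 : ℝ) 1 ×ˢ Icc (0 : ℝ) T) ∧
    (∀ s ∈ Icc (0 : ℝ) 1, IntervalIntegrable
      (fun t => Λ.bar (S s t) (toL2 (S s t) (v s t))) volume 0 T) ∧
    (∀ t ∈ Icc (0 : ℝ) T, IntervalIntegrable
      (fun s => Λ.bar (S s t) (toL2 (S s t) (w s t))) volume 0 1) ∧
    Λ.surfaceIntegral T S v w = Λ.boundaryIntegral T S v w := by
  obtain ⟨v', w', C, hC, hv, hw, htr⟩ := hS.exists_isTransported hT
  obtain ⟨Q, hQ⟩ := htr.exists_lipschitz_bar hC hbdd hlip hT.le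
  have hfam : ∀ {z : ℝ → ℝ → E D → E D} {z' : ℝ × ℝ × E D → ℝ × ℝ × E D →L[ℝ] E D},
      IsC11Field T z z' C →
      ∀ s t s' t', (s, t) ∈ rect T → (s', t') ∈ rect T →
        |Λ.bar (S s t) (toL2 (S s t) (z s t)) - Λ.bar (S s' t') (toL2 (S s' t') (z s' t'))| ≤
          Q * C * ‖((s - s', t - t') : ℝ × ℝ)‖ := fun {z z'} hz =>
    (hQ z C (fun s t hp => ⟨fun x => (hz.hasFDerivAt_space hp x).differentiableAt, hz.norm_le hp,
      fun x => by
        rw [(hz.hasFDerivAt_space hp x).fderiv]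
        exact IsC11Field.norm_comp_spaceIncl_le (hz.norm_fderiv_le hp x)⟩)
      fun s t s' t' hp hq x => by simpa using hz.lipschitz hC hp hq x x).1
  have hfamA : ∀ {z : ℝ → ℝ → E D → E D} {z' : ℝ × ℝ × E D → ℝ × ℝ × E D →L[ℝ] E D},
      IsC11Field T z z' C → IsGradientFamily T z → ∀ n, _ := fun {z z'} hz hg n =>
    hQ (fun s t => approx n (z s t)) (approxBound D C) (fun s t hp => by
      obtain ⟨f, hf⟩ := hz.exists_isC1GradientField hC hg hp
      exact ⟨(isTest_approx n hf.continuous).differentiable,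
        norm_approx_le_approxBound n hf.norm_le, hf.norm_fderiv_approx_le n⟩)
      fun s t s' t' hp hq x => hz.norm_approx_sub_le hC n hp hq x
  have hline : ∀ {k : ℝ → ℝ} {c : ℝ}, 0 ≤ c →
      (∀ x ∈ Icc 0 c, ∀ y ∈ Icc 0 c, |k x - k y| ≤ Q * C * |x - y|) →
      IntervalIntegrable k volume 0 c := fun {k c} hc hk => by
    have : LipschitzOnWith (Q * C).toNNReal k (Icc 0 c) :=
      LipschitzOnWith.of_dist_le_mul fun x hx y hy => by
        rw [Real.dist_eq, Real.dist_eq]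
        exact (hk x hx y hy).trans (by gcongr; exact Real.le_coe_toNNReal _)
    refine ContinuousOn.intervalIntegrable ?_
    rw [uIcc_of_le hc]
    exact this.continuousOn
  have hlim : ∀ {z : ℝ → ℝ → E D → E D} {z' : ℝ × ℝ × E D → ℝ × ℝ × E D →L[ℝ] E D},
      IsC11Field T z z' C → ∀ s t, (s, t) ∈ rect T →
      Tendsto (fun n => Λ.bar (S s t) (toL2 (S s t) (approx n (z s t)))) atTop
        (𝓝 (Λ.bar (S s t) (toL2 (S s t) (z s t)))) := fun {z z'} hz s t hp =>
    ((Λ.bar (S s t)).continuous.tendsto _).comp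
      (tendsto_toL2_approx (S s t) (hz.continuous_space hp) (hz.norm_le hp))
  -- derivatives of the approximations in the two parameters
  have hder_s : ∀ n, ∀ s ∈ Ioo (0 : ℝ) 1, ∀ t ∈ Ioo 0 T,
      HasDerivAt (fun s => Λ.bar (S s t) (toL2 (S s t) (approx n (v s t))))
        (dirDeriv (w s t) (fun ν => Λ.bar ν (toL2 ν (approx n (v s t)))) (S s t) +
          Λ.bar (S s t) (toL2 (S s t) (approx n fun x => v' (s, t, x) (1, 0, 0)))) s := by
    intro n s hs t ht
    have hp := mem_interior_rect hs ht
    obtain ⟨f, hf⟩ := hw.exists_isC1GradientField hC hS.grad_w (interior_subset hp)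
    have h := htr.hasDerivAt_bar_approx hC hΛ hbdd hlip hv (a := 1) (b := 0)
      (by simp [Prod.norm_def]) hp hf (by simp) n
    set P : ℝ → ℝ → ℝ := fun s t => Λ.bar (S s t) (toL2 (S s t) (approx n (v s t))) with hP
    change HasDerivAt (fun h => P (s + h * 1) (t + h * 0)) _ 0 at h
    change HasDerivAt (fun s => P s t) _ s
    refine (hasDerivAt_comp_sub_self s h).congr_of_eventuallyEq (Eventually.of_forall fun s' => ?_)
    simp
  have hder_t : ∀ n, ∀ s ∈ Ioo (0 : ℝ) 1, ∀ t ∈ Ioo 0 T,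
      HasDerivAt (fun t => Λ.bar (S s t) (toL2 (S s t) (approx n (w s t))))
        (dirDeriv (v s t) (fun ν => Λ.bar ν (toL2 ν (approx n (w s t)))) (S s t) +
          Λ.bar (S s t) (toL2 (S s t) (approx n fun x => w' (s, t, x) (0, 1, 0)))) t := by
    intro n s hs t ht
    have hp := mem_interior_rect hs ht
    obtain ⟨f, hf⟩ := hv.exists_isC1GradientField hC hS.grad_v (interior_subset hp)
    have h := htr.hasDerivAt_bar_approx hC hΛ hbdd hlip hw (a := 0) (b := 1)
      (by simp [Prod.norm_def]) hp hf (by simp) n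
    set P : ℝ → ℝ → ℝ := fun s t => Λ.bar (S s t) (toL2 (S s t) (approx n (w s t))) with hP
    change HasDerivAt (fun h => P (s + h * 0) (t + h * 1)) _ 0 at h
    change HasDerivAt (fun t => P s t) _ t
    refine (hasDerivAt_comp_sub_self t h).congr_of_eventuallyEq (Eventually.of_forall fun t' => ?_)
    simp
  have main := integral_rect_of_tendsto hT (L := Q * approxBound D C) (B := Q * approxBound D C)
    (G := fun s t => Λ.bar (S s t) (toL2 (S s t) (v s t)))
    (H := fun s t => Λ.bar (S s t) (toL2 (S s t) (w s t))) (d := Λ.dSurface S v w)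
    (fun n => (hfamA hv hS.grad_v n).1) (fun n => (hfamA hw hS.grad_w n).1)
    (fun n => (hfamA hv hS.grad_v n).2) (fun n => (hfamA hw hS.grad_w n).2)
    (hlim hv) (hlim hw) hder_s hder_t fun s hs t ht => ?_
  · refine ⟨main.1, fun s hs => hline hT.le fun x hx y hy => ?_,
      fun t ht => hline zero_le_one fun x hx y hy => ?_, main.2⟩
    · simpa [Prod.norm_def] using hfam hv s x s y ⟨hs, hx⟩ ⟨hs, hy⟩
    · simpa [Prod.norm_def] using hfam hw x t y t ⟨hx, ht⟩ ⟨hy, ht⟩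
  · have hp := mem_interior_rect hs ht
    obtain ⟨f, hf⟩ := hv.exists_isC1GradientField hC hS.grad_v (interior_subset hp)
    obtain ⟨k, hk⟩ := hw.exists_isC1GradientField hC hS.grad_w (interior_subset hp)
    have h1 := (hk.tendsto_d hf hΛ hlip (S s t)).add
      (htr.tendsto_bar_lieBracket hC hv hw hS.grad_v hS.grad_w Λ hp)
    rw [add_zero] at h1
    -- the derivatives in `hder_s` and `hder_t` differ by the expression for `dΛ` plus the bracket
    -- and the terms that compensate it
    refine h1.congr fun n => ?_
    ring

end surface

end WassersteinCalculus

end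

theorem mainTheorem4 (D : ℕ) (T : ℝ) (hT : 0 < T)
    (Λ : WassersteinCalculus.OneForm D)
    (hdiff : Λ.IsDifferentiable)
    (hbdd : Λ.LocallyBounded)
    (hlip : Λ.LocallyLipschitzOnFields)
    (hdbdd : Λ.DLocallyBounded)
    (S : ℝ → ℝ → WassersteinCalculus.WSpace D)
    (v w : ℝ → ℝ → WassersteinCalculus.E D → WassersteinCalculus.E D)
    (hS : WassersteinCalculus.IsSmoothSurface T S v w) :
    IntegrableOn (fun p : ℝ × ℝ => Λ.dSurface S v w p.1 p.2)
      (Icc (0 : ℝ) 1 ×ˢ Icc (0 : ℝ) T) ∧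
    (∀ s ∈ Icc (0 : ℝ) 1, IntervalIntegrable
      (fun t => Λ.bar (S s t) (WassersteinCalculus.toL2 (S s t) (v s t))) volume 0 T) ∧
    (∀ t ∈ Icc (0 : ℝ) T, IntervalIntegrable
      (fun s => Λ.bar (S s t) (WassersteinCalculus.toL2 (S s t) (w s t))) volume 0 1) ∧
    Λ.surfaceIntegral T S v w = Λ.boundaryIntegral T S v w := by
  exact hS.stokes hT hdiff hbdd hlip
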